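/- **Model.** $M(v)$, $v$ a power of two, consists of $v$ processing elements (PEs) $P_0,\dots,P_{v-1}$, each with its own memory. An algorithm is a sequence of supersteps, each with a label $i\in\{0,\dots,\log_2 v-1\}$; in an $i$-superstep each PE performs local computation and sends messages, which are available from the next superstep on, and only to PEs whose index agrees with its own in the $i$ most significant bits. A message carries at most $c$ keys (and other data), for a constant $c\ge 1$. The $n$-sort problem is to label $n$ distinct keys with their ranks (numbers of smaller keys), using only comparisons between keys held by the same PE. Folding an algorithm for $M(v)$ onto $M(p)$, $p\le v$ a power of two, means that $P_j$ of $M(p)$ carries out the operations of the $v/p$ PEs $P_{jv/p},\dots,P_{(j+1)v/p-1}$; supersteps with label $\ge\log_2 p$ become local computation. An algorithm is static if the sequence of labels and, for each superstep, the source-destination pairs of its messages are the same for all inputs of the same size $n$. The communication time of $\mathcal A$ on a D-BSP$(p,\mathbf g,\boldsymbol\ell)$, $p\ge2$, with $\mathbf g=(g_0,\dots,g_{\log_2 p-1})$, $g_i>0$, and $\boldsymbol\ell=(\ell_0,\dots,\ell_{\log_2 p-1})$, $\ell_i\ge0$, is $$D_{\mathcal A}(n,p,\mathbf g,\boldsymbol\ell)=\max_{|I|=n}\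 \sum_{i=0}^{\log_2 p-1}\bigl(F^i_{\mathcal A}(I,p)\,g_i+S^i_{\mathcal A}(I)\,\ell_i\bigr),$$ where $S^i$ is the number of $i$-supersteps, and $F^i$ is the sum, over the $i$-supersteps of the algorithm folded onto $p$ PEs, of the maximum number of messages sent by, or destined to, any one PE (messages within a PE not counted). **Class.** Fix $0<\varepsilon<1$ and constants $\kappa,c\ge1$. $\mathscr C$ is the class of static $n$-sort algorithms such that (i) initially each key is in exactly one PE, and at any time (at the superstep boundaries) there are at most $\kappa$ copies of each key; (ii) no PE performs more than $\varepsilon n\max\{1,\log_2 n\}$ comparisons; (iii) all foldings onto $q'\ge 2$ PEs ($q'$ a power of two) satisfy these conditions too. **Algorithm.** Let $n=2^k$, $k\ge 1$. Recursive Columnsort is specified on $M(n)$, with one input key per PE. A segment of $2^m$ consecutive PEs sorts the $2^m$ keys it holds as follows. If $m\le2$, the first PE collects the keys, sorts them, and sends the key of rank $y$ to position $y$ of the segment. If $m\ge3$, let $r$ be the smallest power of two with $r\ge 2^{2m/3}$ and $s=2^m/r$, and regard the keys as an $r\times s$ matrix stored by columns, a column being a subsegment of $r$ PEs. In Phases 1,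 3, 5, 7 all columns are sorted recursively. The other phases permute the keys, each in one superstep: Phase 2 picks them up in column-major and sets them down in row-major order; Phase 4 picks them up by antidiagonals and sets them down in column-major order; Phase 6 is the cyclic shift by $r/2$ positions in column-major order, after which, in the first column, the first $r/2$ keys count as smaller than the last $r/2$; Phase 8 undoes Phase 6. All segments of the same size act in parallel, the supersteps of segments of size $2^m$ have label $k-m$, and in each of them, moreover, $P_j$ sends a dummy message to $P_{j+2^m/2}$ for $0\le j<2^m/2$. **Claim.** 1. For every $n=2^k$, $k\ge1$, recursive Columnsort is a static algorithm that solves the $n$-sort problem and satisfies (i). 2. For every $\eta>0$, for all sufficiently large $n=2^k$ (depending on $\varepsilon,\eta$), the foldings of recursive Columnsort onto $q\le n$ PEs, $q\ge n^{\eta}$ a power of two, satisfy (ii). 3. For all $\delta\in(0,1)$ and $C>0$ there are $\beta\in(0,1]$ and $N$, depending only on $\delta,C,\varepsilon,\kappa,c$, such that for all $n=2^k\ge N$, every power of two $p\ge 2$ with $p\le C\,n^{1-\delta}$, all $g_i>0$ and $\ell_i\ge0$ for which $(g_i)_i$ and $(\ell_i/g_i)_i$ are non-increasing, and every algorithm $\mathcal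 B\in\mathscr C$ for $p$ PEs, or for more than $p$ PEs and folded onto $p$, $$D_{\text{Columnsort}}(n,p,\mathbf g,\boldsymbol\ell)\le\frac1\beta\,D_{\mathcal B}(n,p,\mathbf g,\boldsymbol\ell).$$ -/

import Mathlib

namespace NetObl

/-! ### Comparison-based local computations -/

/-- A local computation using only comparisons among `n` keys: a finite decision tree whose inner
nodes compare two keys (keys are referred to by their position in the input) and whose leaves
return a result. -/
inductive CmpTree (n : ℕ) (R : Type) : Type where
  | done (res : R) : CmpTree n R
  | cmp (a b : Fin n) (next : Bool → CmpTree n R) : CmpTree n R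

/-- An instance of the `n`-sort problem: a sequence of `n` distinct keys. -/
abbrev Input (n : ℕ) : Type := Fin n ↪ ℕ

/-- The rank of a key: the number of smaller keys in the input sequence. -/
def Input.rank {n : ℕ} (x : Input n) (a : Fin n) : ℕ :=
  (Finset.univ.filter fun b => x b < x a).card

namespace CmpTree

variable {n : ℕ} {R R' : Type}

/-- The result of the computation on input `x`. -/
def run (x : Input n) : CmpTree n R → R
  | done res => res
  | cmp a b next => (next (decide (x a < x b))).run x

/-- The number of comparisons performed on input `x`. -/
def cost (x : Input n) : CmpTree n R → ℕ
  | done _ => 0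
  | cmp a b next => (next (decide (x a < x b))).cost x + 1

/-- On input `x`, only keys in `held` are compared. -/
def Uses (x : Input n) (held : List (Fin n)) : CmpTree n R → Prop
  | done _ => True
  | cmp a b next => a ∈ held ∧ b ∈ held ∧ (next (decide (x a < x b))).Uses x held

/-- Sequential composition. -/
def bind : CmpTree n R → (R → CmpTree n R') → CmpTree n R'
  | done res, f => f res
  | cmp a b next, f => cmp a b fun t => (next t).bind f

end CmpTree

/-! ### The machine with `2 ^ k` processing elements -/

/-- A message: its destination, the keys (copies of keys) it carries, and a word of other data. -/
structure Msg (n k : ℕ) where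
  dst : Fin (2 ^ k)
  keys : List (Fin n)
  word : ℕ

/-- What a processing element has at the beginning of a superstep: information other than keys,
the copies of keys in its local memory, and the messages sent to it in the preceding superstep. -/
structure PEState (n k : ℕ) (S : Type) where
  info : S
  keys : List (Fin n)
  inbox : List (Msg n k)

/-- What the local computation of a superstep produces: the information and the copies of keys
that stay in the local memory, and the messages that are sent. -/
structure Outcome (n k : ℕ) (S : Type) where
  info : S
  keys : List (Fin n)
  sent : List (Msg n k)

/-- All copies of keys present at a processing element. -/
def PEState.held {n k : ℕ} {S : Type} (st : PEState n k S) : List (Fin n) :=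
  st.keys ++ st.inbox.flatMap Msg.keys

/-- The index formed by the `i` most significant bits of the `k`-bit index `r`. Thus `topBits i r`
is the `i`-cluster containing the processing element `r`, and also the processor that carries out
the operations of `r` when the machine is folded onto `2 ^ i` processors. -/
def topBits {k : ℕ} (i : ℕ) (r : Fin (2 ^ k)) : ℕ := r.val / 2 ^ (k - i)

/-- A comparison-based algorithm for `n` keys and `2 ^ k` processing elements whose sequence of
superstep labels is the same for all processing elements and all inputs (of size `n`). Each key is
initially stored in exactly one processing element (`home`). `body t r` is the local computation
of the processing element `r` in superstep `t`; superstep `t` ends with a sync with label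
`labels[t]`. At the end, `answer r st a` is the label (if any) that the processing element `r`,
when in state `st`, attaches to key `a`. -/
structure SortAlg (n k : ℕ) where
  State : Type
  home : Fin n → Fin (2 ^ k)
  init : Fin (2 ^ k) → State
  labels : List ℕ
  body : ℕ → Fin (2 ^ k) → PEState n k State → CmpTree n (Outcome n k State)
  answer : Fin (2 ^ k) → PEState n k State → Fin n → Option ℕ

namespace SortAlg

variable {n k : ℕ}

/-- The configuration at the beginning of superstep `t` on input `x`. -/
def config (A : SortAlg n k) (x : Input n) : ℕ → Fin (2 ^ k) → PEState n k A.State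
  | 0 => fun r => ⟨A.init r, (List.finRange n).filter fun a => A.home a = r, []⟩
  | t + 1 => fun r =>
      let out := fun s => (A.body t s (A.config x t s)).run x
      ⟨(out r).info, (out r).keys,
        (List.finRange (2 ^ k)).flatMap fun s => (out s).sent.filter fun m => m.dst = r⟩

/-- The outcome of superstep `t` at processing element `r` on input `x`. -/
def outcome (A : SortAlg n k) (x : Input n) (t : ℕ) (r : Fin (2 ^ k)) : Outcome n k A.State :=
  (A.body t r (A.config x t r)).run x

/-- The algorithm respects the rules of the machine: labels are in range; a processing element
compares, keeps and sends only keys that it holds; a message carries at most `c` keys; in an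
`i`-superstep messages are only sent within `i`-clusters. -/
structure Legal (A : SortAlg n k) (c : ℕ) : Prop where
  label_lt : ∀ i ∈ A.labels, i < k
  compares : ∀ (x : Input n) (t : Fin A.labels.length) (r : Fin (2 ^ k)),
    (A.body t r (A.config x t r)).Uses x (A.config x t r).held
  keeps : ∀ (x : Input n) (t : Fin A.labels.length) (r : Fin (2 ^ k)),
    ∀ a ∈ (A.outcome x t r).keys, a ∈ (A.config x t r).held
  sends : ∀ (x : Input n) (t : Fin A.labels.length) (r : Fin (2 ^ k)),
    ∀ m ∈ (A.outcome x t r).sent, ∀ a ∈ m.keys, a ∈ (A.config x t r).held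
  size_le : ∀ (x : Input n) (t : Fin A.labels.length) (r : Fin (2 ^ k)),
    ∀ m ∈ (A.outcome x t r).sent, m.keys.length ≤ c
  cluster : ∀ (x : Input n) (t : Fin A.labels.length) (r : Fin (2 ^ k)),
    ∀ m ∈ (A.outcome x t r).sent, topBits (A.labels.get t) m.dst = topBits (A.labels.get t) r

/-- The algorithm labels every key with its rank. -/
def Solves (A : SortAlg n k) : Prop :=
  ∀ (x : Input n) (a : Fin n),
    (∃ r, A.answer r (A.config x A.labels.length r) a = some (x.rank a)) ∧
      ∀ r b, A.answer r (A.config x A.labels.length r) a = some b → b = x.rank a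

/-- The number of messages sent from `s` to `d` in superstep `t` on input `x`. -/
def traffic (A : SortAlg n k) (x : Input n) (t : ℕ) (s d : Fin (2 ^ k)) : ℕ :=
  (A.outcome x t s).sent.countP fun m => m.dst = d

/-- The algorithm is static: the source-destination pairs of the messages of each superstep are
the same, with multiplicities, for all inputs of size `n` (the number and the labels of the
supersteps are the same by the definition of `SortAlg`). -/
def Static (A : SortAlg n k) : Prop :=
  ∀ (x y : Input n) (t : Fin A.labels.length) (s d : Fin (2 ^ k)),
    A.traffic x t s d = A.traffic y t s d

/-- The number of copies of the key `a`, in local memories or in messages, at the beginning of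
superstep `t` on input `x`. -/
def copies (A : SortAlg n k) (x : Input n) (t : ℕ) (a : Fin n) : ℕ :=
  ∑ r, (A.config x t r).held.count a

/-- At any time there are at most `κ` copies of each key. -/
def CopiesLE (A : SortAlg n k) (κ : ℕ) : Prop :=
  ∀ (x : Input n) (t : ℕ), t ≤ A.labels.length → ∀ a, A.copies x t a ≤ κ

/-- The number of comparisons performed by processor `P` on input `x` when the algorithm is
folded onto `2 ^ j` processors. -/
def comparisons (A : SortAlg n k) (j : ℕ) (x : Input n) (P : ℕ) : ℕ :=
  ∑ r with topBits j r = P, ∑ t : Fin A.labels.length, (A.body t r (A.config x t r)).cost x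

/-- When the algorithm is folded onto `2 ^ j` processors, no processor performs more than
`ε n log n` comparisons, where `log x` stands for `max 1 (log₂ x)`. -/
def WorkLE (A : SortAlg n k) (ε : ℝ) (j : ℕ) : Prop :=
  ∀ (x : Input n) (P : ℕ), (A.comparisons j x P : ℝ) ≤ ε * n * max 1 (Real.logb 2 n)

/-- The class of static algorithms for `n`-sort such that no key is initially replicated (which is
part of the definition of `SortAlg`), at any time there are at most `κ` copies of each key, no
processing element performs more than `ε n log n` comparisons, and all foldings onto `q'`
processing elements, `2 ≤ q' ≤ 2 ^ k` a power of two, have these properties too. (The bound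
on the number of copies is inherited by foldings.) Messages carry at most `c` keys. -/
structure InClass (A : SortAlg n k) (ε : ℝ) (κ c : ℕ) : Prop where
  legal : A.Legal c
  solves : A.Solves
  static : A.Static
  copies : A.CopiesLE κ
  work : ∀ j, 1 ≤ j → j ≤ k → A.WorkLE ε j

/-! ### Communication time of foldings on D-BSP machines -/

/-- The number of messages sent in superstep `t` by processor `P` to other processors, when the
algorithm is folded onto `2 ^ j` processors. -/
def sentBy (A : SortAlg n k) (j : ℕ) (x : Input n) (t P : ℕ) : ℕ :=
  ∑ s with topBits j s = P, ∑ d with topBits j d ≠ P, A.traffic x t s d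

/-- The number of messages destined in superstep `t` to processor `P` from other processors, when
the algorithm is folded onto `2 ^ j` processors. -/
def receivedBy (A : SortAlg n k) (j : ℕ) (x : Input n) (t P : ℕ) : ℕ :=
  ∑ s with topBits j s ≠ P, ∑ d with topBits j d = P, A.traffic x t s d

/-- The degree of superstep `t` of the algorithm folded onto `2 ^ j` processors: the maximum number
of messages sent by, or destined to, any processor. -/
def degree (A : SortAlg n k) (j : ℕ) (x : Input n) (t : ℕ) : ℕ :=
  (Finset.range (2 ^ j)).sup fun P => max (A.sentBy j x t P) (A.receivedBy j x t P)

/-- The cumulative degree of all `i`-supersteps on `2 ^ j` processors. -/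
def cumDegree (A : SortAlg n k) (j : ℕ) (x : Input n) (i : ℕ) : ℕ :=
  ∑ t : Fin A.labels.length with A.labels.get t = i, A.degree j x t

/-- The number of `i`-supersteps. -/
def numSupersteps (A : SortAlg n k) (i : ℕ) : ℕ := A.labels.count i

/-- The communication time, maximised over the inputs of size `n`, of the algorithm folded onto
the D-BSP machine with `2 ^ j` processors and parameters `g` and `ℓ`. -/
noncomputable def commTime (A : SortAlg n k) (j : ℕ) (g ℓ : Fin j → ℝ) : ℝ :=
  ⨆ x : Input n, ∑ i : Fin j, (A.cumDegree j x i * g i + A.numSupersteps i * ℓ i)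

end SortAlg

/-! ### The network-oblivious sorting algorithm (recursive Columnsort) -/

/-- A superstep in which each segment of `2 ^ m` consecutive virtual processors acts on its own:
* `route m f retag`: the processor at position `y` of a segment sends its key to position `f y`
  of the segment, changing the tag `τ` of the key to `retag y τ`;
* `gather m`: all processors of a segment send their keys to the first one;
* `solve m`: the first processor of a segment sorts the keys it has received, and sends the key of
  rank `y` to position `y` of the segment. -/
inductive Op : Type where
  | route (m : ℕ) (f : ℕ → ℕ) (retag : ℕ → ℕ → ℕ) : Op
  | gather (m : ℕ) : Op
  | solve (m : ℕ) : Op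

/-- The binary logarithm of the size of the segments. -/
def Op.logSize : Op → ℕ
  | route m _ _ => m
  | gather m => m
  | solve m => m

/-! Position `y` of a segment of `r * s` processors holds the entry in row `y % r` and column
`y / r` of an `r × s` matrix, so that each column is stored in a segment of `r` consecutive
processors. -/

/-- Transposition maintaining the `r × s` shape: the entries are picked up in column-major order
and set down in row-major order. -/
def transposePos (r s y : ℕ) : ℕ := (y % s) * r + y / s

/-- Diagonalizing permutation: the entries are picked up diagonal by diagonal (a diagonal consists
of the entries with a given sum of row and column indices, and is scanned by increasing row) and
set down in column-major order. -/
def diagonalPos (r s y : ℕ) : ℕ :=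
  ((Finset.range (r * s)).filter fun z =>
    z % r + z / r < y % r + y / r ∨ (z % r + z / r = y % r + y / r ∧ z % r < y % r)).card

/-- The cyclic shift by `r / 2` positions, and its inverse. -/
def shiftPos (r s y : ℕ) : ℕ := (y + r / 2) % (r * s)

def unshiftPos (r s y : ℕ) : ℕ := (y + (r * s - r / 2)) % (r * s)

/-- After the shift, in the first column, the first `r / 2` keys are to be considered smaller than
the last `r / 2` keys: the latter get a tag bit, more significant than all previous ones, which are
the `depth` lowest bits. -/
def shiftTag (r s depth y τ : ℕ) : ℕ :=
  if r / 2 ≤ shiftPos r s y ∧ shiftPos r s y < r then τ + 2 ^ depth else τ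

/-- The sequence of supersteps that sorts each segment of `2 ^ m` keys, at recursion depth `depth`.
With `n = 2 ^ m`, the keys form an `r × s` matrix, where `r` is the smallest power of two that is at
least `n ^ (2 / 3)`, and `r * s = n`. In Phases 1, 3, 5 and 7 the columns are sorted recursively;
Phases 2, 4, 6 and 8 permute the keys. The recursion stops at segments of constant size. -/
def schedule (m depth : ℕ) : List Op :=
  if m ≤ 2 then [.gather m, .solve m]
  else
    let m' := (2 * m + 2) / 3
    let r := 2 ^ m'
    let s := 2 ^ (m - m')
    let sortColumns := schedule m' (depth + 1)
    sortColumns ++ [.route m (transposePos r s) fun _ τ => τ] ++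
    sortColumns ++ [.route m (diagonalPos r s) fun _ τ => τ] ++
    sortColumns ++ [.route m (shiftPos r s) (shiftTag r s depth)] ++
    sortColumns ++ [.route m (unshiftPos r s) fun _ τ => τ % 2 ^ depth]
termination_by m
decreasing_by all_goals omega

/-- A key together with its tag. -/
abbrev Item (n : ℕ) : Type := Fin n × ℕ

/-- Compares two tagged keys: first the tags, and then, if these are equal, the keys. -/
def itemLT {n : ℕ} (a b : Item n) : CmpTree n Bool :=
  if a.2 < b.2 then .done true
  else if b.2 < a.2 then .done false
  else .cmp a.1 b.1 fun t => .done t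

def insertItem {n : ℕ} (a : Item n) : List (Item n) → CmpTree n (List (Item n))
  | [] => .done [a]
  | b :: l => (itemLT a b).bind fun t =>
      if t then .done (a :: b :: l) else (insertItem a l).bind fun l' => .done (b :: l')

/-- Sequential sorting of (a constant number of) tagged keys. -/
def sortItems {n : ℕ} : List (Item n) → CmpTree n (List (Item n))
  | [] => .done []
  | a :: l => (sortItems l).bind (insertItem a)

/-- The tagged keys of a virtual processor: keys in its memory have tag `0`; the tag of a key in a
message is the word of the message. -/
def PEState.items {n k : ℕ} {S : Type} (st : PEState n k S) : List (Item n) :=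
  (st.keys.map fun a => (a, 0)) ++ st.inbox.flatMap fun m => m.keys.map fun a => (a, m.word)

/-- The virtual processor with index `d`. -/
def vp (k d : ℕ) : Fin (2 ^ k) := ⟨d % 2 ^ k, Nat.mod_lt _ (by positivity)⟩

/-- Dummy messages of a superstep with segments of size `2 ^ m`: the virtual processor `r` sends one
to `r + 2 ^ m / 2`, for `r < 2 ^ m / 2`. -/
def dummies (n k m : ℕ) (r : Fin (2 ^ k)) : List (Msg n k) :=
  if r.val < 2 ^ m / 2 then [⟨vp k (r.val + 2 ^ m / 2), [], 0⟩] else []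

/-- The local computation of virtual processor `r` in a superstep. -/
def Op.body {n k : ℕ} (op : Op) (r : Fin (2 ^ k)) (st : PEState n k Unit) :
    CmpTree n (Outcome n k Unit) :=
  let y := r.val % 2 ^ op.logSize
  let first := r.val - y
  match op with
  | .route m f retag => .done ⟨(), [],
      (st.items.map fun it => ⟨vp k (first + f y), [it.1], retag y it.2⟩) ++ dummies n k m r⟩
  | .gather m => .done ⟨(), [],
      (st.items.map fun it => ⟨vp k first, [it.1], it.2⟩) ++ dummies n k m r⟩
  | .solve m => (sortItems st.items).bind fun l => .done ⟨(), [],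
      (l.zipIdx.map fun it => ⟨vp k (first + it.2), [it.1.1], it.1.2⟩) ++ dummies n k m r⟩

/-- The network-oblivious algorithm for `n`-sort, `n = 2 ^ k`, specified on `n` virtual processors:
recursive Columnsort. Initially the `i`-th virtual processor holds the `i`-th key; at the end each
virtual processor holds one key, which it labels with its own index. -/
def columnsort (k : ℕ) : SortAlg (2 ^ k) k where
  State := Unit
  home := id
  init := fun _ => ()
  labels := (schedule k 0).map fun op => k - op.logSize
  body := fun t r st => ((schedule k 0).getD t (.gather 0)).body r st
  answer := fun r st a => if a ∈ st.held then some r.val else none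

end NetObl

/-! Both communication times are compared with `(n / p) * g 0 + ℓ 0`, the cost of one superstep in
which processors exchange `n / p` messages across the whole machine.

Lower bound. On some input, an algorithm of the class sends at least `α n` messages between the two
halves of the machine, where `α = (1 - ε) / (4 c)` (`exists_le_crossing`). Suppose first that each
half starts with more than `(1 - ε) n / 4` keys. Interleave their values. Keys with consecutive
values must meet, since otherwise exchanging them would go unnoticed (`exists_meet`), so one key of
each pair has crossed (`exists_le_card_moved`). Suppose now that almost all keys start in one half
`P`. If few messages crossed, few keys would ever be outside `P`. The order of these strays
determines what the other half does, so together with the comparison outcomes in `P` it encodes the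
whole permutation (`lt_iff_of_encoding_eq`). Counting gives `n! ≤ (n + 1) ^ τ * 2 ^ L`
(`factorial_le`), which is impossible when there are at most `τ ≤ (1 - ε) n / 2` strays, `P` makes
at most `L ≤ ε n log n` comparisons and `n` is large. Crossing messages occur only in 0-supersteps,
so the time is at least `α (n / p) g 0 + ℓ 0` (`le_commTime`).

Upper bound. Supersteps that stay non-local after folding act on segments larger than `n / p`, which
is at least `n ^ δ / C`. Each recursion level multiplies `m - 2` by at most `2 / 3`, so only
boundedly many levels, hence supersteps, are concerned (`countP_schedule_le`, `exists_exponent`).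
Each has degree at most `5 n / p` (`columnsort_degree_le`). Monotonicity bounds all parameters by `g
0` and `ℓ 0`. The work bound holds because the schedule has only polylogarithmic length
(`length_schedule_le`).

Correctness. A threshold turns keys into zeros and ones. After Phase 3 the columns have nearly equal
numbers of ones (`ones_transpose`). After Phase 4 fewer than half a column of entries are out of
place on either side (`card_ones_after_le`, `card_zeros_before_le`), so after Phase 5 the disorder
is confined to the two half columns at one boundary (`exists_boundary`). Phases 6 to 8 sort each
such window (`sortedOn_shift`). Induction on the segment size gives `exists_exec_schedule`. -/

namespace NetObl

/-! ### Comparison outcomes as a prefix-free code -/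

namespace CmpTree

variable {n : ℕ} {R R' : Type}

/-- The outcomes of the comparisons performed on input `x`. -/
def bits (x : Input n) : CmpTree n R → List Bool
  | done _ => []
  | cmp a b next => decide (x a < x b) :: (next (decide (x a < x b))).bits x

theorem length_bits (x : Input n) (T : CmpTree n R) : (T.bits x).length = T.cost x := by
  induction T with
  | done res => rfl
  | cmp a b next ih => simp [bits, cost, ih]

/-- As long as the bits agree, both runs follow the same branch, and the leaf reached fixes how many
bits are consumed. Because of the arbitrary tails, outcomes of many trees can be concatenated and
padded without separators. -/
theorem bits_append_inj (x y : Input n) (T : CmpTree n R) {l l' : List Bool}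
    (h : T.bits x ++ l = T.bits y ++ l') : T.run x = T.run y ∧ l = l' := by
  induction T with
  | done res => exact ⟨rfl, h⟩
  | cmp a b next ih =>
    simp only [bits, List.cons_append, List.cons.injEq] at h
    obtain ⟨h1, h2⟩ := h
    rw [← h1] at h2
    have := ih _ h2
    simpa only [run, ← h1] using this

theorem flatMap_bits_inj {ι : Type*} (x y : Input n) (T : ι → CmpTree n R) (rs : List ι)
    {l l' : List Bool}
    (h : rs.flatMap (fun r => (T r).bits x) ++ l = rs.flatMap (fun r => (T r).bits y) ++ l') :
    (∀ r ∈ rs, (T r).run x = (T r).run y) ∧ l = l' := by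
  induction rs with
  | nil => exact ⟨by simp, h⟩
  | cons r rs ih =>
    simp only [List.flatMap_cons, List.append_assoc] at h
    obtain ⟨h1, h2⟩ := bits_append_inj x y (T r) h
    obtain ⟨h3, h4⟩ := ih h2
    exact ⟨by simpa using ⟨h1, h3⟩, h4⟩

theorem run_congr_of_uses {x y : Input n} {held : List (Fin n)} (T : CmpTree n R)
    (hu : T.Uses x held) (h : ∀ a ∈ held, ∀ b ∈ held, (x a < x b ↔ y a < y b)) :
    T.run x = T.run y := by
  induction T with
  | done res => rfl
  | cmp a b next ih =>
    obtain ⟨ha, hb, hn⟩ := hu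
    have := ih _ hn
    simpa only [run, h a ha b hb] using this

end CmpTree

/-! ### Ranks and clusters -/

theorem Input.lt_iff_rank_lt {n : ℕ} (x : Input n) (a b : Fin n) :
    x a < x b ↔ x.rank a < x.rank b := by
  have key : ∀ a b, x a < x b → x.rank a < x.rank b := fun a b h => by
    apply Finset.card_lt_card
    refine ⟨fun c hc => ?_, fun hs => ?_⟩
    · simp only [Finset.mem_filter, Finset.mem_univ, true_and] at hc ⊢
      exact hc.trans h
    · have : a ∈ Finset.univ.filter fun c => x c < x a := hs (by simpa using h)
      simp at this
  refine ⟨key a b, fun h => ?_⟩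
  by_contra hn
  rcases (not_lt.1 hn).lt_or_eq with h' | h'
  · exact absurd (key b a h') (by omega)
  · rw [x.injective h'] at h
    exact lt_irrefl _ h

theorem topBits_congr {k i j : ℕ} (hij : i ≤ j) {r s : Fin (2 ^ k)}
    (h : topBits j r = topBits j s) : topBits i r = topBits i s := by
  have key : ∀ r : Fin (2 ^ k), topBits i r = topBits j r / 2 ^ ((k - i) - (k - j)) := fun r => by
    unfold topBits
    rw [Nat.div_div_eq_div_mul, ← pow_add]
    congr 2
    omega
  rw [key, key, h]

theorem topBits_lt {k j : ℕ} (hj : j ≤ k) (r : Fin (2 ^ k)) : topBits j r < 2 ^ j := by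
  unfold topBits
  rw [Nat.div_lt_iff_lt_mul (by positivity), ← pow_add]
  convert r.isLt using 2
  omega

/-! ### Lower bound on the messages between the two halves -/

namespace SortAlg

variable {n k : ℕ}

theorem config_eq_of_run_eq (A : SortAlg n k) {x y : Input n} {T : ℕ}
    (h : ∀ t < T, A.config x t = A.config y t → ∀ r,
      (A.body t r (A.config x t r)).run x = (A.body t r (A.config x t r)).run y) :
    ∀ t ≤ T, A.config x t = A.config y t := by
  intro t
  induction t with
  | zero => intro _; rfl
  | succ t ih =>
    intro ht
    have e := ih (by omega)
    have := h t (by omega) e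
    funext r
    simp only [config, this]
    simp only [e]

/-- An algorithm that reaches the same final configuration on two inputs finds the same order. -/
theorem Solves.lt_iff {A : SortAlg n k} (hA : A.Solves) {x y : Input n}
    (h : A.config x A.labels.length = A.config y A.labels.length) (a b : Fin n) :
    x a < x b ↔ y a < y b := by
  have key : ∀ a, x.rank a = y.rank a := fun a => by
    obtain ⟨r, hr⟩ := (hA x a).1
    rw [h] at hr
    exact (hA y a).2 r _ hr
  rw [x.lt_iff_rank_lt, y.lt_iff_rank_lt, key, key]

/-- The number of messages between the two halves of the machine. -/
def crossing (A : SortAlg n k) (x : Input n) : ℕ :=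
  ∑ t : Fin A.labels.length, ∑ s,
    (A.outcome x t s).sent.countP fun m => topBits 1 m.dst ≠ topBits 1 s

/-- The keys that are sent between the two halves of the machine. -/
noncomputable def moved (A : SortAlg n k) (x : Input n) : Finset (Fin n) :=
  Finset.univ.biUnion fun t : Fin A.labels.length => Finset.univ.biUnion fun s =>
    (((A.outcome x t s).sent.filter fun m => topBits 1 m.dst ≠ topBits 1 s).flatMap
      Msg.keys).toFinset

theorem length_flatMap_le {α β : Type*} (l : List α) (f : α → List β) (c : ℕ)
    (h : ∀ a ∈ l, (f a).length ≤ c) : (l.flatMap f).length ≤ c * l.length := by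
  induction l with
  | nil => simp
  | cons a l ih =>
    have h1 := h a (by simp)
    have h2 := ih fun b hb => h b (by simp [hb])
    simp only [List.flatMap_cons, List.length_append, List.length_cons]
    linarith [mul_add c l.length 1]

theorem card_moved_le {A : SortAlg n k} {c : ℕ} (hA : A.Legal c) (x : Input n) :
    (A.moved x).card ≤ c * A.crossing x := by
  unfold moved crossing
  rw [Finset.mul_sum]
  refine Finset.card_biUnion_le.trans (Finset.sum_le_sum fun t _ => ?_)
  rw [Finset.mul_sum]
  refine Finset.card_biUnion_le.trans (Finset.sum_le_sum fun s _ => ?_)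
  refine (List.toFinset_card_le _).trans ?_
  rw [List.countP_eq_length_filter]
  exact length_flatMap_le _ _ _ fun m hm => hA.size_le x t s m (List.mem_filter.1 hm).1

theorem mem_held {S : Type} (st : PEState n k S) (a : Fin n) :
    a ∈ st.held ↔ a ∈ st.keys ∨ ∃ m ∈ st.inbox, a ∈ m.keys := by
  simp [PEState.held]

/-- A key that is not in the half of the machine in which it was initially has been sent there. -/
theorem home_eq_or_mem_moved {A : SortAlg n k} {c : ℕ} (hA : A.Legal c) (x : Input n)
    (a : Fin n) : ∀ t ≤ A.labels.length, ∀ r, a ∈ (A.config x t r).held →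
      topBits 1 (A.home a) = topBits 1 r ∨ a ∈ A.moved x := by
  intro t
  induction t with
  | zero =>
    intro _ r h
    left
    rw [mem_held] at h
    simp only [config] at h
    simp at h
    rw [h]
  | succ t ih =>
    intro ht r h
    rw [mem_held] at h
    rcases h with h | ⟨m, hm, ham⟩
    · exact ih (by omega) r (hA.keeps x ⟨t, ht⟩ r a h)
    · simp only [config, List.mem_flatMap, List.mem_finRange, true_and, List.mem_filter,
        decide_eq_true_eq] at hm
      obtain ⟨s, hms, hmr⟩ := hm
      subst hmr
      have h1 : a ∈ (A.config x t s).held := hA.sends x ⟨t, ht⟩ s m hms a ham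
      by_cases hs : topBits 1 m.dst = topBits 1 s
      · rw [hs]
        exact ih (by omega) s h1
      · right
        simp only [moved, Finset.mem_biUnion, Finset.mem_univ, true_and, List.mem_toFinset,
          List.mem_flatMap, List.mem_filter, decide_eq_true_eq]
        exact ⟨⟨t, ht⟩, s, m, ⟨hms, hs⟩, ham⟩

/-- Two keys with consecutive values must be compared, so they must meet. -/
theorem exists_meet {A : SortAlg n k} {c : ℕ} (hA : A.Legal c) (hs : A.Solves) (x : Input n)
    (a b : Fin n) (hab : x b = x a + 1) :
    ∃ t < A.labels.length, ∃ r, a ∈ (A.config x t r).held ∧ b ∈ (A.config x t r).held := by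
  by_contra hcon
  push Not at hcon
  have hne : a ≠ b := by rintro rfl; omega
  -- Exchanging two adjacent values changes the outcome of no comparison except that between `a` and
  -- `b`.
  let y : Input n := (Equiv.swap a b).toEmbedding.trans x
  have hya : y a = x b := by simp [y]
  have hyb : y b = x a := by simp [y]
  have hyc : ∀ u, u ≠ a → u ≠ b → y u = x u := fun u h1 h2 => by
    simp [y, Equiv.swap_apply_of_ne_of_ne h1 h2]
  have hcmp : ∀ u v, ¬ (u = a ∧ v = b) → ¬ (u = b ∧ v = a) → (x u < x v ↔ y u < y v) := by
    intro u v h1 h2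
    have inj : ∀ w, w ≠ a → w ≠ b → x w < x a ∨ x a + 1 < x w := fun w h1 h2 => by
      have h3 : x w ≠ x a := fun h => h1 (x.injective h)
      have h4 : x w ≠ x b := fun h => h2 (x.injective h)
      omega
    by_cases ua : u = a <;> by_cases ub : u = b <;> by_cases va : v = a <;> by_cases vb : v = b <;>
      simp_all <;>
      first
        | (have := inj v va vb; omega)
        | (have := inj u ua ub; omega)
  have hc := A.config_eq_of_run_eq (x := x) (y := y) (T := A.labels.length) (fun t ht _ r => by
    refine CmpTree.run_congr_of_uses _ (hA.compares x ⟨t, ht⟩ r) fun u hu v hv => hcmp u v ?_ ?_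
    · rintro ⟨rfl, rfl⟩
      exact hcon t ht r hu hv
    · rintro ⟨rfl, rfl⟩
      exact hcon t ht r hv hu) A.labels.length le_rfl
  have := hs.lt_iff hc a b
  omega

theorem countP_eq_sum_traffic (A : SortAlg n k) (x : Input n) (t : ℕ) (s : Fin (2 ^ k))
    (p : Fin (2 ^ k) → Prop) [DecidablePred p] :
    (A.outcome x t s).sent.countP (fun m => p m.dst) = ∑ d with p d, A.traffic x t s d := by
  unfold traffic
  induction (A.outcome x t s).sent with
  | nil => simp
  | cons m l ih =>
    simp only [List.countP_cons, Finset.sum_add_distrib, ih, decide_eq_true_eq,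
      Finset.sum_ite_eq, Finset.mem_filter, Finset.mem_univ, true_and]

theorem sum_sum_traffic_le (A : SortAlg n k) (x : Input n) (t : ℕ) {j : ℕ} (hj : j ≤ k) :
    ∑ s, ∑ d with topBits j d ≠ topBits j s, A.traffic x t s d ≤ 2 ^ j * A.degree j x t := by
  calc ∑ s, ∑ d with topBits j d ≠ topBits j s, A.traffic x t s d
      = ∑ P ∈ Finset.range (2 ^ j), A.sentBy j x t P := by
        rw [← Finset.sum_fiberwise_of_maps_to (g := topBits j) (t := Finset.range (2 ^ j))
          fun s _ => Finset.mem_range.2 (topBits_lt hj s)]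
        refine Finset.sum_congr rfl fun P _ => Finset.sum_congr rfl fun s hs => ?_
        rw [(Finset.mem_filter.1 hs).2]
    _ ≤ ∑ P ∈ Finset.range (2 ^ j), A.degree j x t :=
        Finset.sum_le_sum fun P hP => (le_max_left _ _).trans
          (Finset.le_sup (f := fun P => max (A.sentBy j x t P) (A.receivedBy j x t P)) hP)
    _ = _ := by simp

/-- Messages between the two halves are sent in `0`-supersteps, and do not stay within a processor
when the algorithm is folded onto at least two processors. -/
theorem crossing_le_cumDegree {A : SortAlg n k} {c : ℕ} (hA : A.Legal c) (x : Input n) {j : ℕ}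
    (h1 : 1 ≤ j) (hj : j ≤ k) : A.crossing x ≤ 2 ^ j * A.cumDegree j x 0 := by
  unfold crossing cumDegree
  rw [Finset.mul_sum, Finset.sum_filter]
  refine Finset.sum_le_sum fun t _ => ?_
  split_ifs with ht
  · refine le_trans (Finset.sum_le_sum fun s _ => ?_) (A.sum_sum_traffic_le x t hj)
    rw [A.countP_eq_sum_traffic x t s (fun d => topBits 1 d ≠ topBits 1 s)]
    refine Finset.sum_le_sum_of_subset fun d hd => ?_
    simp only [Finset.mem_filter, Finset.mem_univ, true_and] at hd ⊢
    exact fun h => hd (topBits_congr h1 h)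
  -- With a label at least 1, messages stay within clusters that lie in one half.
  · refine (Finset.sum_eq_zero fun s _ => ?_).le
    rw [List.countP_eq_zero]
    intro m hm
    have := topBits_congr (i := 1) (by omega) (hA.cluster x t s m hm)
    simpa using this

/-- The keys whose initial processor is in the first half of the machine. -/
def firstHalf (A : SortAlg n k) : Finset (Fin n) :=
  Finset.univ.filter fun a => topBits 1 (A.home a) = 0

/-- Interleave the halves: the values `2 * i` and `2 * i + 1` start on different sides. Their keys
must meet, so one of them has crossed. Halving its value recovers `i`, so different pairs contribute
different keys. -/
theorem exists_le_card_moved {A : SortAlg n k} {c : ℕ} (hA : A.Legal c) (hs : A.Solves) {h : ℕ}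
    (h0 : h ≤ A.firstHalf.card) (h1 : h ≤ A.firstHalfᶜ.card) :
    ∃ x : Input n, h ≤ (A.moved x).card := by
  classical
  let e0 := A.firstHalf.equivFin
  let e1 := A.firstHalfᶜ.equivFin
  let f : Fin n → ℕ := fun a =>
    if ha : a ∈ A.firstHalf then 2 * (e0 ⟨a, ha⟩ : ℕ)
    else 2 * (e1 ⟨a, Finset.mem_compl.2 ha⟩ : ℕ) + 1
  have hf : Function.Injective f := by
    intro a b hab
    simp only [f] at hab
    split_ifs at hab with ha hb hb
    · have := e0.injective (Fin.ext (show (e0 ⟨a, ha⟩ : ℕ) = e0 ⟨b, hb⟩ by omega))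
      simpa using this
    · omega
    · omega
    · have := e1.injective (Fin.ext (show (e1 ⟨a, Finset.mem_compl.2 ha⟩ : ℕ) =
        e1 ⟨b, Finset.mem_compl.2 hb⟩ by omega))
      simpa using this
  let x : Input n := ⟨f, hf⟩
  refine ⟨x, ?_⟩
  have key : ∀ i : Fin h, ∃ a ∈ A.moved x, x a / 2 = i := by
    intro i
    let a := e0.symm ⟨i, by omega⟩
    let b := e1.symm ⟨i, by omega⟩
    have xa : x a = 2 * i := by
      change f a = _
      simp only [f, a.2, dif_pos]
      simp [a]
    have xb : x b = 2 * i + 1 := by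
      change f b = _
      simp only [f, Finset.mem_compl.1 b.2, dif_neg, not_false_iff]
      simp [b]
    obtain ⟨t, ht, r, ha, hb⟩ := exists_meet hA hs x a b (by omega)
    rcases home_eq_or_mem_moved hA x a t ht.le r ha with h | h
    · rcases home_eq_or_mem_moved hA x b t ht.le r hb with h' | h'
      · exfalso
        have h2 := Finset.mem_filter.1 a.2
        have h3 := Finset.mem_compl.1 b.2
        simp only [firstHalf, Finset.mem_filter, Finset.mem_univ, true_and] at h3
        exact h3 (h'.trans (h.symm.trans h2.2))
      · exact ⟨b, h', by omega⟩
    · exact ⟨a, h, by omega⟩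
  choose g hg1 hg2 using key
  have := Finset.card_le_card_of_injOn (s := Finset.univ) (t := A.moved x) g
    (fun i _ => hg1 i) (fun i _ j _ hij => Fin.ext (by rw [← hg2 i, ← hg2 j, hij]))
  simpa using this

/-! ### Counting argument when one half starts with almost all keys -/

/-- The keys that are at some time outside the half `P` of the machine. -/
noncomputable def strays (A : SortAlg n k) (x : Input n) (P : ℕ) : Finset (Fin n) := by
  classical
  exact Finset.univ.filter fun a =>
    ∃ t < A.labels.length, ∃ r, topBits 1 r ≠ P ∧ a ∈ (A.config x t r).held

theorem card_strays_le {A : SortAlg n k} {c : ℕ} (hA : A.Legal c) (x : Input n) (P : ℕ) :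
    (A.strays x P).card ≤
      (Finset.univ.filter fun a => topBits 1 (A.home a) ≠ P).card + c * A.crossing x := by
  classical
  refine le_trans (Finset.card_le_card (fun a ha => ?_))
    ((Finset.card_union_le _ _).trans (Nat.add_le_add_left (card_moved_le hA x) _))
  simp only [strays, Finset.mem_filter, Finset.mem_univ, true_and] at ha
  obtain ⟨t, ht, r, hr, h⟩ := ha
  simp only [Finset.mem_union, Finset.mem_filter, Finset.mem_univ, true_and]
  rcases home_eq_or_mem_moved hA x a t ht.le r h with h | h
  · left; rwa [h]
  · right; exact h

/-- The keys of a set in increasing order. -/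
noncomputable def sortedList (x : Input n) (T : Finset (Fin n)) : List (Fin n) :=
  ((T.map x).sort (· ≤ ·)).attach.map fun v => (Finset.mem_map.1 ((Finset.mem_sort _).1 v.2)).choose

theorem map_sortedList (x : Input n) (T : Finset (Fin n)) :
    (sortedList x T).map x = (T.map x).sort (· ≤ ·) := by
  unfold sortedList
  rw [List.map_map]
  conv_rhs => rw [← List.attach_map_subtype_val ((T.map x).sort (· ≤ ·))]
  refine List.map_congr_left fun v _ => ?_
  exact (Finset.mem_map.1 ((Finset.mem_sort _).1 v.2)).choose_spec.2

theorem length_sortedList (x : Input n) (T : Finset (Fin n)) :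
    (sortedList x T).length = T.card := by
  rw [← List.length_map (f := x), map_sortedList]
  simp

theorem mem_sortedList (x : Input n) (T : Finset (Fin n)) (a : Fin n) :
    a ∈ sortedList x T ↔ a ∈ T := by
  rw [← List.mem_map_of_injective x.injective, map_sortedList]
  simp

theorem pairwise_sortedList (x : Input n) (T : Finset (Fin n)) :
    (sortedList x T).Pairwise fun a b => x a < x b := by
  have h := (Finset.sortedLT_sort (T.map x)).pairwise
  rw [← map_sortedList, List.pairwise_map] at h
  exact h

theorem lt_iff_of_sortedList_eq {x y : Input n} {T T' : Finset (Fin n)}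
    (h : sortedList x T = sortedList y T') {a b : Fin n} (ha : a ∈ T) (hb : b ∈ T) :
    x a < x b ↔ y a < y b := by
  have hx := pairwise_sortedList x T
  have hy := pairwise_sortedList y T'
  rw [← h] at hy
  rw [← mem_sortedList x] at ha hb
  obtain ⟨i, hi, rfl⟩ := List.mem_iff_getElem.1 ha
  obtain ⟨j, hj, rfl⟩ := List.mem_iff_getElem.1 hb
  rw [List.pairwise_iff_getElem] at hx hy
  rcases lt_trichotomy i j with hij | rfl | hij
  · exact iff_of_true (hx i j hi hj hij) (hy i j hi hj hij)
  · simp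
  · exact iff_of_false (hx j i hj hi hij).not_gt (hy j i hj hi hij).not_gt

/-- The outcomes of the comparisons performed by the half `P` of the machine in superstep `t`. -/
def halfBits (A : SortAlg n k) (P : ℕ) (x : Input n) (t : ℕ) : List Bool :=
  ((List.finRange (2 ^ k)).filter fun r => topBits 1 r = P).flatMap fun r =>
    (A.body t r (A.config x t r)).bits x

theorem _root_.List.sum_map_filter {α : Type*} (l : List α) (p : α → Prop) [DecidablePred p]
    (f : α → ℕ) :
    ((l.filter fun a => p a).map f).sum = (l.map fun a => if p a then f a else 0).sum := by
  induction l with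
  | nil => rfl
  | cons a l ih => by_cases h : p a <;> simp [h, ih]

theorem length_flatMap_halfBits (A : SortAlg n k) (P : ℕ) (x : Input n) :
    ((List.range A.labels.length).flatMap (A.halfBits P x)).length = A.comparisons 1 x P := by
  unfold comparisons
  rw [Finset.sum_comm, List.length_flatMap]
  change ∑ t ∈ Finset.range A.labels.length, (A.halfBits P x t).length = _
  rw [Finset.sum_range]
  refine Finset.sum_congr rfl fun t _ => ?_
  rw [halfBits, List.length_flatMap, List.sum_map_filter, Finset.sum_filter, Fin.sum_univ_def]
  simp only [CmpTree.length_bits]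

/-- The comparisons performed by the half `P` of the machine and the order of the keys that are at
some time outside this half determine the order of all keys. -/
theorem lt_iff_of_encoding_eq {A : SortAlg n k} {c : ℕ} (hA : A.Legal c) (hs : A.Solves)
    {x y : Input n} {P : ℕ} (hl : sortedList x (A.strays x P) = sortedList y (A.strays y P))
    {l l' : List Bool}
    (hb : (List.range A.labels.length).flatMap (A.halfBits P x) ++ l =
      (List.range A.labels.length).flatMap (A.halfBits P y) ++ l') (a b : Fin n) :
    x a < x b ↔ y a < y b := by
  classical
  -- Induction on the number `m` of remaining supersteps. Since the configurations at `t` agree, the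
  -- bits of superstep `t` can be decoded and split off.
  have key : ∀ m t, t + m = A.labels.length → A.config x t = A.config y t →
      (List.range' t m).flatMap (A.halfBits P x) ++ l =
        (List.range' t m).flatMap (A.halfBits P y) ++ l' →
      A.config x A.labels.length = A.config y A.labels.length := by
    intro m
    induction m with
    | zero =>
      intro t ht hc _
      have : t = A.labels.length := by omega
      rwa [this] at hc
    | succ m ih =>
      intro t ht hc h
      simp only [List.range'_succ, List.flatMap_cons, List.append_assoc] at h
      simp only [halfBits, ← hc] at h
      obtain ⟨h1, h2⟩ := CmpTree.flatMap_bits_inj x y _ _ h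
      refine ih (t + 1) (by omega) ?_ h2
      have hrun : ∀ r, (A.body t r (A.config x t r)).run x =
          (A.body t r (A.config x t r)).run y := by
        intro r
        by_cases hr : topBits 1 r = P
        · exact h1 r (by simp [hr])
        · have ht' : t < A.labels.length := by omega
          -- Outside `P` only strays are held, and their order is part of the code.
          have hstray : ∀ a ∈ (A.config x t r).held, a ∈ A.strays x P := fun a ha => by
            simp only [strays, Finset.mem_filter, Finset.mem_univ, true_and]
            exact ⟨t, ht', r, hr, ha⟩
          exact CmpTree.run_congr_of_uses _ (hA.compares x ⟨t, ht'⟩ r) fun a ha b hb =>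
            lt_iff_of_sortedList_eq hl (hstray a ha) (hstray b hb)
      funext r
      simp only [config, hrun]
      simp only [hc]
  refine hs.lt_iff (key A.labels.length 0 (by omega) rfl ?_) a b
  rwa [← List.range_eq_range']

/-- A permutation is encoded injectively by the increasing list of strays, padded with `none` to
length `τ`, and the outcomes in `P`, padded with `false` to length `L`. The second padding loses
nothing because the outcomes are prefix-free. -/
theorem factorial_le {A : SortAlg n k} {c : ℕ} (hA : A.Legal c) (hs : A.Solves) {P τ L : ℕ}
    (hτ : ∀ x, (A.strays x P).card ≤ τ) (hL : ∀ x, A.comparisons 1 x P ≤ L) :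
    n.factorial ≤ (n + 1) ^ τ * 2 ^ L := by
  let inp : Equiv.Perm (Fin n) → Input n := fun π => π.toEmbedding.trans Fin.valEmbedding
  let bs : Input n → List Bool := fun x => (List.range A.labels.length).flatMap (A.halfBits P x)
  let enc : Equiv.Perm (Fin n) → (Fin τ → Option (Fin n)) × (Fin L → Bool) := fun π =>
    (fun i => (sortedList (inp π) (A.strays (inp π) P))[(i : ℕ)]?,
      fun i => (bs (inp π)).getD i false)
  have henc : Function.Injective enc := by
    intro π ρ h
    have h1 : sortedList (inp π) (A.strays (inp π) P) = sortedList (inp ρ) (A.strays (inp ρ) P) := by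
      refine List.ext_getElem? fun i => ?_
      by_cases hi : i < τ
      · exact congrFun (Prod.ext_iff.1 h).1 ⟨i, hi⟩
      · rw [List.getElem?_eq_none, List.getElem?_eq_none] <;> rw [length_sortedList]
        · exact (hτ _).trans (not_lt.1 hi)
        · exact (hτ _).trans (not_lt.1 hi)
    have hlen : ∀ x, (bs x).length ≤ L := fun x => by
      rw [length_flatMap_halfBits]; exact hL x
    have h2 : bs (inp π) ++ List.replicate (L - (bs (inp π)).length) false =
        bs (inp ρ) ++ List.replicate (L - (bs (inp ρ)).length) false := by
      have e : ∀ l : List Bool, ∀ i < L, l.length ≤ L →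
          (l ++ List.replicate (L - l.length) false)[i]? = some (l.getD i false) := by
        intro l i hi hl
        by_cases h : i < l.length
        · simp [List.getElem?_append_left, h]
        · rw [List.getElem?_append_right (by omega)]
          simp only [List.getElem?_replicate, List.getD_eq_getElem?_getD]
          rw [if_pos (by omega), List.getElem?_eq_none (by omega)]
          rfl
      refine List.ext_getElem? fun i => ?_
      by_cases hi : i < L
      · rw [e _ i hi (hlen _), e _ i hi (hlen _)]
        exact congrArg some (congrFun (Prod.ext_iff.1 h).2 ⟨i, hi⟩)
      · have := hlen (inp π)
        have := hlen (inp ρ)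
        rw [List.getElem?_eq_none, List.getElem?_eq_none] <;> simp <;> omega
    have h3 := lt_iff_of_encoding_eq hA hs h1 h2
    have h4 : ∀ a b, π a < π b ↔ ρ a < ρ b := h3
    let e : Fin n ≃o Fin n := ⟨π.symm.trans ρ, by
      intro a b
      have := h4 (π.symm b) (π.symm a)
      simp only [Equiv.apply_symm_apply] at this
      simpa using (not_congr this).symm⟩
    -- `Fin n` has no nontrivial order automorphism, so permutations inducing the same order
    -- coincide.
    have h5 : e = OrderIso.refl _ := Subsingleton.elim _ _
    ext a
    have := congrArg (fun e : Fin n ≃o Fin n => (e (π a) : ℕ)) h5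
    simpa [e] using this.symm
  have := Fintype.card_le_of_injective enc henc
  simpa [Fintype.card_perm] using this

/-- One term of the exponential series gives `n ^ n / n! ≤ e ^ n`, and `e < 4`. A power of two as
base lets the estimate be read off in exponents. -/
theorem pow_self_le_four_pow_mul_factorial (n : ℕ) : n ^ n ≤ 4 ^ n * n.factorial := by
  have h1 := Real.pow_div_factorial_le_exp (n : ℝ) (by positivity) n
  have h2 : Real.exp n ≤ 4 ^ n := by
    rw [← mul_one (n : ℝ), Real.exp_nat_mul]
    gcongr
    linarith [Real.exp_one_lt_d9]
  rw [div_le_iff₀ (by positivity)] at h1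
  have h3 : (n : ℝ) ^ n ≤ 4 ^ n * n.factorial := h1.trans (by gcongr)
  exact_mod_cast h3

/-- If few messages are sent between the two halves of the machine and almost all keys are
initially in one half, then this half performs almost all comparisons. -/
theorem mul_le_of_card_strays_le {k k' : ℕ} {A : SortAlg (2 ^ k) k'} {c : ℕ} (hA : A.Legal c)
    (hs : A.Solves) {ε : ℝ} (hε : 0 ≤ ε) (hw : A.WorkLE ε 1) (hk : 1 ≤ k) {P : ℕ} {θ : ℝ}
    (hθ : 0 ≤ θ) (hτ : ∀ x, ((A.strays x P).card : ℝ) ≤ θ * 2 ^ k) :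
    (k : ℝ) ≤ 2 + (k + 1) * θ + ε * k := by
  have hk1 : (1 : ℝ) ≤ k := by exact_mod_cast hk
  have hlog : max 1 (Real.logb 2 ((2 ^ k : ℕ) : ℝ)) = k := by
    push_cast
    rw [Real.logb_pow, Real.logb_self_eq_one (by norm_num), mul_one, max_eq_right hk1]
  have h1 := factorial_le hA hs (P := P) (τ := ⌊θ * 2 ^ k⌋₊) (L := ⌊ε * 2 ^ k * k⌋₊)
    (fun x => Nat.le_floor (hτ x)) (fun x => Nat.le_floor (by
      have := hw x P
      rw [hlog] at this
      exact_mod_cast this))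
  set τ := ⌊θ * 2 ^ k⌋₊
  set L := ⌊ε * 2 ^ k * k⌋₊
  -- After `n + 1 ≤ 2 ^ (k + 1)` all factors are powers of two, and only exponents remain to be
  -- compared.
  have h2 : (2 ^ k) ^ (2 ^ k) ≤ 4 ^ (2 ^ k) * ((2 ^ (k + 1)) ^ τ * 2 ^ L) :=
    (pow_self_le_four_pow_mul_factorial _).trans (Nat.mul_le_mul_left _ (h1.trans (by
      gcongr
      rw [pow_succ]
      have := Nat.one_le_two_pow (n := k)
      omega)))
  rw [show 4 = 2 ^ 2 from rfl, ← pow_mul, ← pow_mul, ← pow_mul, ← pow_add, ← pow_add,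
    Nat.pow_le_pow_iff_right (by norm_num)] at h2
  have hτ' : (τ : ℝ) ≤ θ * 2 ^ k := Nat.floor_le (by positivity)
  have hL' : (L : ℝ) ≤ ε * 2 ^ k * k := Nat.floor_le (by positivity)
  have h3 : (k : ℝ) * 2 ^ k ≤ 2 * 2 ^ k + ((k + 1) * τ + L) := by exact_mod_cast h2
  have h4 : ((k : ℝ) + 1) * τ ≤ (k + 1) * (θ * 2 ^ k) := by gcongr
  have h5 : (0 : ℝ) < 2 ^ k := by positivity
  refine le_of_mul_le_mul_right ?_ h5
  linarith

/-- If the bound failed on every input, counting would force more than `(1 - ε) n / 4` keys to start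
in each half, and interleaving would then make that many keys cross, `c` per message at most. -/
theorem exists_le_crossing {ε : ℝ} (hε0 : 0 < ε) (hε1 : ε < 1) {c : ℕ} (hc : 1 ≤ c) :
    ∃ K : ℕ, ∀ k k' : ℕ, K ≤ k → 1 ≤ k' → ∀ A : SortAlg (2 ^ k) k', A.Legal c → A.Solves →
      A.WorkLE ε 1 → ∃ x, (1 - ε) / (4 * c) * 2 ^ k ≤ A.crossing x := by
  -- With `θ = (1 - ε) / 2` the counting inequality says `(1 - ε) * k ≤ 4 + (1 - ε)`, which is less
  -- than 5.
  refine ⟨⌈5 / (1 - ε)⌉₊ + 1, fun k k' hk hk' A hA hs hw => ?_⟩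
  have hk5 : 5 < (1 - ε) * k := by
    have h1 := Nat.le_ceil (5 / (1 - ε))
    have h2 : (⌈5 / (1 - ε)⌉₊ : ℝ) + 1 ≤ k := by exact_mod_cast hk
    rw [← div_lt_iff₀' (by linarith)]
    linarith
  by_contra hcon
  push Not at hcon
  have hc0 : (0 : ℝ) < c := by exact_mod_cast hc
  have hcr : ∀ x, (c : ℝ) * A.crossing x < (1 - ε) / 4 * 2 ^ k := fun x => by
    have := mul_lt_mul_of_pos_left (hcon x) hc0
    have e : (c : ℝ) * ((1 - ε) / (4 * c) * 2 ^ k) = (1 - ε) / 4 * 2 ^ k := by field_simp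
    linarith
  -- Strays either start outside `P` or cross. Each kind would number at most `(1 - ε) n / 4`, which
  -- explains `θ`.
  have hhalf : ∀ P, ¬ ((Finset.univ.filter fun a => topBits 1 (A.home a) ≠ P).card : ℝ) ≤
      (1 - ε) / 4 * 2 ^ k := fun P h => by
    have := mul_le_of_card_strays_le hA hs hε0.le hw (by omega) (P := P) (θ := (1 - ε) / 2)
      (by linarith) fun x => by
        have h1 : ((A.strays x P).card : ℝ) ≤
          (Finset.univ.filter fun a => topBits 1 (A.home a) ≠ P).card + c * A.crossing x := by
            exact_mod_cast card_strays_le hA x P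
        have := hcr x
        linarith
    linarith
  have e0 : (Finset.univ.filter fun a => topBits 1 (A.home a) ≠ 0) = A.firstHalfᶜ := by
    ext a; simp [firstHalf]
  have e1 : (Finset.univ.filter fun a => topBits 1 (A.home a) ≠ 1) = A.firstHalf := by
    ext a
    have := topBits_lt hk' (A.home a)
    simp only [firstHalf, Finset.mem_filter, Finset.mem_univ, true_and]
    omega
  have h0 := hhalf 0
  have h1 := hhalf 1
  rw [e0, not_le] at h0
  rw [e1, not_le] at h1
  obtain ⟨x, hx⟩ := exists_le_card_moved hA hs
    (min_le_left A.firstHalf.card A.firstHalfᶜ.card) (min_le_right _ _)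
  have h2 : ((min A.firstHalf.card A.firstHalfᶜ.card : ℕ) : ℝ) ≤ c * A.crossing x := by
    exact_mod_cast hx.trans (card_moved_le hA x)
  have h3 := hcr x
  rw [Nat.cast_min] at h2
  rcases min_choice (A.firstHalf.card : ℝ) A.firstHalfᶜ.card with h | h <;> rw [h] at h2 <;>
    linarith

end SortAlg

/-! ### Permutations of an initial segment of the positions -/

/-- `f` permutes the positions below `M`. -/
structure PermOn (f : ℕ → ℕ) (M : ℕ) : Prop where
  lt : ∀ y < M, f y < M
  inj : ∀ y < M, ∀ y' < M, f y = f y' → y = y'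

theorem PermOn.sum_comp {f : ℕ → ℕ} {M : ℕ} (hf : PermOn f M) (F : ℕ → ℕ) :
    ∑ y ∈ Finset.range M, F (f y) = ∑ y ∈ Finset.range M, F y := by
  have hinj : Set.InjOn f (Finset.range M) := fun a ha b hb h =>
    hf.inj a (by simpa using ha) b (by simpa using hb) h
  have himg : (Finset.range M).image f = Finset.range M := by
    refine Finset.eq_of_subset_of_card_le (fun p hp => ?_) ?_
    · obtain ⟨y, hy, rfl⟩ := Finset.mem_image.1 hp
      exact Finset.mem_range.2 (hf.lt y (Finset.mem_range.1 hy))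
    · rw [Finset.card_image_of_injOn hinj]
  conv_rhs => rw [← himg]
  rw [Finset.sum_image hinj]

theorem PermOn.exists_eq {f : ℕ → ℕ} {M : ℕ} (hf : PermOn f M) {p : ℕ} (hp : p < M) :
    ∃ y < M, f y = p := by
  have := hf.sum_comp fun q => if q = p then 1 else 0
  rw [Finset.sum_ite_eq' (Finset.range M) p, if_pos (Finset.mem_range.2 hp)] at this
  by_contra hcon
  push Not at hcon
  rw [Finset.sum_eq_zero] at this
  · omega
  · intro y hy
    rw [if_neg (hcon y (Finset.mem_range.1 hy))]

/-! ### Rearrangements and sorted blocks of sequences -/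

/-- The block of length `len` at position `b` of `w'` is a rearrangement of that of `w`. -/
def Rearr {ι : Type*} (w w' : ℕ → ι) (b len : ℕ) : Prop :=
  ∀ F : ι → ℕ, ∑ i ∈ Finset.range len, F (w' (b + i)) = ∑ i ∈ Finset.range len, F (w (b + i))

/-- The block of length `len` at position `b` of `w` is sorted by `v`. -/
def SortedOn {ι β : Type*} [LE β] (v : ι → β) (w : ℕ → ι) (b len : ℕ) : Prop :=
  ∀ i j, i ≤ j → j < len → v (w (b + i)) ≤ v (w (b + j))

theorem sum_range_mul (F : ℕ → ℕ) (r s : ℕ) : ∑ y ∈ Finset.range (r * s), F y =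
    ∑ c ∈ Finset.range s, ∑ i ∈ Finset.range r, F (c * r + i) := by
  induction s with
  | zero => simp
  | succ s ih => rw [mul_add, mul_one, Finset.sum_range_add, ih, Finset.sum_range_succ, mul_comm r s]

/-- Test the rearrangement with the indicator function of the entry `w' (b + i)`. -/
theorem Rearr.exists_eq {ι : Type*} {w w' : ℕ → ι} {b len : ℕ} (h : Rearr w w' b len) {i : ℕ}
    (hi : i < len) : ∃ j < len, w' (b + i) = w (b + j) := by
  classical
  by_contra hcon
  push Not at hcon
  have := h fun a => if a = w' (b + i) then 1 else 0
  rw [Finset.sum_eq_zero (s := Finset.range len) (f := fun j => if w (b + j) = _ then 1 else 0)]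
    at this
  · rw [Finset.sum_eq_zero_iff] at this
    simpa using this i (Finset.mem_range.2 hi)
  · intro j hj
    rw [if_neg fun h => hcon j (Finset.mem_range.1 hj) h.symm]

theorem Rearr.mul {ι : Type*} {w w' : ℕ → ι} {b r s : ℕ}
    (h : ∀ c < s, Rearr w w' (b + c * r) r) : Rearr w w' b (r * s) := by
  intro F
  rw [sum_range_mul, sum_range_mul]
  refine Finset.sum_congr rfl fun c hc => ?_
  have := h c (Finset.mem_range.1 hc) F
  simpa only [add_assoc] using this

theorem Rearr.trans {ι : Type*} {w w' w'' : ℕ → ι} {b len : ℕ} (h : Rearr w w' b len)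
    (h' : Rearr w' w'' b len) : Rearr w w'' b len := fun F => (h' F).trans (h F)

theorem Rearr.of_perm {ι : Type*} {w w' : ℕ → ι} {b len : ℕ} {f : ℕ → ℕ} (hf : PermOn f len)
    (h : ∀ y < len, w' (b + f y) = w (b + y)) : Rearr w w' b len := by
  intro F
  rw [← hf.sum_comp]
  exact Finset.sum_congr rfl fun y hy => by rw [h y (Finset.mem_range.1 hy)]

/-! ### Zero-one sequences -/

/-- The number of ones in a block. -/
def ones (z : ℕ → Bool) (b len : ℕ) : ℕ := ∑ i ∈ Finset.range len, (z (b + i)).toNat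

theorem ones_eq_card (z : ℕ → Bool) (b len : ℕ) :
    ones z b len = ((Finset.range len).filter fun i => z (b + i) = true).card := by
  rw [ones, Finset.card_filter]
  refine Finset.sum_congr rfl fun i _ => ?_
  cases z (b + i) <;> rfl

/-- A downward closed set of indices is an initial segment, determined by its cardinality. -/
theorem iff_lt_ones {z : ℕ → Bool} {b len : ℕ}
    (h : ∀ i j, i ≤ j → j < len → z (b + j) = true → z (b + i) = true) {i : ℕ} (hi : i < len) :
    z (b + i) = true ↔ i < ones z b len := by
  rw [ones_eq_card]
  constructor
  · intro hz
    have : Finset.range (i + 1) ⊆ (Finset.range len).filter fun i => z (b + i) = true := by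
      intro j hj
      simp only [Finset.mem_range, Finset.mem_filter] at hj ⊢
      exact ⟨by omega, h j i (by omega) hi hz⟩
    simpa using Finset.card_le_card this
  · intro hlt
    by_contra hz
    have : ((Finset.range len).filter fun i => z (b + i) = true) ⊆ Finset.range i := by
      intro j hj
      simp only [Finset.mem_range, Finset.mem_filter] at hj ⊢
      by_contra hij
      exact hz (h i j (by omega) hj.1 hj.2)
    have := Finset.card_le_card this
    rw [Finset.card_range] at this
    omega

theorem ones_le (z : ℕ → Bool) (b len : ℕ) : ones z b len ≤ len := by
  rw [ones_eq_card]
  exact (Finset.card_filter_le _ _).trans (by simp)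

/-- `z'` arises from `z` by sorting all columns, the ones first. -/
def ColSorted (r s : ℕ) (z z' : ℕ → Bool) : Prop :=
  ∀ c < s, ∀ i < r, (z' (c * r + i) = true ↔ i < ones z (c * r) r)

/-- Sorting the columns, seen through a threshold. -/
theorem colSorted_of_sorted {ι β : Type*} [LinearOrder β] {v : ι → β} {w w' : ℕ → ι} {r s : ℕ}
    (h : ∀ c < s, Rearr w w' (c * r) r) (h' : ∀ c < s, SortedOn v w' (c * r) r) (θ : β) :
    ColSorted r s (fun p => decide (v (w p) < θ)) fun p => decide (v (w' p) < θ) := by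
  intro c hc i hi
  rw [iff_lt_ones (b := c * r) (len := r) (z := fun p => decide (v (w' p) < θ)) _ hi]
  · rw [show ones (fun p => decide (v (w' p) < θ)) (c * r) r =
      ones (fun p => decide (v (w p) < θ)) (c * r) r from h c hc fun a => (decide (v a < θ)).toNat]
  · intro i j hij hj hz
    simp only [decide_eq_true_eq] at hz ⊢
    exact (h' c hc i j hij hj).trans_lt hz

/-! ### Phases 2 and 3: transposition balances the columns -/

theorem transposePos_permOn {r s : ℕ} : PermOn (transposePos r s) (r * s) := by
  constructor
  · intro y hy
    have hs : 0 < s := by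
      rcases Nat.eq_zero_or_pos s with rfl | h
      · simp at hy
      · exact h
    have h1 : y / s < r := by rwa [Nat.div_lt_iff_lt_mul hs]
    have h2 := Nat.mod_lt y hs
    unfold transposePos
    calc y % s * r + y / s < y % s * r + r := by omega
      _ = (y % s + 1) * r := by ring
      _ ≤ s * r := Nat.mul_le_mul_right _ h2
      _ = r * s := mul_comm _ _
  · intro y hy y' hy' h
    have hs : 0 < s := by
      rcases Nat.eq_zero_or_pos s with rfl | h
      · simp at hy
      · exact h
    have h1 : y / s < r := by rwa [Nat.div_lt_iff_lt_mul hs]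
    have h1' : y' / s < r := by rwa [Nat.div_lt_iff_lt_mul hs]
    have hr : 0 < r := (Nat.zero_le _).trans_lt h1
    unfold transposePos at h
    have hm : y % s = y' % s := by
      have : (y % s * r + y / s) / r = (y' % s * r + y' / s) / r := by rw [h]
      rwa [mul_comm, Nat.mul_add_div hr, Nat.div_eq_of_lt h1, mul_comm, Nat.mul_add_div hr, Nat.div_eq_of_lt h1'] at this
    rw [hm] at h
    rw [← Nat.div_add_mod y s, ← Nat.div_add_mod y' s, hm, Nat.add_left_cancel h]

/-- After sorting the columns, transposing and sorting the columns again, the numbers of ones in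
the columns decrease and differ by at most `s`. -/
theorem ones_transpose {s t : ℕ} {z z1 z2 : ℕ → Bool} (h1 : ColSorted (s * t) s z z1)
    (h2 : ∀ y < s * t * s, z2 (transposePos (s * t) s y) = z1 y) {c d : ℕ} (hcd : c ≤ d)
    (hd : d < s) :
    ones z2 (d * (s * t)) (s * t) ≤ ones z2 (c * (s * t)) (s * t) ∧
      ones z2 (c * (s * t)) (s * t) ≤ ones z2 (d * (s * t)) (s * t) + s := by
  set Z : ℕ → ℕ := fun a => ones z (a * (s * t)) (s * t)
  -- Column `c` receives, from each old column `a`, the rows congruent to `c` modulo `s`. Such a row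
  -- `u * s + c` holds a one exactly if it is less than `Z a`.
  have key : ∀ c < s, ones z2 (c * (s * t)) (s * t) =
      ∑ a ∈ Finset.range s, ((Finset.range t).filter fun u => u * s + c < Z a).card := by
    intro c hc
    have e : ones z2 (c * (s * t)) (s * t) =
        ∑ q ∈ Finset.range (t * s), (z2 (c * (s * t) + q)).toNat := by rw [mul_comm t s]; rfl
    rw [e, sum_range_mul]
    refine Finset.sum_congr rfl fun a ha => ?_
    rw [Finset.card_filter]
    refine Finset.sum_congr rfl fun u hu => ?_
    have ha' := Finset.mem_range.1 ha
    have hu' := Finset.mem_range.1 hu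
    have hus : u * s + c < s * t := by
      calc u * s + c < u * s + s := by omega
        _ = (u + 1) * s := by ring
        _ ≤ t * s := Nat.mul_le_mul_right _ hu'
        _ = s * t := mul_comm _ _
    have hy : (a * t + u) * s + c = a * (s * t) + (u * s + c) := by ring
    have hlt : (a * t + u) * s + c < s * t * s := by
      rw [hy]
      calc a * (s * t) + (u * s + c) < a * (s * t) + s * t := by omega
        _ = (a + 1) * (s * t) := by ring
        _ ≤ s * (s * t) := Nat.mul_le_mul_right _ ha'
        _ = s * t * s := mul_comm _ _
    have hp : transposePos (s * t) s ((a * t + u) * s + c) = c * (s * t) + (a * t + u) := by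
      unfold transposePos
      rw [mul_comm (a * t + u) s, Nat.mul_add_mod, Nat.mod_eq_of_lt hc, Nat.mul_add_div (by omega),
        Nat.div_eq_of_lt hc, add_zero]
    rw [← hp, h2 _ hlt, hy]
    have := h1 a ha' _ hus
    by_cases hz : u * s + c < Z a
    · rw [if_pos hz, this.2 hz]; rfl
    · rw [if_neg hz, Bool.eq_false_iff.2 fun h => hz (this.1 h)]; rfl
  rw [key c (by omega), key d hd]
  constructor
  · refine Finset.sum_le_sum fun a _ => Finset.card_le_card fun u hu => ?_
    simp only [Finset.mem_filter] at hu ⊢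
    exact ⟨hu.1, by omega⟩
  · suffices ∑ a ∈ Finset.range s, ((Finset.range t).filter fun u => u * s + c < Z a).card ≤
        ∑ a ∈ Finset.range s, (((Finset.range t).filter fun u => u * s + d < Z a).card + 1) by
      simpa [Finset.sum_add_distrib] using this
    refine Finset.sum_le_sum fun a _ => ?_
    -- Since `d < s`, row `(u + 1) * s + c` lies below row `u * s + d`. So each of the `s` old
    -- columns contributes a difference of at most one.
    have hsub : ((Finset.range t).filter fun u => u * s + c < Z a) ⊆
        insert 0 (((Finset.range t).filter fun u => u * s + d < Z a).image (· + 1)) := by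
      intro u hu
      simp only [Finset.mem_filter, Finset.mem_range, Finset.mem_insert, Finset.mem_image] at hu ⊢
      rcases u with _ | u
      · left; rfl
      · right
        refine ⟨u, ⟨by omega, ?_⟩, rfl⟩
        have : (u + 1) * s = u * s + s := by ring
        omega
    exact (Finset.card_le_card hsub).trans ((Finset.card_insert_le _ _).trans
      (Nat.add_le_add_right Finset.card_image_le _))

/-! ### Phases 4 and 5: diagonalization confines the disorder to one boundary -/

/-- The order in which the entries are picked up by the diagonalizing permutation. -/
def DiagLT (r y y' : ℕ) : Prop :=
  y % r + y / r < y' % r + y' / r ∨ (y % r + y / r = y' % r + y' / r ∧ y % r < y' % r)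

theorem diagonalPos_lt_of_diagLT {r s y y' : ℕ} (hy : y < r * s) (h : DiagLT r y y') :
    diagonalPos r s y < diagonalPos r s y' := by
  unfold DiagLT at h
  apply Finset.card_lt_card
  refine ⟨fun z hz => ?_, fun hs => ?_⟩
  · simp only [Finset.mem_filter] at hz ⊢
    exact ⟨hz.1, by omega⟩
  · have := hs (Finset.mem_filter.2 ⟨Finset.mem_range.2 hy, h⟩)
    simp at this

theorem diagLT_trichotomy {r y y' : ℕ} (h : y ≠ y') : DiagLT r y y' ∨ DiagLT r y' y := by
  unfold DiagLT
  by_contra hcon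
  have h1 : y % r = y' % r := by omega
  have h2 : y / r = y' / r := by omega
  exact h (by rw [← Nat.div_add_mod y r, ← Nat.div_add_mod y' r, h1, h2])

theorem diagLT_of_diagonalPos_lt {r s y y' : ℕ} (hy' : y' < r * s)
    (h : diagonalPos r s y < diagonalPos r s y') : DiagLT r y y' := by
  rcases diagLT_trichotomy (r := r) (show y ≠ y' by rintro rfl; omega) with h' | h'
  · exact h'
  · have := diagonalPos_lt_of_diagLT hy' h'
    omega

theorem diagonalPos_permOn {r s : ℕ} : PermOn (diagonalPos r s) (r * s) := by
  constructor
  · intro y hy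
    conv_rhs => rw [← Finset.card_range (r * s)]
    apply Finset.card_lt_card
    refine ⟨Finset.filter_subset _ _, fun hs => ?_⟩
    have := hs (Finset.mem_range.2 hy)
    simp at this
  · intro y hy y' hy' h
    by_contra hne
    rcases diagLT_trichotomy (r := r) hne with h' | h'
    · have := diagonalPos_lt_of_diagLT hy h'; omega
    · have := diagonalPos_lt_of_diagLT hy' h'; omega

/-- The summands are the cyclic distances from `a` to `c` modulo `s`, so they run through `0, …, s -
1`. They bound the misplaced ones per column. -/
theorem sum_distance_right {s a : ℕ} (ha : a < s) :
    ∑ c ∈ Finset.range s, (if a ≤ c then c - a else s - (a - c)) = s * (s - 1) / 2 := by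
  rw [← Finset.sum_range_id]
  refine Finset.sum_nbij' (fun c => if a ≤ c then c - a else s - (a - c))
    (fun u => if u + a < s then u + a else u + a - s) ?_ ?_ ?_ ?_ ?_
  all_goals
    intro c hc
    simp only [Finset.mem_range] at hc ⊢
    try split_ifs <;> omega

theorem sum_distance_left {s a : ℕ} (ha : a < s) :
    ∑ c ∈ Finset.range s, (if c ≤ a then a - c else s - (c - a)) = s * (s - 1) / 2 := by
  rw [← Finset.sum_range_id]
  refine Finset.sum_nbij' (fun c => if c ≤ a then a - c else s - (c - a))
    (fun u => if u ≤ a then a - u else s + a - u) ?_ ?_ ?_ ?_ ?_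
  all_goals
    intro c hc
    simp only [Finset.mem_range] at hc ⊢
    try split_ifs <;> omega

section Diagonal

variable {r s : ℕ} {z z' : ℕ → Bool} {Z : ℕ → ℕ}

theorem card_filter_le_of_columns {p : ℕ → Prop} [DecidablePred p] {g : ℕ → ℕ}
    (h : ∀ c < s, ((Finset.range r).filter fun i => p (c * r + i)).card ≤ g c) :
    ((Finset.range (r * s)).filter p).card ≤ ∑ c ∈ Finset.range s, g c := by
  rw [Finset.card_filter, sum_range_mul]
  refine Finset.sum_le_sum fun c hc => ?_
  rw [← Finset.card_filter]
  exact h c (Finset.mem_range.1 hc)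

theorem card_filter_diagonalPos (p : ℕ → Prop) [DecidablePred p] :
    ((Finset.range (r * s)).filter p).card =
      ((Finset.range (r * s)).filter fun y => p (diagonalPos r s y)).card := by
  rw [Finset.card_filter, Finset.card_filter,
    ← (diagonalPos_permOn (r := r) (s := s)).sum_comp]

theorem diagLT_column {r c i c' i' : ℕ} (hi : i < r) (hi' : i' < r)
    (h : DiagLT r (c * r + i) (c' * r + i')) : i + c ≤ i' + c' := by
  have e : ∀ c i, i < r → (c * r + i) % r = i ∧ (c * r + i) / r = c := fun c i hi => by
    rw [mul_comm c r, Nat.mul_add_mod, Nat.mod_eq_of_lt hi, Nat.mul_add_div (by omega),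
      Nat.div_eq_of_lt hi]
    exact ⟨rfl, rfl⟩
  unfold DiagLT at h
  rw [(e c i hi).1, (e c i hi).2, (e c' i' hi').1, (e c' i' hi').2] at h
  omega

theorem exists_column {p : ℕ} (hp : p < r * s) : ∃ c < s, ∃ i < r, p = c * r + i := by
  have hr : 0 < r := by
    rcases Nat.eq_zero_or_pos r with rfl | h
    · simp at hp
    · exact h
  refine ⟨p / r, ?_, p % r, Nat.mod_lt _ hr, ?_⟩
  · rwa [Nat.div_lt_iff_lt_mul hr, mul_comm]
  · rw [mul_comm]; exact (Nat.div_add_mod p r).symm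

theorem column_lt {c i : ℕ} (hc : c < s) (hi : i < r) : c * r + i < r * s := by
  calc c * r + i < c * r + r := by omega
    _ = (c + 1) * r := by ring
    _ ≤ s * r := Nat.mul_le_mul_right _ hc
    _ = r * s := mul_comm _ _

/-- After the diagonalizing permutation, few ones follow a zero. -/
theorem card_ones_after_le (hz : ∀ c < s, ∀ i < r, (z (c * r + i) = true ↔ i < Z c))
    (hZ : ∀ c d, c ≤ d → d < s → Z d ≤ Z c ∧ Z c ≤ Z d + s)
    (h : ∀ y < r * s, z' (diagonalPos r s y) = z y) {p : ℕ} (hp : p < r * s)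
    (hp0 : z' p = false) :
    ((Finset.range (r * s)).filter fun q => p < q ∧ z' q = true).card ≤ s * (s - 1) / 2 := by
  obtain ⟨y, hy, rfl⟩ := diagonalPos_permOn.exists_eq hp
  obtain ⟨a, ha, i, hi, rfl⟩ := exists_column hy
  rw [h _ hy] at hp0
  have hiZ : Z a ≤ i := by
    by_contra hlt
    rw [(hz a ha i hi).2 (by omega)] at hp0
    cases hp0
  rw [card_filter_diagonalPos, ← sum_distance_right ha]
  refine card_filter_le_of_columns fun c hc => ?_
  -- Rows of column `c` picked up after row `i` of column `a` have index at least `i + a - c`, and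
  -- ones have index below `Z c`. Here `Z a ≤ i`, so `Z c ≤ i` if `a ≤ c`, and `Z c ≤ i + s`
  -- otherwise.
  have hsub : ((Finset.range r).filter fun j =>
      diagonalPos r s (a * r + i) < diagonalPos r s (c * r + j) ∧
        z' (diagonalPos r s (c * r + j)) = true) ⊆ Finset.Ico (i + a - c) (Z c) := by
    intro j hj
    simp only [Finset.mem_filter, Finset.mem_range, Finset.mem_Ico] at hj ⊢
    obtain ⟨hj, h1, h2⟩ := hj
    have hlt := column_lt hc hj
    rw [h _ hlt, hz c hc j hj] at h2
    have := diagLT_column hi hj (diagLT_of_diagonalPos_lt hlt h1)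
    omega
  refine (Finset.card_le_card hsub).trans ?_
  rw [Nat.card_Ico]
  split_ifs with hac
  · have := hZ a c hac hc
    omega
  · have := hZ c a (by omega) ha
    omega

/-- After the diagonalizing permutation, few zeros precede a one. -/
theorem card_zeros_before_le (hz : ∀ c < s, ∀ i < r, (z (c * r + i) = true ↔ i < Z c))
    (hZ : ∀ c d, c ≤ d → d < s → Z d ≤ Z c ∧ Z c ≤ Z d + s)
    (h : ∀ y < r * s, z' (diagonalPos r s y) = z y) {p : ℕ} (hp : p < r * s)
    (hp0 : z' p = true) :
    ((Finset.range (r * s)).filter fun q => q < p ∧ z' q = false).card ≤ s * (s - 1) / 2 := by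
  obtain ⟨y, hy, rfl⟩ := diagonalPos_permOn.exists_eq hp
  obtain ⟨a, ha, i, hi, rfl⟩ := exists_column hy
  rw [h _ hy, hz a ha i hi] at hp0
  rw [card_filter_diagonalPos, ← sum_distance_left ha]
  refine card_filter_le_of_columns fun c hc => ?_
  -- The mirror image: zeros start at row `Z c`, rows picked up earlier end at `i + a - c`, and now
  -- `i < Z a`.
  have hsub : ((Finset.range r).filter fun j =>
      diagonalPos r s (c * r + j) < diagonalPos r s (a * r + i) ∧
        z' (diagonalPos r s (c * r + j)) = false) ⊆ Finset.Ico (Z c) (i + a + 1 - c) := by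
    intro j hj
    simp only [Finset.mem_filter, Finset.mem_range, Finset.mem_Ico] at hj ⊢
    obtain ⟨hj, h1, h2⟩ := hj
    have hlt := column_lt hc hj
    rw [h _ hlt] at h2
    have := diagLT_column hj hi (diagLT_of_diagonalPos_lt hy h1)
    have : Z c ≤ j := by
      by_contra hlt
      rw [(hz c hc j hj).2 (by omega)] at h2
      cases h2
    omega
  refine (Finset.card_le_card hsub).trans ?_
  rw [Nat.card_Ico]
  split_ifs with hac
  · have := hZ c a hac ha
    omega
  · have := hZ a c (by omega) hc
    omega

/-- A sequence in which few ones follow a zero and few zeros precede a one is, after its columns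
have been sorted, sorted except for the halves of two columns adjacent to the same boundary. -/
theorem exists_boundary {h : ℕ} (hr : 2 * h < r)
    (h1 : ∀ p < r * s, z p = false →
      ((Finset.range (r * s)).filter fun q => p < q ∧ z q = true).card ≤ h)
    (h0 : ∀ p < r * s, z p = true →
      ((Finset.range (r * s)).filter fun q => q < p ∧ z q = false).card ≤ h)
    (hs : ColSorted r s z z') :
    ∃ c, ∀ p < r * s, (p + r / 2 < c * r → z' p = true) ∧ (c * r + r / 2 ≤ p → z' p = false) := by
  set Y : ℕ → ℕ := fun c => ones z (c * r) r
  have hYr : ∀ c, Y c ≤ r := fun c => ones_le _ _ _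
  have hcol : ∀ c d i j, c < d → i < r → c * r + i < d * r + j := fun c d i j hcd hi => by
    have : (c + 1) * r ≤ d * r := Nat.mul_le_mul_right _ hcd
    rw [add_mul, one_mul] at this
    omega
  have hYcard : ∀ c, Y c = ((Finset.range r).filter fun i => z (c * r + i) = true).card :=
    fun c => ones_eq_card _ _ _
  have hNcard : ∀ c, r - Y c = ((Finset.range r).filter fun i => z (c * r + i) = false).card := by
    intro c
    have := Finset.card_filter_add_card_filter_not (s := Finset.range r)
      (fun i => z (c * r + i) = true)
    simp only [Bool.not_eq_true, Finset.card_range] at this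
    have := hYcard c
    omega
  -- A zero in column `c` precedes all ones of a later column. `hB` is the dual statement for a one
  -- and the zeros of an earlier column.
  have hA : ∀ c d, c < d → d < s → Y c < r → Y d ≤ h := by
    intro c d hcd hd hY
    have hpos : 0 < r - Y c := by omega
    rw [hNcard, Finset.card_pos] at hpos
    obtain ⟨i, hi⟩ := hpos
    simp only [Finset.mem_filter, Finset.mem_range] at hi
    refine le_trans ?_ (h1 _ (column_lt (hcd.trans hd) hi.1) hi.2)
    rw [hYcard]
    refine Finset.card_le_card_of_injOn (fun j => d * r + j) (fun j hj => ?_)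
      (fun j _ j' _ h => Nat.add_left_cancel h)
    simp only [Finset.coe_filter, Finset.mem_range, Set.mem_ofPred_eq] at hj ⊢
    exact ⟨column_lt hd hj.1, hcol _ _ _ _ hcd hi.1, hj.2⟩
  have hB : ∀ c d, c < d → d < s → 0 < Y d → r - Y c ≤ h := by
    intro c d hcd hd hY
    rw [hYcard, Finset.card_pos] at hY
    obtain ⟨i, hi⟩ := hY
    simp only [Finset.mem_filter, Finset.mem_range] at hi
    refine le_trans ?_ (h0 _ (column_lt hd hi.1) hi.2)
    rw [hNcard]
    refine Finset.card_le_card_of_injOn (fun j => c * r + j) (fun j hj => ?_)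
      (fun j _ j' _ h => Nat.add_left_cancel h)
    simp only [Finset.coe_filter, Finset.mem_range, Set.mem_ofPred_eq] at hj ⊢
    exact ⟨column_lt (hcd.trans hd) hj.1, hcol _ _ _ _ hcd hj.1, hj.2⟩
  -- It suffices to compare the numbers of ones in the columns with the boundary.
  suffices ∃ c, (∀ a < s, a + 1 < c → Y a = r) ∧ (∀ a < s, a + 1 = c → r ≤ Y a + r / 2) ∧
      (∀ a < s, a = c → Y a ≤ r / 2) ∧ (∀ a < s, c < a → Y a = 0) by
    obtain ⟨c, hc1, hc2, hc3, hc4⟩ := this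
    refine ⟨c, fun p hp => ?_⟩
    obtain ⟨a, ha, i, hi, rfl⟩ := exists_column hp
    constructor
    · intro hlt
      rw [hs a ha i hi]
      change i < Y a
      rcases lt_trichotomy (a + 1) c with hac | hac | hac
      · rw [hc1 a ha hac]; exact hi
      · have := hc2 a ha hac
        rw [← hac, add_mul, one_mul] at hlt
        omega
      · have : c * r ≤ a * r := Nat.mul_le_mul_right _ (by omega)
        omega
    · intro hle
      rw [Bool.eq_false_iff, Ne, hs a ha i hi, not_lt]
      change Y a ≤ i
      rcases lt_trichotomy a c with hac | hac | hac
      · have := hcol a c i 0 hac hi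
        omega
      · have := hc3 a ha hac
        rw [hac] at hle
        omega
      · rw [hc4 a ha hac]; omega
  by_cases hfull : ∀ a < s, Y a = r
  · exact ⟨s, fun a ha _ => hfull a ha, fun a ha _ => by rw [hfull a ha]; omega,
      fun a ha h => by omega, fun a ha h => by omega⟩
  push Not at hfull
  classical
  -- Let `a` be the first column that is not full of ones.
  have hspec := Nat.find_spec hfull
  set a := Nat.find hfull
  have hmin : ∀ b < a, Y b = r := fun b hb => by
    have := Nat.find_min hfull hb
    simp only [not_and, not_not] at this
    exact this (hb.trans hspec.1)
  have hYa : Y a < r := lt_of_le_of_ne (hYr a) hspec.2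
  by_cases hdirty : ∃ d < s, a < d ∧ 0 < Y d
  · obtain ⟨d, hd, had, hYd⟩ := hdirty
    -- A one beyond column `a + 1` would leave that column at most `h` zeros, while the zero in
    -- column `a` leaves it at most `h` ones. This contradicts `2 * h < r`.
    have key : ∀ e < s, a + 1 < e → Y e = 0 := by
      intro e he hae
      by_contra hne
      have h2 := hB (a + 1) e hae he (by omega)
      have h3 := hA a (a + 1) (by omega) (by omega) hYa
      omega
    have hda : d = a + 1 := by
      by_contra hne
      have := key d hd (by omega)
      omega
    refine ⟨a + 1, fun b hb hlt => hmin b (by omega), fun b hb hab => ?_, fun b hb hab => ?_, key⟩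
    · have h2 := hB a d had hd hYd
      have : b = a := by omega
      rw [this]
      omega
    · have h2 := hA a b (by omega) hb hYa
      omega
  · push Not at hdirty
    -- Only column `a` can be mixed. The boundary is its left edge if ones fill at most half of it,
    -- and its right edge otherwise.
    by_cases hhalf : Y a ≤ r / 2
    · exact ⟨a, fun b hb hlt => hmin b (by omega),
        fun b hb hab => by rw [hmin b (by omega)]; omega, fun b hb hab => by rwa [hab],
        fun b hb hab => Nat.le_zero.1 (hdirty b hb hab)⟩
    · refine ⟨a + 1, fun b hb hlt => hmin b (by omega), fun b hb hab => ?_, fun b hb hab => ?_,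
        fun b hb hab => Nat.le_zero.1 (hdirty b hb (by omega))⟩
      · have : b = a := by omega
        rw [this]
        omega
      · rw [Nat.le_zero.1 (hdirty b hb (by omega))]; omega

end Diagonal

theorem add_mod_eq {M a y : ℕ} (hy : y < M) (ha : a ≤ M) :
    (y + a) % M = if y + a < M then y + a else y + a - M := by
  split_ifs with h
  · exact Nat.mod_eq_of_lt h
  · rw [Nat.mod_eq_sub_mod (not_lt.1 h)]
    exact Nat.mod_eq_of_lt (by omega)

theorem add_mod_permOn {M a : ℕ} (ha : a ≤ M) : PermOn (fun y => (y + a) % M) M := by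
  constructor
  · intro y hy
    exact Nat.mod_lt _ (by omega)
  · intro y hy y' hy' h
    simp only [add_mod_eq hy ha, add_mod_eq hy' ha] at h
    split_ifs at h <;> omega

/-- The order by which tagged keys are sorted: first by tag, then by key. -/
def itemKey {n : ℕ} (x : Input n) (it : Item n) : ℕ ×ₗ ℕ := toLex (it.2, x it.1)

theorem itemKey_le {n : ℕ} (x : Input n) (a b : Item n) :
    itemKey x a ≤ itemKey x b ↔ a.2 < b.2 ∨ (a.2 = b.2 ∧ x a.1 ≤ x b.1) :=
  Prod.Lex.toLex_le_toLex

/-! ### Phases 6 to 8: the shifted columns -/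

section Segment

variable {n : ℕ} {x : Input n} {r s t e d : ℕ}

/-- Phases 1 to 5 sort all entries except in the halves of two columns adjacent to the same
boundary. -/
theorem exists_boundary_of_phases {ι β : Type*} [LinearOrder β] {v : ι → β}
    {u0 u1 u2 u3 u4 u5 : ℕ → ι} (hr : r = s * t) (hs : 1 ≤ s) (hsr : s * s ≤ r)
    (h1 : ∀ c < s, Rearr u0 u1 (c * r) r) (o1 : ∀ c < s, SortedOn v u1 (c * r) r)
    (h2 : ∀ y < r * s, u2 (transposePos r s y) = u1 y)
    (h3 : ∀ c < s, Rearr u2 u3 (c * r) r) (o3 : ∀ c < s, SortedOn v u3 (c * r) r)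
    (h4 : ∀ y < r * s, u4 (diagonalPos r s y) = u3 y)
    (h5 : ∀ c < s, Rearr u4 u5 (c * r) r) (o5 : ∀ c < s, SortedOn v u5 (c * r) r) (θ : β) :
    ∃ c, ∀ p < r * s, (p + r / 2 < c * r → v (u5 p) < θ) ∧
      (c * r + r / 2 ≤ p → ¬ v (u5 p) < θ) := by
  have hc1 := colSorted_of_sorted h1 o1 θ
  have hc3 := colSorted_of_sorted h3 o3 θ
  have hc5 := colSorted_of_sorted h5 o5 θ
  have hZ : ∀ c d, c ≤ d → d < s →
      ones (fun p => decide (v (u2 p) < θ)) (d * r) r ≤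
        ones (fun p => decide (v (u2 p) < θ)) (c * r) r ∧
      ones (fun p => decide (v (u2 p) < θ)) (c * r) r ≤
        ones (fun p => decide (v (u2 p) < θ)) (d * r) r + s := by
    subst hr
    exact fun c d hcd hd => ones_transpose hc1 (fun y hy => by rw [h2 y hy]) hcd hd
  -- This is where the shape condition `s * s ≤ r` enters.
  have hh : 2 * (s * (s - 1) / 2) < r := by
    have h1 : s * (s - 1) < s * s := Nat.mul_lt_mul_of_pos_left (by omega) hs
    have h2 := Nat.mul_div_le (s * (s - 1)) 2
    omega
  have hd : ∀ y < r * s, (fun p => decide (v (u4 p) < θ)) (diagonalPos r s y) =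
      (fun p => decide (v (u3 p) < θ)) y := fun y hy => by simp only [h4 y hy]
  obtain ⟨c, hc⟩ := exists_boundary hh
    (fun p hp hp0 => card_ones_after_le (fun c hc i hi => hc3 c hc i hi) hZ hd hp hp0)
    (fun p hp hp0 => card_zeros_before_le (fun c hc i hi => hc3 c hc i hi) hZ hd hp hp0) hc5
  exact ⟨c, fun p hp => ⟨fun h => by simpa using (hc p hp).1 h, fun h => by
    simpa using (hc p hp).2 h⟩⟩

variable {u0 u5 u6 u7 u8 : ℕ → Item n}

/-- Phases 6 to 8 rearrange the entries. -/
theorem rearr_shift (hs : 1 ≤ s)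
    (tag : ∀ y < r * s, (u5 y).2 < 2 ^ d)
    (h6 : ∀ y < r * s, u6 (shiftPos r s y) = ((u5 y).1, shiftTag r s d y (u5 y).2))
    (h7 : ∀ c < s, Rearr u6 u7 (c * r) r)
    (h8 : ∀ y < r * s, u8 (unshiftPos r s y) = ((u7 y).1, (u7 y).2 % 2 ^ d)) :
    Rearr u5 u8 0 (r * s) := by
  intro F
  have hrs : r / 2 ≤ r * s := (Nat.div_le_self r 2).trans (Nat.le_mul_of_pos_right r hs)
  have p6 : PermOn (shiftPos r s) (r * s) := add_mod_permOn hrs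
  have p8 : PermOn (unshiftPos r s) (r * s) := add_mod_permOn (Nat.sub_le _ _)
  have h7' : Rearr u6 u7 0 (r * s) := Rearr.mul fun c hc => by simpa using h7 c hc
  simp only [zero_add]
  calc ∑ y ∈ Finset.range (r * s), F (u8 y)
      = ∑ y ∈ Finset.range (r * s), F ((u7 y).1, (u7 y).2 % 2 ^ d) := by
        rw [← p8.sum_comp]
        exact Finset.sum_congr rfl fun y hy => by rw [h8 y (Finset.mem_range.1 hy)]
    _ = ∑ y ∈ Finset.range (r * s), F ((u6 y).1, (u6 y).2 % 2 ^ d) := by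
        simpa using h7' fun it => F (it.1, it.2 % 2 ^ d)
    _ = ∑ y ∈ Finset.range (r * s), F (u5 y) := by
        rw [← p6.sum_comp]
        refine Finset.sum_congr rfl fun y hy => ?_
        have hy' := Finset.mem_range.1 hy
        have ht := tag y hy'
        rw [h6 y hy']
        congr 1
        refine Prod.ext rfl ?_
        simp only [shiftTag]
        split_ifs
        · rw [Nat.add_mod_right, Nat.mod_eq_of_lt ht]
        · rw [Nat.mod_eq_of_lt ht]

/-- Phases 6 to 8 rearrange the entries within the shifted columns. -/
theorem exists_shift_eq (he : r = 2 * e) (hs : 1 ≤ s)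
    (tag : ∀ y < r * s, (u5 y).2 < 2 ^ d)
    (h6 : ∀ y < r * s, u6 (shiftPos r s y) = ((u5 y).1, shiftTag r s d y (u5 y).2))
    (h7 : ∀ c < s, Rearr u6 u7 (c * r) r) (o7 : ∀ c < s, SortedOn (itemKey x) u7 (c * r) r)
    (h8 : ∀ y < r * s, u8 (unshiftPos r s y) = ((u7 y).1, (u7 y).2 % 2 ^ d))
    {p : ℕ} (hp : p < r * s) :
    ∃ p' < r * s, (p' + e) / r = (p + e) / r ∧ u8 p = u5 p' ∧
      u7 (shiftPos r s p) = ((u5 p').1, (u5 p').2 + if (p + e) / r = 0 then 2 ^ d else 0) := by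
  have hr : r / 2 = e := by omega
  have hrs : r ≤ r * s := Nat.le_mul_of_pos_right r hs
  have hr0 : 0 < r := by
    rcases Nat.eq_zero_or_pos r with h | h
    · rw [h, zero_mul] at hp; omega
    · exact h
  have hshift : ∀ y < r * s, shiftPos r s y = if y + e < r * s then y + e else y + e - r * s :=
    fun y hy => by
      unfold shiftPos
      rw [hr, add_mod_eq hy (by omega)]
  have hu8 : u8 p = ((u7 (shiftPos r s p)).1, (u7 (shiftPos r s p)).2 % 2 ^ d) := by
    rw [← h8 _ (by rw [hshift p hp]; split_ifs <;> omega)]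
    congr 1
    unfold unshiftPos
    rw [hr, hshift p hp]
    split_ifs with h
    · rw [show p + e + (r * s - e) = p + r * s by omega, Nat.add_mod_right, Nat.mod_eq_of_lt hp]
    · rw [show p + e - r * s + (r * s - e) = p by omega, Nat.mod_eq_of_lt hp]
  -- After the shift, the first column holds the last `e` entries with their old tags, then the
  -- first `e` entries with bit `d` added. All other columns are plain shifts.
  have h6a : ∀ q < e, u6 q = u5 (r * s + q - e) := fun q hq => by
    have hlt : r * s + q - e < r * s := by omega
    have hsh : shiftPos r s (r * s + q - e) = q := by
      rw [hshift _ hlt, if_neg (by omega)]; omega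
    have := h6 _ hlt
    rw [shiftTag, hsh, if_neg (by omega)] at this
    exact this
  have h6b : ∀ q, e ≤ q → q < r → u6 q = ((u5 (q - e)).1, (u5 (q - e)).2 + 2 ^ d) :=
    fun q hq hq' => by
      have hlt : q - e < r * s := by omega
      have hsh : shiftPos r s (q - e) = q := by
        rw [hshift _ hlt, if_pos (by omega)]; omega
      have := h6 _ hlt
      rw [shiftTag, hsh, if_pos (by omega)] at this
      exact this
  have h6c : ∀ q, r ≤ q → q < r * s → u6 q = u5 (q - e) := fun q hq hq' => by
    have hlt : q - e < r * s := by omega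
    have hsh : shiftPos r s (q - e) = q := by
      rw [hshift _ hlt, if_pos (by omega)]; omega
    have := h6 _ hlt
    rw [shiftTag, hsh, if_neg (by omega)] at this
    exact this
  -- The first column: the entries with small tags come first.
  have hfirst : ∀ i < r, ((u7 i).2 < 2 ^ d ↔ i < e) := by
    intro i hi
    have hm := iff_lt_ones (z := fun q => decide ((u7 q).2 < 2 ^ d)) (b := 0) (len := r)
      (fun i j hij hj h => by
        have := o7 0 hs i j hij hj
        rw [itemKey_le] at this
        simp only [zero_mul, zero_add, decide_eq_true_eq] at this h ⊢
        omega) hi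
    have hones : ones (fun q => decide ((u7 q).2 < 2 ^ d)) 0 r = e := by
      have h1 := h7 0 hs fun it => (decide (it.2 < 2 ^ d)).toNat
      simp only [zero_mul, zero_add] at h1
      simp only [ones, zero_add]
      rw [h1, show r = e + e by omega, Finset.sum_range_add]
      have h2 : ∀ i ∈ Finset.range e, (decide ((u6 i).2 < 2 ^ d)).toNat = 1 := fun i hi => by
        have hi' := Finset.mem_range.1 hi
        rw [h6a i hi', decide_eq_true (tag _ (by omega))]
        rfl
      have h3 : ∀ i ∈ Finset.range e, (decide ((u6 (e + i)).2 < 2 ^ d)).toNat = 0 := fun i hi => by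
        have hi' := Finset.mem_range.1 hi
        rw [h6b _ (by omega) (by omega), decide_eq_false (by simp)]
        rfl
      rw [Finset.sum_congr rfl h2, Finset.sum_congr rfl h3]
      simp
    rw [hones] at hm
    simpa using hm
  have hcol0 : ∀ i < r, ∃ j < r, u7 i = u6 j ∧ (i < e ↔ j < e) := fun i hi => by
    obtain ⟨j, hj, h⟩ := (h7 0 hs).exists_eq hi
    simp only [zero_mul, zero_add] at h
    refine ⟨j, hj, h, ?_⟩
    rw [← hfirst i hi, h]
    by_cases hje : j < e
    · rw [h6a j hje]
      exact iff_of_true (tag _ (by omega)) hje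
    · rw [h6b j (by omega) hj]
      exact iff_of_false (by simp) hje
  have hdiv : ∀ c i, i < r → (c * r + i) / r = c := fun c i hi => by
    rw [mul_comm, Nat.mul_add_div hr0, Nat.div_eq_of_lt hi, add_zero]
  -- Call `(p + e) / r` the window of `p`. Windows `0` and `s` are half windows sharing the shifted
  -- first column, where the tags keep them apart (`hcol0`).
  by_cases hlast : p + e < r * s
  · have hsh : shiftPos r s p = p + e := by rw [hshift p hp, if_pos hlast]
    obtain ⟨c, hc, i, hi, hpe⟩ := exists_column hlast
    rcases Nat.eq_zero_or_pos c with rfl | hc0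
    · rw [zero_mul, zero_add] at hpe
      obtain ⟨j, hj, hj1, hj2⟩ := hcol0 i hi
      rw [h6b j (by omega) hj] at hj1
      have hW : (p + e) / r = 0 := Nat.div_eq_of_lt (by omega)
      rw [hsh, hpe, hj1, Nat.add_mod_right, Nat.mod_eq_of_lt (tag _ (by omega))] at hu8
      refine ⟨j - e, by omega, ?_, hu8, ?_⟩
      · rw [hW]
        exact Nat.div_eq_of_lt (by omega)
      · rw [hW, if_pos rfl, hsh, hpe, hj1]
    · obtain ⟨j, hj, hj1⟩ := (h7 c hc).exists_eq hi
      have hlt := column_lt hc hj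
      have hle : 1 * r ≤ c * r := Nat.mul_le_mul_right _ hc0
      rw [h6c _ (by omega) hlt] at hj1
      have hW : (p + e) / r = c := by rw [hpe]; exact hdiv c i hi
      rw [hsh, hpe, hj1, Nat.mod_eq_of_lt (tag _ (by omega))] at hu8
      refine ⟨c * r + j - e, by omega, ?_, hu8, ?_⟩
      · rw [hW, show c * r + j - e + e = c * r + j by omega]
        exact hdiv c j hj
      · rw [hW, if_neg (by omega), hsh, hpe, hj1, add_zero]
  · have hsh : shiftPos r s p = p + e - r * s := by rw [hshift p hp, if_neg hlast]
    obtain ⟨j, hj, hj1, hj2⟩ := hcol0 (p + e - r * s) (by omega)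
    rw [h6a j (by omega)] at hj1
    have hW : (p + e) / r = s := by
      rw [show p + e = s * r + (p + e - r * s) by rw [mul_comm s r]; omega]
      exact hdiv s _ (by omega)
    rw [hsh, hj1, Nat.mod_eq_of_lt (tag _ (by omega))] at hu8
    refine ⟨r * s + j - e, by omega, ?_, hu8, ?_⟩
    · rw [hW, show r * s + j - e + e = s * r + j by rw [mul_comm s r]; omega]
      exact hdiv s j hj
    · rw [hW, if_neg (by omega), hsh, hj1, add_zero]

/-- Phases 6 to 8 complete the sorting. -/
theorem sortedOn_shift (he : r = 2 * e) (hs : 1 ≤ s)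
    (hb : ∀ θ, ∃ c, ∀ p < r * s, (p + r / 2 < c * r → itemKey x (u5 p) < θ) ∧
      (c * r + r / 2 ≤ p → ¬ itemKey x (u5 p) < θ))
    (tag : ∀ y < r * s, (u5 y).2 < 2 ^ d)
    (h6 : ∀ y < r * s, u6 (shiftPos r s y) = ((u5 y).1, shiftTag r s d y (u5 y).2))
    (h7 : ∀ c < s, Rearr u6 u7 (c * r) r) (o7 : ∀ c < s, SortedOn (itemKey x) u7 (c * r) r)
    (h8 : ∀ y < r * s, u8 (unshiftPos r s y) = ((u7 y).1, (u7 y).2 % 2 ^ d)) :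
    SortedOn (itemKey x) u8 0 (r * s) := by
  intro p q hpq hq
  simp only [zero_add]
  have hp : p < r * s := by omega
  have hr : r / 2 = e := by omega
  have hr0 : 0 < r := by
    rcases Nat.eq_zero_or_pos r with h | h
    · rw [h, zero_mul] at hp; omega
    · exact h
  have hrs : r ≤ r * s := Nat.le_mul_of_pos_right r hs
  have hshift : ∀ y < r * s, shiftPos r s y = if y + e < r * s then y + e else y + e - r * s :=
    fun y hy => by
      unfold shiftPos
      rw [hr, add_mod_eq hy (by omega)]
  obtain ⟨p', hp', wp, ep, fp⟩ := exists_shift_eq he hs tag h6 h7 o7 h8 hp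
  obtain ⟨q', hq', wq, eq, fq⟩ := exists_shift_eq he hs tag h6 h7 o7 h8 hq
  have hdm := fun a => Nat.div_add_mod (a + e) r
  have hml := fun a => Nat.mod_lt (a + e) hr0
  rcases lt_or_eq_of_le (Nat.div_le_div_right (c := r) (Nat.add_le_add_right hpq e)) with hW | hW
  · by_contra hcon
    rw [not_le] at hcon
    -- Take the supposedly larger entry as threshold. It is not below itself, so its origin `p'`
    -- lies in window `c` or later. The origin `q'` then lies in a later window, past all entries
    -- below the threshold.
    obtain ⟨c, hc⟩ := hb (itemKey x (u8 p))
    have hep : ¬ itemKey x (u5 p') < itemKey x (u8 p) := by rw [ep]; exact lt_irrefl _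
    have heq : itemKey x (u5 q') < itemKey x (u8 p) := by rwa [← eq]
    have hc1 : c ≤ (p' + e) / r := by
      by_contra hlt
      refine hep ((hc p' hp').1 ?_)
      rw [hr, mul_comm]
      have := Nat.mul_le_mul_left r (show (p' + e) / r + 1 ≤ c by omega)
      rw [mul_add, mul_one] at this
      have := hdm p'
      have := hml p'
      omega
    refine (hc q' hq').2 ?_ heq
    have := Nat.mul_le_mul_left r (show c + 1 ≤ (q' + e) / r by omega)
    rw [mul_add, mul_one] at this
    have := hdm q'
    rw [mul_comm c r]
    omega
  -- Within one window the column sort decides, and since both tags received the same increment, the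
  -- order survives its removal.
  · have hkey : itemKey x (u7 (shiftPos r s p)) ≤ itemKey x (u7 (shiftPos r s q)) := by
      rw [hshift p hp, hshift q hq]
      by_cases hlast : p + e < r * s
      · have hlast' : q + e < r * s := by
          by_contra hge
          have h1 : (p + e) / r < s := by rwa [Nat.div_lt_iff_lt_mul hr0, mul_comm]
          have h2 : s ≤ (q + e) / r := by
            rw [Nat.le_div_iff_mul_le hr0, mul_comm]; omega
          omega
        rw [if_pos hlast, if_pos hlast']
        have hC : (p + e) / r < s := by rwa [Nat.div_lt_iff_lt_mul hr0, mul_comm]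
        have := o7 _ hC ((p + e) % r) ((q + e) % r) (by
          have e1 := hdm p
          have e2 := hdm q
          rw [hW] at e1
          omega) (hml q)
        have e1 := hdm p
        have e2 := hdm q
        rw [mul_comm] at e1 e2
        rw [e1] at this
        rw [hW, e2] at this
        exact this
      · rw [if_neg hlast, if_neg (by omega)]
        simpa using o7 0 hs (p + e - r * s) (q + e - r * s) (by omega) (by omega)
    rw [fp, fq, hW, itemKey_le] at hkey
    rw [ep, eq, itemKey_le]
    simp only at hkey
    omega

end Segment

/-! ### Sequential sorting -/

namespace CmpTree

variable {n : ℕ} {R R' : Type} (x : Input n)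

theorem run_bind (T : CmpTree n R) (f : R → CmpTree n R') :
    (T.bind f).run x = (f (T.run x)).run x := by
  induction T with
  | done res => rfl
  | cmp a b next ih => exact ih _

theorem cost_bind (T : CmpTree n R) (f : R → CmpTree n R') :
    (T.bind f).cost x = T.cost x + (f (T.run x)).cost x := by
  induction T with
  | done res => simp [bind, cost, run]
  | cmp a b next ih => simp only [bind, cost, run, ih]; omega

theorem uses_bind (T : CmpTree n R) (f : R → CmpTree n R') (held : List (Fin n)) :
    (T.bind f).Uses x held ↔ T.Uses x held ∧ (f (T.run x)).Uses x held := by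
  induction T with
  | done res => simp [bind, Uses, run]
  | cmp a b next ih => simp only [bind, Uses, run, ih]; tauto

end CmpTree

section SortItems

variable {n : ℕ} (x : Input n)

theorem itemLT_run (a b : Item n) :
    (itemLT a b).run x = decide (itemKey x a < itemKey x b) := by
  have : itemKey x a < itemKey x b ↔ a.2 < b.2 ∨ (a.2 = b.2 ∧ x a.1 < x b.1) :=
    Prod.Lex.toLex_lt_toLex
  unfold itemLT
  split_ifs with h1 h2
  · simp [CmpTree.run, this, h1]
  · simp only [CmpTree.run, this]
    rw [eq_comm, decide_eq_false_iff_not]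
    omega
  · simp only [CmpTree.run, this]
    rw [decide_eq_decide]
    omega

theorem itemLT_cost (a b : Item n) : (itemLT a b).cost x ≤ 1 := by
  unfold itemLT
  split_ifs <;> simp [CmpTree.cost]

theorem itemLT_uses (a b : Item n) {held : List (Fin n)} (ha : a.1 ∈ held) (hb : b.1 ∈ held) :
    (itemLT a b).Uses x held := by
  unfold itemLT
  split_ifs <;> simp [CmpTree.Uses, ha, hb]

theorem insertItem_run_cons (a b : Item n) (l : List (Item n)) :
    (insertItem a (b :: l)).run x =
      if itemKey x a < itemKey x b then a :: b :: l else b :: (insertItem a l).run x := by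
  simp only [insertItem, CmpTree.run_bind, itemLT_run, decide_eq_true_eq]
  split_ifs
  · rfl
  · rw [CmpTree.run_bind]; rfl

theorem insertItem_perm (a : Item n) (l : List (Item n)) :
    ((insertItem a l).run x).Perm (a :: l) := by
  induction l with
  | nil => exact List.Perm.refl _
  | cons b l ih =>
    rw [insertItem_run_cons]
    split_ifs
    · exact List.Perm.refl _
    · exact (ih.cons b).trans (List.Perm.swap _ _ _)

theorem insertItem_sorted (a : Item n) (l : List (Item n))
    (h : l.Pairwise fun a b => itemKey x a ≤ itemKey x b) :
    ((insertItem a l).run x).Pairwise fun a b => itemKey x a ≤ itemKey x b := by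
  induction l with
  | nil => exact List.pairwise_singleton _ _
  | cons b l ih =>
    rw [insertItem_run_cons]
    rw [List.pairwise_cons] at h
    split_ifs with hab
    · refine List.pairwise_cons.2 ⟨fun c hc => ?_, List.pairwise_cons.2 h⟩
      rcases List.mem_cons.1 hc with rfl | hc
      · exact hab.le
      · exact hab.le.trans (h.1 c hc)
    · refine List.pairwise_cons.2 ⟨fun c hc => ?_, ih h.2⟩
      rcases List.mem_cons.1 ((insertItem_perm x a l).mem_iff.1 hc) with rfl | hc
      · exact not_lt.1 hab
      · exact h.1 c hc

theorem insertItem_cost (a : Item n) (l : List (Item n)) : (insertItem a l).cost x ≤ l.length := by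
  induction l with
  | nil => simp [insertItem, CmpTree.cost]
  | cons b l ih =>
    have := itemLT_cost x a b
    simp only [insertItem, CmpTree.cost_bind, List.length_cons]
    split_ifs
    · simp only [CmpTree.cost]; omega
    · simp only [CmpTree.cost_bind, CmpTree.cost]; omega

theorem insertItem_uses (a : Item n) (l : List (Item n)) {held : List (Fin n)}
    (ha : a.1 ∈ held) (hl : ∀ b ∈ l, b.1 ∈ held) : (insertItem a l).Uses x held := by
  induction l with
  | nil => trivial
  | cons b l ih =>
    rw [insertItem, CmpTree.uses_bind]
    refine ⟨itemLT_uses x a b ha (hl b (by simp)), ?_⟩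
    split_ifs
    · trivial
    · rw [CmpTree.uses_bind]
      exact ⟨ih fun c hc => hl c (by simp [hc]), trivial⟩

theorem sortItems_perm (l : List (Item n)) : ((sortItems l).run x).Perm l := by
  induction l with
  | nil => exact List.Perm.refl _
  | cons a l ih =>
    rw [sortItems, CmpTree.run_bind]
    exact (insertItem_perm x a _).trans (ih.cons a)

theorem sortItems_sorted (l : List (Item n)) :
    ((sortItems l).run x).Pairwise fun a b => itemKey x a ≤ itemKey x b := by
  induction l with
  | nil => exact List.Pairwise.nil
  | cons a l ih =>
    rw [sortItems, CmpTree.run_bind]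
    exact insertItem_sorted x a _ ih

theorem sortItems_cost (l : List (Item n)) : (sortItems l).cost x ≤ l.length * l.length := by
  induction l with
  | nil => simp [sortItems, CmpTree.cost]
  | cons a l ih =>
    rw [sortItems, CmpTree.cost_bind, List.length_cons]
    have := insertItem_cost x a ((sortItems l).run x)
    rw [(sortItems_perm x l).length_eq] at this
    nlinarith

theorem sortItems_uses (l : List (Item n)) {held : List (Fin n)} (hl : ∀ b ∈ l, b.1 ∈ held) :
    (sortItems l).Uses x held := by
  induction l with
  | nil => trivial
  | cons a l ih =>
    rw [sortItems, CmpTree.uses_bind]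
    refine ⟨ih fun c hc => hl c (by simp [hc]), insertItem_uses x a _ (hl a (by simp)) ?_⟩
    intro b hb
    exact hl b (by simp [(sortItems_perm x l).mem_iff.1 hb])

end SortItems

/-! ### The effect of a superstep -/

theorem PEState.held_eq_map_items {n k : ℕ} {S : Type} (st : PEState n k S) :
    st.held = st.items.map Prod.fst := by
  simp [PEState.held, PEState.items, List.map_flatMap, Function.comp_def]

namespace Op

variable {n k : ℕ}

/-- The tagged keys sent by the virtual processor `r`, in the order in which they are sent. -/
def arrange (op : Op) (x : Input n) (r : Fin (2 ^ k)) (l : List (Item n)) : List (Item n) :=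
  match op with
  | route m _ retag => l.map fun it => (it.1, retag (r.val % 2 ^ m) it.2)
  | gather _ => l
  | solve _ => (sortItems l).run x

/-- The destination of the `i`-th tagged key sent by the virtual processor `r`. -/
def dest (op : Op) (r : Fin (2 ^ k)) (i : ℕ) : Fin (2 ^ k) :=
  match op with
  | route m f _ => vp k (r.val - r.val % 2 ^ m + f (r.val % 2 ^ m))
  | gather m => vp k (r.val - r.val % 2 ^ m)
  | solve m => vp k (r.val - r.val % 2 ^ m + i)

theorem map_zipIdx_fst {α β : Type*} (l : List α) (F : α → β) (i : ℕ) :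
    (l.zipIdx i).map (fun p => F p.1) = l.map F := by
  induction l generalizing i with
  | nil => rfl
  | cons a l ih => simp [ih]

/-- A common normal form of the three kinds of supersteps: rearrange the list, send its `i`-th entry
to `dest r i`, add the dummies. Only `arrange` depends on the keys. -/
theorem body_run (op : Op) (r : Fin (2 ^ k)) (st : PEState n k Unit) (x : Input n) :
    (op.body r st).run x = ⟨(), [],
      ((op.arrange x r st.items).zipIdx.map fun it => ⟨op.dest r it.2, [it.1.1], it.1.2⟩) ++
        dummies n k op.logSize r⟩ := by
  cases op with
  | route m f retag =>
    simp only [body, CmpTree.run, arrange, dest, logSize]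
    rw [map_zipIdx_fst (F := fun it : Item n => (⟨_, [it.1], it.2⟩ : Msg n k)), List.map_map]
    rfl
  | gather m =>
    simp only [body, CmpTree.run, arrange, dest, logSize]
    rw [map_zipIdx_fst (F := fun it : Item n => (⟨_, [it.1], it.2⟩ : Msg n k))]
  | solve m =>
    simp only [body, CmpTree.run_bind, CmpTree.run, arrange, dest, logSize]

theorem length_arrange (op : Op) (x : Input n) (r : Fin (2 ^ k)) (l : List (Item n)) :
    (op.arrange x r l).length = l.length := by
  cases op with
  | route m f retag => simp [arrange]
  | gather m => rfl
  | solve m => exact (sortItems_perm x l).length_eq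

theorem map_fst_arrange_perm (op : Op) (x : Input n) (r : Fin (2 ^ k)) (l : List (Item n)) :
    ((op.arrange x r l).map Prod.fst).Perm (l.map Prod.fst) := by
  cases op with
  | route m f retag => simp [arrange, Function.comp_def]
  | gather m => exact List.Perm.refl _
  | solve m => exact (sortItems_perm x l).map _

/-- The tagged keys of the virtual processors after a superstep, given those before. -/
def step (op : Op) (x : Input n) (L : Fin (2 ^ k) → List (Item n)) (d : Fin (2 ^ k)) :
    List (Item n) :=
  (List.finRange (2 ^ k)).flatMap fun s =>
    ((op.arrange x s (L s)).zipIdx.filter fun p => op.dest s p.2 = d).map Prod.fst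

/-- The tagged keys of the virtual processors after a sequence of supersteps. -/
def runAll (ops : List Op) (x : Input n) (L : Fin (2 ^ k) → List (Item n)) :
    Fin (2 ^ k) → List (Item n) :=
  ops.foldl (fun L op => op.step x L) L

theorem runAll_append (ops ops' : List Op) (x : Input n) (L : Fin (2 ^ k) → List (Item n)) :
    runAll (ops ++ ops') x L = runAll ops' x (runAll ops x L) := List.foldl_append

theorem countP_dest (op : Op) (x : Input n) (s d : Fin (2 ^ k)) (l : List (Item n)) :
    ((op.arrange x s l).zipIdx.countP fun p => op.dest s p.2 = d) =
      (List.range l.length).countP fun i => op.dest s i = d := by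
  have : List.range l.length = (op.arrange x s l).zipIdx.map Prod.snd := by
    rw [List.zipIdx_map_snd, length_arrange, List.range_eq_range']
  rw [this, List.countP_map]
  rfl

end Op

/-! ### Columnsort as an evolution of lists of tagged keys -/

section Columnsort

variable {k : ℕ}

/-- The tagged keys of the virtual processors at the beginning of superstep `t`. -/
def itemsAt (x : Input (2 ^ k)) (t : ℕ) (r : Fin (2 ^ k)) : List (Item (2 ^ k)) :=
  ((columnsort k).config x t r).items

/-- Superstep `t`. -/
def opAt (k t : ℕ) : Op := (schedule k 0).getD t (.gather 0)

theorem columnsort_outcome (x : Input (2 ^ k)) (t : ℕ) (r : Fin (2 ^ k)) :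
    (columnsort k).outcome x t r = ⟨(), [],
      (((opAt k t).arrange x r (itemsAt x t r)).zipIdx.map fun it =>
        ⟨(opAt k t).dest r it.2, [it.1.1], it.1.2⟩) ++
        dummies (2 ^ k) k (opAt k t).logSize r⟩ :=
  Op.body_run _ _ _ _

theorem itemsAt_zero (x : Input (2 ^ k)) (r : Fin (2 ^ k)) : itemsAt x 0 r = [(r, 0)] := by
  have h : ((List.finRange (2 ^ k)).filter fun a => a = r) = [r] := by
    rw [List.filter_eq, List.count_eq_one_of_mem (List.nodup_finRange _) (List.mem_finRange r)]
    rfl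
  change ((List.finRange (2 ^ k)).filter fun a => id a = r).map _ ++ [] = _
  simp only [id]
  rw [h]
  rfl

theorem keys_of_mem_dummies {n m : ℕ} {r : Fin (2 ^ k)} {a : Msg n k}
    (h : a ∈ dummies n k m r) :
    a.keys = [] ∧ r.val < 2 ^ m / 2 ∧ a.dst = vp k (r.val + 2 ^ m / 2) := by
  unfold dummies at h
  split_ifs at h with h'
  · rw [List.mem_singleton] at h
    subst h
    exact ⟨rfl, h', rfl⟩
  · cases h

/-- Dummies carry no keys, so they do not affect the lists. -/
theorem itemsAt_succ (x : Input (2 ^ k)) (t : ℕ) :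
    itemsAt x (t + 1) = (opAt k t).step x (itemsAt x t) := by
  funext r
  have hout := fun s => columnsort_outcome x t s
  unfold SortAlg.outcome at hout
  simp only [itemsAt, PEState.items, SortAlg.config, hout, List.map_nil, List.nil_append,
    Op.step, List.flatMap_assoc]
  refine List.flatMap_congr fun s _ => ?_
  rw [List.filter_append, List.flatMap_append]
  have h2 : ((dummies (2 ^ k) k (opAt k t).logSize s).filter fun m => m.dst = r).flatMap
      (fun m => m.keys.map fun a => (a, m.word)) = [] := by
    rw [List.flatMap_eq_nil_iff]
    intro m hm
    rw [(keys_of_mem_dummies (List.mem_filter.1 hm).1).1]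
    rfl
  rw [h2, List.append_nil, List.filter_map, List.flatMap_map]
  simp only [List.map_cons, List.map_nil, ← List.map_eq_flatMap]
  rfl

theorem columnsort_held (x : Input (2 ^ k)) (t : ℕ) (r : Fin (2 ^ k)) :
    ((columnsort k).config x t r).held = (itemsAt x t r).map Prod.fst :=
  PEState.held_eq_map_items _

theorem itemsAt_eq_runAll (x : Input (2 ^ k)) : ∀ t ≤ (schedule k 0).length,
    itemsAt x t = Op.runAll ((schedule k 0).take t) x (itemsAt x 0) := by
  intro t
  induction t with
  | zero => intro _; rfl
  | succ t ih =>
    intro ht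
    rw [itemsAt_succ, ih (by omega), List.take_succ_eq_append_getElem (by omega),
      Op.runAll_append, opAt, List.getD_eq_getElem _ _ (by omega)]
    rfl

/-! ### Properties that do not depend on the schedule -/

theorem columnsort_traffic (x : Input (2 ^ k)) (t : ℕ) (s d : Fin (2 ^ k)) :
    (columnsort k).traffic x t s d =
      ((List.range (itemsAt x t s).length).countP fun i => (opAt k t).dest s i = d) +
        (dummies (2 ^ k) k (opAt k t).logSize s).countP fun m => m.dst = d := by
  rw [SortAlg.traffic, columnsort_outcome]
  simp only
  rw [List.countP_append, List.countP_map, ← Op.countP_dest _ x]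
  rfl

theorem length_itemsAt_succ (x : Input (2 ^ k)) (t : ℕ) (d : Fin (2 ^ k)) :
    (itemsAt x (t + 1) d).length = ∑ s,
      (List.range (itemsAt x t s).length).countP fun i => (opAt k t).dest s i = d := by
  rw [itemsAt_succ, Op.step, List.length_flatMap, Fin.sum_univ_def]
  congr 2
  funext s
  rw [List.length_map, ← List.countP_eq_length_filter, Op.countP_dest]

/-- Destinations depend on the place in the list and never on the key, so list lengths, and with
them the traffic, are the same for all inputs. -/
theorem length_itemsAt_congr (x y : Input (2 ^ k)) (t : ℕ) (d : Fin (2 ^ k)) :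
    (itemsAt x t d).length = (itemsAt y t d).length := by
  induction t generalizing d with
  | zero => rw [itemsAt_zero, itemsAt_zero]
  | succ t ih => simp only [length_itemsAt_succ, ih]

theorem columnsort_static : (columnsort k).Static := by
  intro x y t s d
  rw [columnsort_traffic, columnsort_traffic, length_itemsAt_congr x y]

theorem sum_count_filter {α β γ : Type*} [Fintype γ] [DecidableEq γ] [DecidableEq β] (l : List α)
    (g : α → γ) (f : α → β) (b : β) :
    ∑ d, ((l.filter fun a => g a = d).map f).count b = (l.map f).count b := by
  induction l with
  | nil => simp
  | cons a l ih =>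
    have : ∀ d, (((a :: l).filter fun a => g a = d).map f).count b =
        ((l.filter fun a => g a = d).map f).count b +
          if g a = d then (if f a == b then 1 else 0) else 0 := by
      intro d
      by_cases h : g a = d <;> simp [h, List.count_cons]
    simp only [this, Finset.sum_add_distrib, ih, Finset.sum_ite_eq, Finset.mem_univ, if_true,
      List.map_cons, List.count_cons]

/-- No key is kept in memory, and each tagged key is sent to exactly one destination. -/
theorem columnsort_copies (x : Input (2 ^ k)) (t : ℕ) (a : Fin (2 ^ k)) :
    (columnsort k).copies x t a = 1 := by
  simp only [SortAlg.copies, columnsort_held]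
  induction t with
  | zero => simp [itemsAt_zero, List.count_singleton]
  | succ t ih =>
    have h : ∀ d, ((itemsAt x (t + 1) d).map Prod.fst).count a =
        ∑ s, ((((opAt k t).arrange x s (itemsAt x t s)).zipIdx.filter fun p =>
          (opAt k t).dest s p.2 = d).map fun p => p.1.1).count a := by
      intro d
      rw [itemsAt_succ, Op.step, List.map_flatMap, List.count_flatMap, Fin.sum_univ_def]
      simp only [List.map_map, Function.comp_def]
    refine Eq.trans ?_ ih
    rw [Finset.sum_congr rfl fun d _ => h d, Finset.sum_comm]
    refine Finset.sum_congr rfl fun s _ => ?_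
    have := sum_count_filter ((opAt k t).arrange x s (itemsAt x t s)).zipIdx
      (fun p => (opAt k t).dest s p.2) (fun p => p.1.1) a
    rw [this, Op.map_zipIdx_fst (F := Prod.fst)]
    exact ((opAt k t).map_fst_arrange_perm x s _).count_eq a

end Columnsort

/-! ### Blocks of virtual processors -/

theorem vp_val {k z : ℕ} (h : z < 2 ^ k) : (vp k z).val = z := Nat.mod_eq_of_lt h

theorem mul_add_lt_two_pow {k m q z : ℕ} (hm : m ≤ k) (hq : q < 2 ^ (k - m)) (hz : z < 2 ^ m) :
    q * 2 ^ m + z < 2 ^ k := by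
  calc q * 2 ^ m + z < q * 2 ^ m + 2 ^ m := by omega
    _ = (q + 1) * 2 ^ m := by ring
    _ ≤ 2 ^ (k - m) * 2 ^ m := Nat.mul_le_mul_right _ hq
    _ = 2 ^ k := by rw [← pow_add]; congr 1; omega

theorem div_two_pow_lt {k m p : ℕ} (hm : m ≤ k) (hp : p < 2 ^ k) : p / 2 ^ m < 2 ^ (k - m) := by
  rw [Nat.div_lt_iff_lt_mul (by positivity), ← pow_add]
  convert hp using 2
  omega

theorem sub_mod_eq (p M : ℕ) : p - p % M = p / M * M := by
  have := Nat.div_add_mod p M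
  rw [mul_comm] at this
  omega

theorem mul_add_div_eq {q M z : ℕ} (hz : z < M) : (q * M + z) / M = q := by
  rw [mul_comm, Nat.mul_add_div (by omega), Nat.div_eq_of_lt hz, add_zero]

theorem mul_add_mod_eq {q M z : ℕ} (hz : z < M) : (q * M + z) % M = z := by
  rw [mul_comm, Nat.mul_add_mod, Nat.mod_eq_of_lt hz]

section Lists

theorem flatMap_eq_of_unique {α β : Type*} [DecidableEq α] {l : List α} (hl : l.Nodup) {a : α}
    (ha : a ∈ l) {f : α → List β} (h : ∀ b, b ≠ a → f b = []) : l.flatMap f = f a := by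
  induction l with
  | nil => cases ha
  | cons b l ih =>
    rw [List.nodup_cons] at hl
    rw [List.flatMap_cons]
    by_cases hba : b = a
    · subst hba
      have : l.flatMap f = [] := by
        rw [List.flatMap_eq_nil_iff]
        intro c hc
        exact h c fun e => hl.1 (e ▸ hc)
      rw [this, List.append_nil]
    · rw [h b hba, List.nil_append]
      exact ih hl.2 ((List.mem_cons.1 ha).resolve_left fun e => hba e.symm)

theorem flatMap_ite_singleton {α β : Type*} (l : List α) (p : α → Prop) [DecidablePred p]
    (g : α → β) : (l.flatMap fun a => if p a then [g a] else []) =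
      (l.filter fun a => p a).map g := by
  induction l with
  | nil => rfl
  | cons a l ih => by_cases h : p a <;> simp [h, ih]

theorem filter_zipIdx_eq {α : Type*} (l : List α) (j i : ℕ) (hi : i < l.length)
    (p : ℕ → Prop) [DecidablePred p] (h : ∀ i' < l.length, (p (j + i') ↔ i' = i)) :
    ((l.zipIdx j).filter fun q => p q.2).map Prod.fst = [l[i]] := by
  induction l generalizing i j with
  | nil => simp at hi
  | cons a l ih =>
    rw [List.zipIdx_cons]
    rcases i with _ | i
    · have h0 : p j := by simpa using (h 0 (by simp)).2 rfl
      have hnil : ((l.zipIdx (j + 1)).filter fun q => p q.2) = [] := by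
        rw [List.filter_eq_nil_iff]
        intro q hq
        have := List.mem_zipIdx hq
        have h1 := h (q.2 - j) (by simp; omega)
        rw [show j + (q.2 - j) = q.2 by omega] at h1
        simp only [decide_eq_true_eq, h1]
        omega
      simp [h0, hnil]
    · have h0 : ¬ p j := by simpa using (h 0 (by simp)).not
      rw [List.filter_cons_of_neg (by simpa using h0), ih (j + 1) i (by simpa using hi)]
      · rfl
      · intro i' hi'
        have := h (i' + 1) (by simpa using hi')
        rw [add_assoc, add_comm 1 i', this]
        omega

end Lists

/-! ### Supersteps on configurations with one key per virtual processor -/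

section Steps

variable {n k m : ℕ} {x : Input n}

/-- The configuration with one tagged key per virtual processor. -/
def single (w : ℕ → Item n) : Fin (2 ^ k) → List (Item n) := fun r => [w r.val]

/-- The first virtual processor of each segment holds the tagged keys of the segment. -/
def Gathered (m : ℕ) (w : ℕ → Item n) (L : Fin (2 ^ k) → List (Item n)) : Prop :=
  ∀ r, (L r).Perm (if r.val % 2 ^ m = 0 then (List.range (2 ^ m)).map fun i => w (r.val + i) else [])

/-- Each processor receives from a single sender: the one in its own segment at the preimage of its
position. -/
theorem step_route (hm : m ≤ k) {f : ℕ → ℕ} (hf : PermOn f (2 ^ m)) (retag : ℕ → ℕ → ℕ)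
    (w : ℕ → Item n) :
    ∃ w', (Op.route m f retag).step x (single (k := k) w) = single w' ∧
      ∀ q < 2 ^ (k - m), ∀ y < 2 ^ m, w' (q * 2 ^ m + f y) =
        ((w (q * 2 ^ m + y)).1, retag y (w (q * 2 ^ m + y)).2) := by
  have hM : 0 < 2 ^ m := by positivity
  choose! g hg1 hg2 using fun p (hp : p < 2 ^ m) => hf.exists_eq hp
  refine ⟨fun p => ((w (p / 2 ^ m * 2 ^ m + g (p % 2 ^ m))).1,
    retag (g (p % 2 ^ m)) (w (p / 2 ^ m * 2 ^ m + g (p % 2 ^ m))).2), ?_, ?_⟩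
  · funext d
    have hd := Nat.mod_lt d.val hM
    have hlt := mul_add_lt_two_pow hm (div_two_pow_lt hm d.isLt) (hg1 _ hd)
    have key : ∀ s : Fin (2 ^ k), (Op.route m f retag).dest s 0 = d ↔
        s = vp k (d.val / 2 ^ m * 2 ^ m + g (d.val % 2 ^ m)) := by
      intro s
      have hs := Nat.mod_lt s.val hM
      simp only [Op.dest]
      rw [sub_mod_eq, Fin.ext_iff, Fin.ext_iff, vp_val hlt,
        vp_val (mul_add_lt_two_pow hm (div_two_pow_lt hm s.isLt) (hf.lt _ hs))]
      constructor
      · intro h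
        have h1 : s.val / 2 ^ m = d.val / 2 ^ m := by rw [← h, mul_add_div_eq (hf.lt _ hs)]
        have h2 : f (s.val % 2 ^ m) = d.val % 2 ^ m := by rw [← h, mul_add_mod_eq (hf.lt _ hs)]
        have h3 : s.val % 2 ^ m = g (d.val % 2 ^ m) :=
          hf.inj _ hs _ (hg1 _ hd) (by rw [h2, hg2 _ hd])
        rw [← h1, ← h3, mul_comm, Nat.div_add_mod]
      · intro h
        rw [h, mul_add_div_eq (hg1 _ hd), mul_add_mod_eq (hg1 _ hd), hg2 _ hd, mul_comm,
          Nat.div_add_mod]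
    unfold Op.step
    rw [flatMap_eq_of_unique (List.nodup_finRange _)
      (List.mem_finRange (vp k (d.val / 2 ^ m * 2 ^ m + g (d.val % 2 ^ m))))]
    · simp only [single, Op.arrange, List.map_cons, List.map_nil, List.zipIdx_cons,
        List.zipIdx_nil, (key _).2, decide_true, List.filter_cons_of_pos, List.filter_nil, vp_val hlt,
        mul_add_mod_eq (hg1 _ hd)]
    · intro s hs
      simp [single, Op.arrange, (key s).not.2 hs]
  · intro q hq y hy
    have : g (f y) = y := hf.inj _ (hg1 _ (hf.lt y hy)) _ hy (hg2 _ (hf.lt y hy))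
    simp only [mul_add_div_eq (hf.lt y hy), mul_add_mod_eq (hf.lt y hy), this]

theorem step_gather (hm : m ≤ k) (w : ℕ → Item n) :
    Gathered m w ((Op.gather m).step x (single (k := k) w)) := by
  intro d
  have hM : 0 < 2 ^ m := by positivity
  have key : ∀ s : Fin (2 ^ k), (Op.gather m).dest s 0 = d ↔ s.val / 2 ^ m * 2 ^ m = d.val := by
    intro s
    simp only [Op.dest]
    rw [sub_mod_eq, Fin.ext_iff, ← add_zero (s.val / 2 ^ m * 2 ^ m),
      vp_val (mul_add_lt_two_pow hm (div_two_pow_lt hm s.isLt) hM)]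
  have hstep : (Op.gather m).step x (single w) d =
      (((List.finRange (2 ^ k)).filter fun s => s.val / 2 ^ m * 2 ^ m = d.val).map Fin.val).map
        w := by
    unfold Op.step
    rw [List.map_map, ← flatMap_ite_singleton]
    refine List.flatMap_congr fun s _ => ?_
    by_cases h : s.val / 2 ^ m * 2 ^ m = d.val
    · have := (key s).2 h
      simp [single, Op.arrange, h, this]
    · have := (key s).not.2 h
      simp [single, Op.arrange, h, this]
  rw [hstep]
  split_ifs with hd
  · have hmap : ((List.range (2 ^ m)).map fun i => w (d.val + i)) =
        ((List.range (2 ^ m)).map fun i => d.val + i).map w := by rw [List.map_map]; rfl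
    rw [hmap]
    refine List.Perm.map _ ?_
    rw [List.perm_ext_iff_of_nodup (((List.nodup_finRange _).filter _).map Fin.val_injective)
      (List.nodup_range.map fun a b h => Nat.add_left_cancel h)]
    have hdm := Nat.div_add_mod d.val (2 ^ m)
    rw [hd, add_zero, mul_comm] at hdm
    intro p
    simp only [List.mem_map, List.mem_filter, List.mem_finRange, true_and, decide_eq_true_eq,
      List.mem_range]
    constructor
    · rintro ⟨s, hs, rfl⟩
      refine ⟨s.val % 2 ^ m, Nat.mod_lt _ hM, ?_⟩
      rw [← hs, mul_comm, Nat.div_add_mod]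
    · rintro ⟨i, hi, rfl⟩
      refine ⟨⟨d.val + i, ?_⟩, ?_, rfl⟩
      · rw [← hdm]
        exact mul_add_lt_two_pow hm (div_two_pow_lt hm d.isLt) hi
      · simp only
        rw [← hdm, mul_add_div_eq hi]
  · rw [List.filter_eq_nil_iff.2]
    · exact List.Perm.refl _
    · intro s _
      simp only [decide_eq_true_eq]
      intro h
      rw [← h] at hd
      exact hd (Nat.mul_mod_left _ _)

/-- The sorted list at the head of a segment has `2 ^ m` entries, one for each position, and the
other processors hold nothing. -/
theorem step_solve (hm : m ≤ k) {w : ℕ → Item n} {L : Fin (2 ^ k) → List (Item n)}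
    (hL : Gathered m w L) :
    ∃ w', (Op.solve m).step x L = single w' ∧ ∀ q < 2 ^ (k - m),
      Rearr w w' (q * 2 ^ m) (2 ^ m) ∧ SortedOn (itemKey x) w' (q * 2 ^ m) (2 ^ m) := by
  have hM : 0 < 2 ^ m := by positivity
  set l : ℕ → List (Item n) := fun q => (sortItems (L (vp k (q * 2 ^ m)))).run x with hl
  have hperm : ∀ q < 2 ^ (k - m), (l q).Perm
      ((List.range (2 ^ m)).map fun i => w (q * 2 ^ m + i)) := by
    intro q hq
    have h1 := hL (vp k (q * 2 ^ m))
    have h2 := mul_add_lt_two_pow hm hq hM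
    rw [add_zero] at h2
    rw [vp_val h2, if_pos (Nat.mul_mod_left _ _)] at h1
    exact (sortItems_perm x _).trans h1
  have hlen : ∀ q < 2 ^ (k - m), (l q).length = 2 ^ m := fun q hq => by
    rw [(hperm q hq).length_eq]; simp
  let w' : ℕ → Item n := fun p => (l (p / 2 ^ m)).getD (p % 2 ^ m) (w 0)
  have hw' : ∀ q < 2 ^ (k - m), ∀ i (hi : i < (l q).length), w' (q * 2 ^ m + i) = (l q)[i] := by
    intro q hq i hi
    have hi' := hi
    rw [hlen q hq] at hi'
    simp only [w', mul_add_div_eq hi', mul_add_mod_eq hi']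
    exact List.getD_eq_getElem _ _ hi
  refine ⟨w', ?_, fun q hq => ⟨?_, ?_⟩⟩
  · funext d
    have hd := Nat.mod_lt d.val hM
    have hq := div_two_pow_lt hm d.isLt
    have hlt := mul_add_lt_two_pow hm hq hM
    rw [add_zero] at hlt
    unfold Op.step
    rw [flatMap_eq_of_unique (List.nodup_finRange _)
      (List.mem_finRange (vp k (d.val / 2 ^ m * 2 ^ m)))]
    · have hi : d.val % 2 ^ m < (l (d.val / 2 ^ m)).length := by rw [hlen _ hq]; exact hd
      have := filter_zipIdx_eq (l (d.val / 2 ^ m)) 0 (d.val % 2 ^ m) hi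
        (fun i => (Op.solve m).dest (vp k (d.val / 2 ^ m * 2 ^ m)) i = d) (fun i hi => by
          rw [hlen _ hq] at hi
          simp only [Op.dest]
          rw [vp_val hlt, sub_mod_eq, Nat.mul_div_cancel _ hM, zero_add, Fin.ext_iff,
            vp_val (mul_add_lt_two_pow hm hq hi)]
          have := Nat.div_add_mod d.val (2 ^ m)
          rw [mul_comm] at this
          omega)
      refine Eq.trans this ?_
      rw [← hw' _ hq]
      have := Nat.div_add_mod d.val (2 ^ m)
      rw [mul_comm] at this
      rw [this]
      rfl
    · intro s hs
      by_cases h0 : s.val % 2 ^ m = 0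
      · have hdm := Nat.div_add_mod s.val (2 ^ m)
        rw [h0, add_zero, mul_comm] at hdm
        have hqs := div_two_pow_lt hm s.isLt
        rw [List.map_eq_nil_iff, List.filter_eq_nil_iff]
        intro p hp
        have hp2 := List.mem_zipIdx hp
        rw [Op.length_arrange, (hL s).length_eq, if_pos h0] at hp2
        simp only [List.length_map, List.length_range, zero_add] at hp2
        simp only [decide_eq_true_eq]
        simp only [Op.dest]
        rw [sub_mod_eq, Fin.ext_iff, vp_val (mul_add_lt_two_pow hm hqs hp2.2.1)]
        intro h
        apply hs
        rw [Fin.ext_iff, vp_val hlt, ← h, mul_add_div_eq hp2.2.1, hdm]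
      · have := hL s
        rw [if_neg h0, List.perm_nil] at this
        rw [this]
        rfl
  · intro F
    have h1 := ((hperm q hq).map F).sum_eq
    rw [List.map_map] at h1
    change _ = ∑ i ∈ Finset.range (2 ^ m), F (w (q * 2 ^ m + i)) at h1
    rw [← h1, ← Fin.sum_univ_fun_getElem, Finset.sum_range]
    have e : (l q).length = 2 ^ m := hlen q hq
    refine Fintype.sum_equiv (finCongr e.symm) _ _ fun i => ?_
    rw [hw' q hq i (by omega)]
    rfl
  · intro i j hij hj
    have hj' : j < (l q).length := by rw [hlen q hq]; exact hj
    rw [hw' q hq i (by omega), hw' q hq j hj']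
    rcases hij.eq_or_lt with rfl | hlt
    · exact le_rfl
    · exact List.pairwise_iff_getElem.1 (sortItems_sorted x _) i j
        (show i < (l q).length by omega) hj' hlt

end Steps

/-! ### Execution of the recursive schedule -/

section Exec

variable {n k : ℕ}

/-- The configurations that occur before a superstep of recursive Columnsort. -/
def Op.Ready (op : Op) (L : Fin (2 ^ k) → List (Item n)) : Prop :=
  1 ≤ op.logSize ∧ op.logSize ≤ k ∧
    match op with
    | .route m f _ => PermOn f (2 ^ m) ∧ ∃ w, L = single w
    | .gather m => m ≤ 2 ∧ ∃ w, L = single w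
    | .solve m => m ≤ 2 ∧ ∃ w, Gathered m w L

/-- Legality and the bounds on list lengths concern every intermediate configuration, so the final
result alone would not suffice. -/
def AllReady (x : Input n) : List Op → (Fin (2 ^ k) → List (Item n)) → Prop
  | [], _ => True
  | op :: ops, L => op.Ready L ∧ AllReady x ops (op.step x L)

theorem allReady_append (x : Input n) (ops ops' : List Op) (L : Fin (2 ^ k) → List (Item n)) :
    AllReady x (ops ++ ops') L ↔ AllReady x ops L ∧ AllReady x ops' (Op.runAll ops x L) := by
  induction ops generalizing L with
  | nil => simp [AllReady, Op.runAll]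
  | cons op ops ih =>
    simp only [List.cons_append, AllReady, ih, and_assoc]
    rfl

theorem AllReady.ready {x : Input n} {ops : List Op} {L : Fin (2 ^ k) → List (Item n)}
    (h : AllReady x ops L) {t : ℕ} (ht : t < ops.length) :
    ops[t].Ready (Op.runAll (ops.take t) x L) := by
  rw [← List.take_append_drop t ops, allReady_append, List.drop_eq_getElem_cons ht] at h
  exact h.2.1

/-- From the configuration `w`, the supersteps `ops` lead to the configuration `w'`. -/
def Exec (k : ℕ) (x : Input n) (ops : List Op) (w w' : ℕ → Item n) : Prop :=
  AllReady x ops (single (k := k) w) ∧ Op.runAll ops x (single (k := k) w) = single w'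

theorem Exec.append {x : Input n} {ops ops' : List Op} {w w' w'' : ℕ → Item n}
    (h : Exec k x ops w w') (h' : Exec k x ops' w' w'') : Exec k x (ops ++ ops') w w'' := by
  refine ⟨(allReady_append _ _ _ _).2 ⟨h.1, ?_⟩, ?_⟩
  · rw [h.2]; exact h'.1
  · rw [Op.runAll_append, h.2, h'.2]

theorem exists_exec_route (x : Input n) {m : ℕ} (h1 : 1 ≤ m) (hm : m ≤ k) {f : ℕ → ℕ}
    (hf : PermOn f (2 ^ m)) (retag : ℕ → ℕ → ℕ) (w : ℕ → Item n) :
    ∃ w', Exec k x [.route m f retag] w w' ∧ ∀ q < 2 ^ (k - m), ∀ y < 2 ^ m,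
      w' (q * 2 ^ m + f y) = ((w (q * 2 ^ m + y)).1, retag y (w (q * 2 ^ m + y)).2) := by
  obtain ⟨w', h, h'⟩ := step_route (x := x) hm hf retag w
  exact ⟨w', ⟨⟨⟨h1, hm, hf, w, rfl⟩, trivial⟩, h⟩, h'⟩

/-- Each segment of size `2 ^ m` of `w'` is sorted and is a rearrangement of that of `w`. -/
def SegmentsSorted (k m : ℕ) (x : Input n) (w w' : ℕ → Item n) : Prop :=
  ∀ q < 2 ^ (k - m), Rearr w w' (q * 2 ^ m) (2 ^ m) ∧
    SortedOn (itemKey x) w' (q * 2 ^ m) (2 ^ m)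

theorem exists_exec_base (x : Input n) {m : ℕ} (h1 : 1 ≤ m) (h2 : m ≤ 2) (hm : m ≤ k)
    (w : ℕ → Item n) : ∃ w', Exec k x [.gather m, .solve m] w w' ∧ SegmentsSorted k m x w w' := by
  have hg := step_gather (x := x) hm w
  obtain ⟨w', h, h'⟩ := step_solve (x := x) hm hg
  exact ⟨w', ⟨⟨⟨h1, hm, h2, w, rfl⟩, ⟨h1, hm, h2, w, hg⟩, trivial⟩, h⟩, h'⟩

theorem tag_lt_of_rearr {m : ℕ} (hm : m ≤ k) {w w' : ℕ → Item n}
    (h : ∀ q < 2 ^ (k - m), Rearr w w' (q * 2 ^ m) (2 ^ m)) {B : ℕ}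
    (hw : ∀ p < 2 ^ k, (w p).2 < B) : ∀ p < 2 ^ k, (w' p).2 < B := by
  intro p hp
  have hq := div_two_pow_lt hm hp
  obtain ⟨j, hj, e⟩ := (h _ hq).exists_eq (Nat.mod_lt p (show 0 < 2 ^ m by positivity))
  rw [mul_comm (p / _), Nat.div_add_mod, mul_comm] at e
  rw [e]
  exact hw _ (mul_add_lt_two_pow hm hq hj)

theorem Rearr.shift {ι : Type*} {w w' : ℕ → ι} {a b len : ℕ} (h : Rearr w w' (a + b) len) :
    Rearr (fun y => w (a + y)) (fun y => w' (a + y)) b len := fun F => by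
  simpa only [add_assoc] using h F

theorem rearr_zero_iff {ι : Type*} {w w' : ℕ → ι} {a len : ℕ} :
    Rearr (fun y => w (a + y)) (fun y => w' (a + y)) 0 len ↔ Rearr w w' a len := by
  simp [Rearr]

/-- The columns of a segment of size `2 ^ m` are segments of size `2 ^ m'`. -/
theorem SegmentsSorted.columns {m m' : ℕ} (hm : m ≤ k) (hm' : m' ≤ m) {x : Input n}
    {w w' : ℕ → Item n} (h : SegmentsSorted k m' x w w') {q : ℕ} (hq : q < 2 ^ (k - m)) :
    (∀ c < 2 ^ (m - m'), Rearr (fun y => w (q * 2 ^ m + y)) (fun y => w' (q * 2 ^ m + y))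
      (c * 2 ^ m') (2 ^ m')) ∧
    (∀ c < 2 ^ (m - m'), SortedOn (itemKey x) (fun y => w' (q * 2 ^ m + y))
      (c * 2 ^ m') (2 ^ m')) := by
  have key : ∀ c < 2 ^ (m - m'), q * 2 ^ (m - m') + c < 2 ^ (k - m') ∧
      q * 2 ^ m + c * 2 ^ m' = (q * 2 ^ (m - m') + c) * 2 ^ m' := by
    intro c hc
    constructor
    · refine mul_add_lt_two_pow (by omega) ?_ hc
      rwa [show k - m' - (m - m') = k - m by omega]
    · rw [add_mul, mul_assoc, ← pow_add, Nat.sub_add_cancel hm']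
  constructor
  · intro c hc
    refine Rearr.shift ?_
    rw [(key c hc).2]
    exact (h _ (key c hc).1).1
  · intro c hc i j hij hj
    have := (h _ (key c hc).1).2 i j hij hj
    rw [← (key c hc).2] at this
    simpa only [add_assoc] using this

/-- Strong induction on the segment size. The tag bound leaves bit `d` free for Phase 6, so columns
are sorted with tags below `2 ^ (d + 1)`, and Phase 8 clears the bit again. -/
theorem exists_exec_schedule (x : Input n) : ∀ m d, 1 ≤ m → m ≤ k → ∀ w : ℕ → Item n,
    (∀ p < 2 ^ k, (w p).2 < 2 ^ d) →
      ∃ w', Exec k x (schedule m d) w w' ∧ SegmentsSorted k m x w w' := by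
  intro m
  induction m using Nat.strong_induction_on with
  | _ m ih =>
  intro d h1 hm w tag0
  rw [schedule]
  split_ifs with h2
  · exact exists_exec_base x h1 h2 hm w
  have hm' : (2 * m + 2) / 3 < m := by omega
  set m' := (2 * m + 2) / 3
  set r := 2 ^ m' with hr
  set s := 2 ^ (m - m') with hs
  have hrs : r * s = 2 ^ m := by rw [hr, hs, ← pow_add]; congr 1; omega
  have hs1 : 1 ≤ s := Nat.one_le_two_pow
  have hst : r = s * 2 ^ (m' - (m - m')) := by
    rw [hr, hs, ← pow_add]; congr 1; omega
  -- In exponents this is `2 * (m - m') ≤ m'`, which holds because `m'` is `2 * m / 3` rounded up.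
  have hsr : s * s ≤ r := by
    rw [hr, hs, ← pow_add]
    exact Nat.pow_le_pow_right (by norm_num) (by omega)
  have hre : r = 2 * 2 ^ (m' - 1) := by
    rw [hr, ← pow_succ']; congr 1; omega
  have hr2 : r / 2 ≤ r * s := (Nat.div_le_self r 2).trans (Nat.le_mul_of_pos_right r hs1)
  have sortCols := fun w hw => ih m' hm' (d + 1) (by omega) (by omega) w hw
  have hd : 2 ^ d ≤ 2 ^ (d + 1) := Nat.pow_le_pow_right (by norm_num) (by omega)
  have route := fun f (hf : PermOn f (r * s)) retag w =>
    exists_exec_route x h1 hm (hrs ▸ hf) retag w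
  have colTag : ∀ {w w' : ℕ → Item n}, SegmentsSorted k m' x w w' →
      (∀ p < 2 ^ k, (w p).2 < 2 ^ d) → ∀ p < 2 ^ k, (w' p).2 < 2 ^ d := fun h =>
    tag_lt_of_rearr (by omega) fun q hq => (h q hq).1
  have routeTag : ∀ {w w' : ℕ → Item n} {f}, PermOn f (r * s) → (∀ q < 2 ^ (k - m), ∀ y < 2 ^ m,
      w' (q * 2 ^ m + f y) = ((w (q * 2 ^ m + y)).1, (w (q * 2 ^ m + y)).2)) →
      (∀ p < 2 ^ k, (w p).2 < 2 ^ d) → ∀ p < 2 ^ k, (w' p).2 < 2 ^ d := fun hf h =>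
    tag_lt_of_rearr hm fun q hq => Rearr.of_perm (hrs ▸ hf) (h q hq)
  have le_tag : ∀ {w : ℕ → Item n}, (∀ p < 2 ^ k, (w p).2 < 2 ^ d) →
      ∀ p < 2 ^ k, (w p).2 < 2 ^ (d + 1) := fun h p hp => (h p hp).trans_le hd
  have ps : PermOn (shiftPos r s) (r * s) := add_mod_permOn hr2
  have pu : PermOn (unshiftPos r s) (r * s) := add_mod_permOn (Nat.sub_le _ _)
  obtain ⟨w1, e1, s1⟩ := sortCols w (le_tag tag0)
  have tag1 := colTag s1 tag0
  obtain ⟨w2, e2, s2⟩ := route _ transposePos_permOn (fun _ τ => τ) w1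
  have tag2 := routeTag transposePos_permOn s2 tag1
  obtain ⟨w3, e3, s3⟩ := sortCols w2 (le_tag tag2)
  have tag3 := colTag s3 tag2
  obtain ⟨w4, e4, s4⟩ := route _ diagonalPos_permOn (fun _ τ => τ) w3
  have tag4 := routeTag diagonalPos_permOn s4 tag3
  obtain ⟨w5, e5, s5⟩ := sortCols w4 (le_tag tag4)
  have tag5 := colTag s5 tag4
  obtain ⟨w6, e6, s6⟩ := route _ ps (shiftTag r s d) w5
  have tag6 : ∀ p < 2 ^ k, (w6 p).2 < 2 ^ (d + 1) := by
    intro p hp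
    have hq := div_two_pow_lt hm hp
    obtain ⟨y, hy, hyp⟩ := ps.exists_eq (p := p % 2 ^ m)
      (by rw [hrs]; exact Nat.mod_lt _ (by positivity))
    rw [hrs] at hy
    have := s6 _ hq y hy
    rw [hyp, mul_comm, Nat.div_add_mod] at this
    rw [this]
    have ht := tag5 _ (mul_add_lt_two_pow hm hq hy)
    rw [mul_comm] at ht
    simp only [shiftTag, pow_succ]
    split_ifs <;> omega
  obtain ⟨w7, e7, s7⟩ := sortCols w6 tag6
  obtain ⟨w8, e8, s8⟩ := route _ pu (fun _ τ => τ % 2 ^ d) w7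
  refine ⟨w8, ((((((e1.append e2).append e3).append e4).append e5).append e6).append e7).append e8,
    fun q hq => ?_⟩
  obtain ⟨c1, o1⟩ := s1.columns hm hm'.le hq
  obtain ⟨c3, o3⟩ := s3.columns hm hm'.le hq
  obtain ⟨c5, o5⟩ := s5.columns hm hm'.le hq
  obtain ⟨c7, o7⟩ := s7.columns hm hm'.le hq
  have t5 : ∀ y < r * s, (w5 (q * 2 ^ m + y)).2 < 2 ^ d := fun y hy =>
    tag5 _ (mul_add_lt_two_pow hm hq (hrs ▸ hy))
  have r2 := s2 q hq
  have r4 := s4 q hq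
  have r6 := s6 q hq
  have r8 := s8 q hq
  have r12 : Rearr w1 w2 (q * 2 ^ m) (2 ^ m) := Rearr.of_perm (hrs ▸ transposePos_permOn) r2
  have r34 : Rearr w3 w4 (q * 2 ^ m) (2 ^ m) := Rearr.of_perm (hrs ▸ diagonalPos_permOn) r4
  rw [← hrs] at r2 r4 r6 r8 r12 r34 c1 o1 c3 o3 c5 o5 c7 o7 t5 ⊢
  have glue : ∀ {w w' : ℕ → Item n}, (∀ c < s, Rearr (fun y => w (q * (r * s) + y))
      (fun y => w' (q * (r * s) + y)) (c * r) r) → Rearr w w' (q * (r * s)) (r * s) := fun h =>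
    rearr_zero_iff.1 (Rearr.mul fun c hc => by simpa using h c hc)
  constructor
  · exact (((((glue c1).trans r12).trans (glue c3)).trans r34).trans (glue c5)).trans
      (rearr_zero_iff.1 (rearr_shift hs1 t5 r6 c7 r8))
  · have := sortedOn_shift (u8 := fun y => w8 (q * (r * s) + y)) hre hs1
      (exists_boundary_of_phases hst hs1 hsr c1 o1 r2 c3 o3 r4 c5 o5)
      t5 r6 c7 o7 r8
    intro i j hij hj
    simpa using this i j hij hj

end Exec

/-! ### Legality and correctness of Columnsort -/

variable {n k : ℕ}

namespace Op.Ready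

theorem length_le {op : Op} {L : Fin (2 ^ k) → List (Item n)} (h : op.Ready L) (r : Fin (2 ^ k)) :
    (L r).length ≤ 4 := by
  cases op with
  | route m f retag =>
    obtain ⟨_, _, _, w, rfl⟩ := h
    simp [single]
  | gather m =>
    obtain ⟨_, _, _, w, rfl⟩ := h
    simp [single]
  | solve m =>
    obtain ⟨_, _, h2, w, hw⟩ := h
    rw [(hw r).length_eq]
    have : 2 ^ m ≤ 2 ^ 2 := Nat.pow_le_pow_right (by norm_num) h2
    split_ifs
    · simpa using this
    · simp

theorem dest_div {op : Op} {L : Fin (2 ^ k) → List (Item n)} (h : op.Ready L) {r : Fin (2 ^ k)}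
    {i : ℕ} (hi : i < (L r).length) :
    (op.dest r i).val / 2 ^ op.logSize = r.val / 2 ^ op.logSize := by
  have hq := div_two_pow_lt h.2.1 r.isLt
  have hM : 0 < 2 ^ op.logSize := by positivity
  have key : ∀ z < 2 ^ op.logSize, (vp k (r.val - r.val % 2 ^ op.logSize + z)).val / 2 ^ op.logSize =
      r.val / 2 ^ op.logSize := fun z hz => by
    rw [sub_mod_eq, vp_val (mul_add_lt_two_pow h.2.1 hq hz), mul_add_div_eq hz]
  cases op with
  | route m f retag => exact key _ (h.2.2.1.lt _ (Nat.mod_lt _ hM))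
  | gather m => exact key 0 hM
  | solve m =>
    obtain ⟨_, _, h2, w, hw⟩ := h
    refine key i ?_
    rw [(hw r).length_eq] at hi
    split_ifs at hi
    · rw [List.length_map, List.length_range] at hi
      exact hi
    · simp at hi

end Op.Ready

theorem itemsAt_zero_eq_single (x : Input (2 ^ k)) :
    itemsAt x 0 = single fun p => (vp k p, 0) := by
  funext r
  rw [itemsAt_zero, single]
  congr 2
  exact Fin.ext (vp_val r.isLt).symm

theorem exec_columnsort (hk : 1 ≤ k) (x : Input (2 ^ k)) :
    ∃ w', Exec k x (schedule k 0) (fun p => (vp k p, 0)) w' ∧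
      SegmentsSorted k k x (fun p => (vp k p, 0)) w' :=
  exists_exec_schedule x k 0 hk le_rfl _ (by simp)

theorem ready_itemsAt (hk : 1 ≤ k) (x : Input (2 ^ k)) {t : ℕ} (ht : t < (schedule k 0).length) :
    (opAt k t).Ready (itemsAt x t) := by
  obtain ⟨w', h, _⟩ := exec_columnsort hk x
  rw [itemsAt_eq_runAll x t ht.le, itemsAt_zero_eq_single, opAt, List.getD_eq_getElem _ _ ht]
  exact h.1.ready ht

theorem length_labels : (columnsort k).labels.length = (schedule k 0).length := List.length_map _

theorem labels_get (t : Fin (columnsort k).labels.length) :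
    (columnsort k).labels.get t = k - (opAt k t).logSize := by
  have ht : t.val < (schedule k 0).length := by rw [← length_labels]; exact t.isLt
  rw [opAt, List.getD_eq_getElem _ _ ht]
  exact List.getElem_map _

theorem ready_of_fin (hk : 1 ≤ k) (x : Input (2 ^ k)) (t : Fin (columnsort k).labels.length) :
    (opAt k t).Ready (itemsAt x t) :=
  ready_itemsAt hk x (by rw [← length_labels]; exact t.isLt)

theorem two_pow_half {m : ℕ} (hm : 1 ≤ m) : 2 ^ m / 2 + 2 ^ m / 2 = 2 ^ m := by
  have : 2 ^ m = 2 * 2 ^ (m - 1) := by rw [← pow_succ']; congr 1; omega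
  omega

theorem columnsort_legal (hk : 1 ≤ k) {c : ℕ} (hc : 1 ≤ c) : (columnsort k).Legal c where
  label_lt := by
    intro i hi
    obtain ⟨t, rfl⟩ := List.get_of_mem hi
    rw [labels_get]
    have x : Input (2 ^ k) := Fin.valEmbedding
    have := (ready_of_fin hk x t).1
    omega
  compares := by
    intro x t r
    rw [columnsort_held]
    change ((opAt k t).body r _).Uses x _
    cases opAt k t with
    | route m f retag => trivial
    | gather m => trivial
    | solve m =>
      simp only [Op.body]
      rw [CmpTree.uses_bind]
      exact ⟨sortItems_uses x _ fun b hb => List.mem_map_of_mem hb, trivial⟩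
  keeps := by
    intro x t r a ha
    rw [columnsort_outcome] at ha
    cases ha
  sends := by
    intro x t r m hm a ha
    rw [columnsort_outcome] at hm
    rcases List.mem_append.1 hm with hm | hm
    · obtain ⟨p, hp, rfl⟩ := List.mem_map.1 hm
      rw [columnsort_held, ← ((opAt k t).map_fst_arrange_perm x r _).mem_iff]
      rw [List.mem_singleton.1 ha]
      exact List.mem_map_of_mem (List.fst_mem_of_mem_zipIdx hp)
    · rw [(keys_of_mem_dummies hm).1] at ha
      cases ha
  size_le := by
    intro x t r m hm
    rw [columnsort_outcome] at hm
    rcases List.mem_append.1 hm with hm | hm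
    · obtain ⟨p, hp, rfl⟩ := List.mem_map.1 hm
      exact hc
    · rw [(keys_of_mem_dummies hm).1]
      exact Nat.zero_le _
  cluster := by
    intro x t r m hm
    have hR := ready_of_fin hk x t
    have hmk : k - (k - (opAt k t).logSize) = (opAt k t).logSize := by
      have := hR.2.1
      omega
    rw [labels_get, topBits, topBits, hmk]
    rw [columnsort_outcome] at hm
    rcases List.mem_append.1 hm with hm | hm
    · obtain ⟨p, hp, rfl⟩ := List.mem_map.1 hm
      have := (List.mem_zipIdx hp).2.1
      rw [Op.length_arrange, zero_add] at this
      exact hR.dest_div this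
    · obtain ⟨_, hlt, hdst⟩ := keys_of_mem_dummies hm
      have h2 := two_pow_half hR.1
      have h3 : 2 ^ (opAt k t).logSize ≤ 2 ^ k := Nat.pow_le_pow_right (by norm_num) hR.2.1
      rw [hdst, vp_val (by omega), Nat.div_eq_of_lt (by omega), Nat.div_eq_of_lt (by omega)]

/-- The whole machine is one segment. All tags are finally `0`, so `g` lists the keys in increasing
order and the position of a key is its rank. -/
theorem columnsort_solves (hk : 1 ≤ k) : (columnsort k).Solves := by
  intro x
  obtain ⟨w, hw, hs⟩ := exec_columnsort hk x
  have hs0 := hs 0 (by simp)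
  rw [zero_mul] at hs0
  obtain ⟨hR, hS⟩ := hs0
  have hfin : itemsAt x (columnsort k).labels.length = single w := by
    rw [length_labels, itemsAt_eq_runAll x _ le_rfl, itemsAt_zero_eq_single, List.take_length]
    exact hw.2
  have htag : ∀ p < 2 ^ k, (w p).2 = 0 := fun p hp => by
    have := tag_lt_of_rearr le_rfl (fun q hq => (hs q hq).1) (B := 1) (by simp) p hp
    omega
  let g : Fin (2 ^ k) → Fin (2 ^ k) := fun r => (w r).1
  have hanswer : ∀ r a, (columnsort k).answer r
      ((columnsort k).config x (columnsort k).labels.length r) a =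
        if a = g r then some r.val else none := by
    intro r a
    change (if a ∈ ((columnsort k).config x _ r).held then _ else _) = _
    rw [columnsort_held, hfin]
    simp [single, g]
  have hvp : ∀ i : Fin (2 ^ k), vp k i = i := fun i => Fin.ext (vp_val i.isLt)
  have hsum : ∀ F : Fin (2 ^ k) → ℕ, ∑ i, F (g i) = ∑ i, F i := by
    intro F
    have := hR fun it => F it.1
    simpa only [zero_add, Finset.sum_range, hvp] using this
  have hsurj : Function.Surjective g := by
    intro a
    have := hsum fun b => if b = a then 1 else 0
    rw [Finset.sum_ite_eq' Finset.univ a, if_pos (Finset.mem_univ a)] at this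
    by_contra hcon
    push Not at hcon
    rw [Finset.sum_eq_zero fun i _ => if_neg (hcon i)] at this
    omega
  have hinj : Function.Injective g := Finite.injective_iff_surjective.2 hsurj
  have hmono : ∀ i j : Fin (2 ^ k), x (g i) < x (g j) ↔ i < j := by
    have hle : ∀ i j : Fin (2 ^ k), i ≤ j → x (g i) ≤ x (g j) := by
      intro i j hij
      have := hS i j hij j.isLt
      rw [zero_add, zero_add, itemKey_le, htag i i.isLt, htag j j.isLt] at this
      simpa using this
    intro i j
    refine ⟨fun h => ?_, fun h => lt_of_le_of_ne (hle i j h.le) fun e => ?_⟩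
    · by_contra hij
      exact absurd (hle j i (not_lt.1 hij)) (not_le.2 h)
    · exact h.ne (hinj (x.injective e))
  have hrank : ∀ r, x.rank (g r) = r := by
    intro r
    have h := hsum fun b => if x b < x (g r) then 1 else 0
    rw [Input.rank, Finset.card_filter, ← h,
      Finset.sum_congr rfl fun i _ => if_congr (hmono i r) rfl rfl, ← Finset.card_filter]
    rw [← Fin.card_Iio r]
    congr 1
    ext i
    rw [Finset.mem_filter, Finset.mem_Iio]
    exact and_iff_right (Finset.mem_univ i)
  intro a
  obtain ⟨r, rfl⟩ := hsurj a
  refine ⟨⟨r, by rw [hanswer, if_pos rfl, hrank]⟩, fun r' b hb => ?_⟩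
  rw [hanswer] at hb
  split_ifs at hb with h
  rw [hrank, hinj h]
  exact (Option.some.inj hb).symm

theorem columnsort_copiesLE {κ : ℕ} (hκ : 1 ≤ κ) : (columnsort k).CopiesLE κ := by
  intro x t _ a
  rw [columnsort_copies]
  exact hκ

/-! ### The number of supersteps of recursive Columnsort -/

/-- The recursion is `T(m) = 4 T(m') + 4` with `m' - 2 ≤ (2 / 3) (m - 2)`. The exponent 4 works
since `4 * (2 / 3) ^ 4 = 64 / 81 < 1`, and 48 since `48 * 17 / 81 ≥ 10` absorbs the additive terms.
-/
theorem length_schedule_le (m d : ℕ) : (schedule m d).length ≤ 2 + 48 * (m - 2) ^ 4 := by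
  induction m using Nat.strong_induction_on generalizing d with
  | _ m ih =>
  rw [schedule]
  split_ifs with h
  · simp
  · have h1 := ih ((2 * m + 2) / 3) (by omega) (d + 1)
    obtain ⟨u, hu⟩ : ∃ u, u + 2 = (2 * m + 2) / 3 := ⟨(2 * m + 2) / 3 - 2, by omega⟩
    obtain ⟨v, hv⟩ : ∃ v, v + 1 + 2 = m := ⟨m - 3, by omega⟩
    have huv : 3 * u ≤ 2 * (v + 1) := by omega
    simp only [List.length_append, List.length_singleton]
    rw [← hu, Nat.add_sub_cancel] at h1
    rw [← hu, ← hv, Nat.add_sub_cancel] at *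
    have h2 : 81 * u ^ 4 ≤ 16 * (v + 1) ^ 4 := by
      have := Nat.pow_le_pow_left huv 4
      rw [mul_pow, mul_pow] at this
      simpa using this
    have h3 : 1 ≤ (v + 1) ^ 4 := Nat.one_le_pow _ _ (by omega)
    omega

theorem logSize_le_of_mem_schedule (m d : ℕ) : ∀ op ∈ schedule m d, op.logSize ≤ m := by
  induction m using Nat.strong_induction_on generalizing d with
  | _ m ih =>
  rw [schedule]
  intro op
  split_ifs with h
  · simp only [List.mem_cons, List.not_mem_nil, or_false]
    rintro (rfl | rfl) <;> exact le_rfl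
  · have h1 := ih ((2 * m + 2) / 3) (by omega) (d + 1) op
    simp only [List.mem_append, List.mem_singleton]
    have h2 : op ∈ schedule ((2 * m + 2) / 3) (d + 1) → op.logSize ≤ m := fun h => by
      have := h1 h
      omega
    rintro (((((((h | rfl) | h) | rfl) | h) | rfl) | h) | rfl) <;>
      first
        | exact h2 h
        | exact le_rfl

/-- Only a bounded number of supersteps act on segments that are much larger than `2 ^ l`. -/
theorem countP_schedule_le {l : ℕ} (hl : 2 ≤ l) (e m d : ℕ) (h : (m - 2) * 2 ^ e ≤ (l - 2) * 3 ^ e) :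
    ((schedule m d).countP fun op => l < op.logSize) + 2 ≤ 2 * 4 ^ e := by
  have hbase : m ≤ l → (schedule m d).countP (fun op => l < op.logSize) = 0 := fun hm => by
    rw [List.countP_eq_zero]
    intro op hop
    have := logSize_le_of_mem_schedule m d op hop
    simp only [decide_eq_true_eq]
    omega
  induction e generalizing m d with
  | zero =>
    rw [hbase (by omega)]
    norm_num
  | succ e ih =>
    have h4 : 1 ≤ 4 ^ e := Nat.one_le_pow _ _ (by norm_num)
    by_cases hm : m ≤ 2
    · rw [hbase (by omega), pow_succ]
      omega
    rw [schedule, if_neg hm]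
    have h1 := ih ((2 * m + 2) / 3) (d + 1) (by
      -- Measured by `m - 2`, each level gains a full factor `2 / 3` in spite of the rounding.
      have h5 : 3 * ((2 * m + 2) / 3 - 2) ≤ 2 * (m - 2) := by omega
      rw [pow_succ, pow_succ] at h
      have h6 := Nat.mul_le_mul_right (2 ^ e) h5
      nlinarith) (fun hm => by
        rw [List.countP_eq_zero]
        intro op hop
        have := logSize_le_of_mem_schedule _ _ op hop
        simp only [decide_eq_true_eq]
        omega)
    -- Four recursive calls and four permutations: `x + 2 ≤ B` gives `(4 * x + 4) + 2 ≤ 4 * B`.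
    have h2 : ∀ op : Op, ([op].countP fun op => l < op.logSize) ≤ 1 := fun op =>
      List.countP_le_length
    simp only [List.countP_append]
    rw [pow_succ]
    have := h2 (.route m (transposePos (2 ^ ((2 * m + 2) / 3)) (2 ^ (m - (2 * m + 2) / 3)))
      fun _ τ => τ)
    have := h2 (.route m (diagonalPos (2 ^ ((2 * m + 2) / 3)) (2 ^ (m - (2 * m + 2) / 3)))
      fun _ τ => τ)
    have := h2 (.route m (shiftPos (2 ^ ((2 * m + 2) / 3)) (2 ^ (m - (2 * m + 2) / 3)))
      (shiftTag (2 ^ ((2 * m + 2) / 3)) (2 ^ (m - (2 * m + 2) / 3)) d))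
    have := h2 (.route m (unshiftPos (2 ^ ((2 * m + 2) / 3)) (2 ^ (m - (2 * m + 2) / 3)))
      fun _ τ => τ % 2 ^ d)
    omega

/-! ### Comparisons and degrees of recursive Columnsort -/

section Bounds

variable {k : ℕ}

theorem columnsort_cost_le (hk : 1 ≤ k) (x : Input (2 ^ k))
    (t : Fin (columnsort k).labels.length) (r : Fin (2 ^ k)) :
    ((columnsort k).body t r ((columnsort k).config x t r)).cost x ≤ 16 := by
  have hlen := (ready_of_fin hk x t).length_le r
  change ((opAt k t).body r _).cost x ≤ 16
  cases opAt k t with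
  | route m f retag => simp [Op.body, CmpTree.cost]
  | gather m => simp [Op.body, CmpTree.cost]
  | solve m =>
    simp only [Op.body, CmpTree.cost_bind, CmpTree.cost, add_zero]
    exact (sortItems_cost x _).trans (Nat.mul_le_mul hlen hlen)

theorem card_topBits_le (j P : ℕ) :
    (Finset.univ.filter fun r : Fin (2 ^ k) => topBits j r = P).card ≤ 2 ^ (k - j) := by
  have h := Finset.card_le_card_of_injOn (s := Finset.univ.filter fun r : Fin (2 ^ k) =>
    topBits j r = P) (t := Finset.range (2 ^ (k - j))) (fun r => r.val % 2 ^ (k - j))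
    (fun r _ => Finset.mem_coe.2 (Finset.mem_range.2 (Nat.mod_lt _ (by positivity)))) (by
      intro r hr s hs h
      replace hr := (Finset.mem_filter.1 (Finset.mem_coe.1 hr)).2
      replace hs := (Finset.mem_filter.1 (Finset.mem_coe.1 hs)).2
      unfold topBits at hr hs
      refine Fin.ext ?_
      rw [← Nat.div_add_mod r.val (2 ^ (k - j)), ← Nat.div_add_mod s.val (2 ^ (k - j)), hr, hs]
      simp only at h
      rw [h])
  simpa using h

/-- The constant is `16 * 50`: at most 16 comparisons per virtual processor and superstep, and at
most `2 + 48 * k ^ 4 ≤ 50 * k ^ 4` supersteps. -/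
theorem columnsort_comparisons_le (hk : 1 ≤ k) (j : ℕ) (x : Input (2 ^ k)) (P : ℕ) :
    (columnsort k).comparisons j x P ≤ 2 ^ (k - j) * (800 * k ^ 4) := by
  have hlen : (columnsort k).labels.length * 16 ≤ 800 * k ^ 4 := by
    rw [length_labels]
    have h1 := length_schedule_le k 0
    have h2 : (k - 2) ^ 4 ≤ k ^ 4 := Nat.pow_le_pow_left (Nat.sub_le _ _) 4
    have h3 : 1 ≤ k ^ 4 := Nat.one_le_pow _ _ hk
    omega
  unfold SortAlg.comparisons
  refine (Finset.sum_le_card_nsmul _ _ (800 * k ^ 4) fun r _ => ?_).trans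
    (Nat.mul_le_mul_right _ (card_topBits_le j P))
  refine (Finset.sum_le_card_nsmul _ _ 16 fun t _ => columnsort_cost_le hk x t r).trans ?_
  simpa using hlen

/-- Folding shares the work among `2 ^ j ≥ 2 ^ (η * k)` processors, and this exponential in `k`
eventually beats `800 * k ^ 4 / ε`. -/
theorem columnsort_workLE {ε η : ℝ} (hε : 0 < ε) (hη : 0 < η) :
    ∃ K : ℕ, ∀ k : ℕ, K ≤ k → ∀ j : ℕ, j ≤ k → ((2 : ℝ) ^ k) ^ η ≤ (2 : ℝ) ^ j →
      (columnsort k).WorkLE ε j := by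
  have hr : 1 < (2 : ℝ) ^ η := Real.one_lt_rpow (by norm_num) hη
  have hlim := tendsto_pow_const_div_const_pow_of_one_lt 4 hr
  obtain ⟨K, hK⟩ := Filter.eventually_atTop.1 (hlim.eventually (gt_mem_nhds
    (show (0 : ℝ) < ε / 800 by positivity)))
  refine ⟨max K 1, fun k hk j hj h x P => ?_⟩
  have h1 := columnsort_comparisons_le (show 1 ≤ k by omega) j x P
  have h2 := hK k (by omega)
  have hpow : ((2 : ℝ) ^ η) ^ k = ((2 : ℝ) ^ k) ^ η := by
    rw [← Real.rpow_natCast, ← Real.rpow_natCast, ← Real.rpow_mul (by norm_num),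
      ← Real.rpow_mul (by norm_num), mul_comm]
  rw [hpow, div_lt_iff₀ (by positivity)] at h2
  have h3 : (800 : ℝ) * k ^ 4 ≤ ε * 2 ^ j := by
    have := mul_le_mul_of_nonneg_left h hε.le
    linarith
  calc ((columnsort k).comparisons j x P : ℝ) ≤ 2 ^ (k - j) * (800 * k ^ 4) := by exact_mod_cast h1
    _ ≤ 2 ^ (k - j) * (ε * 2 ^ j) := by gcongr
    _ = ε * (2 ^ (k - j) * 2 ^ j) := by ring
    _ = ε * ((2 ^ k : ℕ) : ℝ) := by rw [← pow_add, Nat.sub_add_cancel hj]; push_cast; rfl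
    _ ≤ ε * ((2 ^ k : ℕ) : ℝ) * max 1 (Real.logb 2 ((2 ^ k : ℕ) : ℝ)) :=
        le_mul_of_one_le_right (by positivity) (le_max_left _ _)

theorem length_itemsAt_le (hk : 1 ≤ k) (x : Input (2 ^ k)) {t : ℕ}
    (ht : t ≤ (schedule k 0).length) (r : Fin (2 ^ k)) : (itemsAt x t r).length ≤ 4 := by
  rcases ht.lt_or_eq with h | rfl
  · exact (ready_itemsAt hk x h).length_le r
  · obtain ⟨w, hw, _⟩ := exec_columnsort hk x
    rw [itemsAt_eq_runAll x _ le_rfl, itemsAt_zero_eq_single, List.take_length, hw.2]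
    simp [single]

theorem length_dummies_le (n k m : ℕ) (r : Fin (2 ^ k)) : (dummies n k m r).length ≤ 1 := by
  unfold dummies
  split_ifs <;> simp

theorem sum_dummies_le {n m : ℕ} (h1 : 1 ≤ m) (hm : m ≤ k) (d : Fin (2 ^ k)) :
    ∑ s, ((dummies n k m s).countP fun a => a.dst = d) ≤ 1 := by
  have h2 := two_pow_half h1
  have h3 : 2 ^ m ≤ 2 ^ k := Nat.pow_le_pow_right (by norm_num) hm
  calc ∑ s, ((dummies n k m s).countP fun a => a.dst = d)
      ≤ ∑ s : Fin (2 ^ k), if s.val + 2 ^ m / 2 = d.val then 1 else 0 := by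
        refine Finset.sum_le_sum fun s _ => ?_
        split_ifs with h
        · exact List.countP_le_length.trans (length_dummies_le _ _ _ _)
        · refine (List.countP_eq_zero.2 fun a ha => ?_).le
          obtain ⟨_, hs, ha⟩ := keys_of_mem_dummies ha
          rw [decide_eq_true_eq, ha, Fin.ext_iff, vp_val (by omega)]
          exact h
    _ = (Finset.univ.filter fun s : Fin (2 ^ k) => s.val + 2 ^ m / 2 = d.val).card :=
        (Finset.card_filter _ _).symm
    _ ≤ 1 := by
        rw [Finset.card_le_one]
        intro a ha b hb
        simp only [Finset.mem_filter, Finset.mem_univ, true_and] at ha hb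
        exact Fin.ext (by omega)

theorem columnsort_sum_traffic_right_le (hk : 1 ≤ k) (x : Input (2 ^ k))
    (t : Fin (columnsort k).labels.length) (s : Fin (2 ^ k)) :
    ∑ d, (columnsort k).traffic x t s d ≤ 5 := by
  have h := (columnsort k).countP_eq_sum_traffic x t s (fun _ => True)
  simp only [Finset.filter_true] at h
  rw [← h]
  refine List.countP_le_length.trans ?_
  rw [columnsort_outcome]
  simp only [List.length_append, List.length_map, List.length_zipIdx, Op.length_arrange]
  exact Nat.add_le_add ((ready_of_fin hk x t).length_le s) (length_dummies_le _ _ _ _)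

/-- Messages with keys destined to `d` are its list in the next configuration, which has length at
most 4, and at most one dummy is added. -/
theorem columnsort_sum_traffic_left_le (hk : 1 ≤ k) (x : Input (2 ^ k))
    (t : Fin (columnsort k).labels.length) (d : Fin (2 ^ k)) :
    ∑ s, (columnsort k).traffic x t s d ≤ 5 := by
  simp only [columnsort_traffic, Finset.sum_add_distrib]
  rw [← length_itemsAt_succ]
  have hR := ready_of_fin hk x t
  have ht : t.val + 1 ≤ (schedule k 0).length := by rw [← length_labels]; exact t.isLt
  exact Nat.add_le_add (length_itemsAt_le hk x ht d) (sum_dummies_le hR.1 hR.2.1 d)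

theorem columnsort_degree_le (hk : 1 ≤ k) (j : ℕ) (x : Input (2 ^ k))
    (t : Fin (columnsort k).labels.length) : (columnsort k).degree j x t ≤ 2 ^ (k - j) * 5 := by
  refine Finset.sup_le fun P _ => max_le ?_ ?_
  · refine (Finset.sum_le_card_nsmul _ _ 5 fun s _ => ?_).trans
      (Nat.mul_le_mul_right _ (card_topBits_le j P))
    exact (Finset.sum_le_sum_of_subset (Finset.filter_subset _ _)).trans
      (columnsort_sum_traffic_right_le hk x t s)
  · rw [SortAlg.receivedBy, Finset.sum_comm]
    refine (Finset.sum_le_card_nsmul _ _ 5 fun s _ => ?_).trans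
      (Nat.mul_le_mul_right _ (card_topBits_le j P))
    exact (Finset.sum_le_sum_of_subset (Finset.filter_subset _ _)).trans
      (columnsort_sum_traffic_left_le hk x t s)

end Bounds

/-! ### Communication time -/

namespace SortAlg

variable {n k : ℕ}

theorem numSupersteps_eq_card (A : SortAlg n k) (i : ℕ) :
    A.numSupersteps i = (Finset.univ.filter fun t : Fin A.labels.length =>
      A.labels.get t = i).card := by
  have key : ∀ l : List ℕ, l.count i = (l.map fun a => if a = i then 1 else 0).sum := by
    intro l
    induction l with
    | nil => rfl
    | cons a l ih => simp [List.count_cons, ih, add_comm]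
  rw [numSupersteps, key, Finset.card_filter, ← Fin.sum_univ_fun_getElem]
  rfl

theorem sum_numSupersteps (A : SortAlg n k) (j : ℕ) :
    ∑ i : Fin j, A.numSupersteps i = A.labels.countP fun i => i < j := by
  unfold numSupersteps
  induction A.labels with
  | nil => simp
  | cons a l ih =>
    simp only [List.count_cons, List.countP_cons, Finset.sum_add_distrib, ih]
    congr 1
    rw [Finset.sum_fin_eq_sum_range]
    by_cases h : a < j
    · rw [Finset.sum_eq_single a]
      · simp [h]
      · intro b _ hb
        by_cases h1 : b < j
        · rw [dif_pos h1, if_neg (by simpa using hb.symm)]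
        · rw [dif_neg h1]
      · simp [h]
    · rw [Finset.sum_eq_zero]
      · simp [h]
      · intro b hb
        have := Finset.mem_range.1 hb
        rw [dif_pos this, if_neg (by simpa using (show a ≠ b by omega))]

theorem Static.commTime_eq {A : SortAlg n k} (hA : A.Static) (j : ℕ) (g ℓ : Fin j → ℝ)
    (x : Input n) :
    A.commTime j g ℓ = ∑ i : Fin j, (A.cumDegree j x i * g i + A.numSupersteps i * ℓ i) := by
  have hc : ∀ y : Input n, ∀ i, A.cumDegree j y i = A.cumDegree j x i := by
    intro y i
    unfold cumDegree degree sentBy receivedBy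
    simp only [hA y x]
  have : Nonempty (Input n) := ⟨x⟩
  unfold commTime
  simp only [hc]
  exact ciSup_const

end SortAlg

/-- Each `ℓ i` is the product of `ℓ i / g i` and `g i`, both nonnegative and non-increasing, so `ℓ i
≤ ℓ 0`. Every non-local superstep then costs no more than one with label `0`. -/
theorem columnsort_commTime_le {k j : ℕ} (hk : 1 ≤ k) (g ℓ : Fin (j + 1) → ℝ)
    (hg0 : ∀ i, 0 < g i) (hg : Antitone g) (hℓg : Antitone fun i => ℓ i / g i)
    (hℓ0 : ∀ i, 0 ≤ ℓ i) :
    (columnsort k).commTime (j + 1) g ℓ ≤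
      ((columnsort k).labels.countP fun i => i < j + 1) *
        (5 * 2 ^ (k - (j + 1)) * g 0 + ℓ 0) := by
  have hℓ : ∀ i, ℓ i ≤ ℓ 0 := fun i => by
    have h1 := hℓg (Fin.zero_le i)
    simp only at h1
    rw [div_le_div_iff₀ (hg0 i) (hg0 0)] at h1
    have h2 : ℓ 0 * g i ≤ ℓ 0 * g 0 := mul_le_mul_of_nonneg_left (hg (Fin.zero_le i)) (hℓ0 0)
    exact le_of_mul_le_mul_right (h1.trans h2) (hg0 0)
  let x : Input (2 ^ k) := Fin.valEmbedding
  rw [columnsort_static.commTime_eq _ _ _ x, ← SortAlg.sum_numSupersteps, Nat.cast_sum,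
    Finset.sum_mul]
  refine Finset.sum_le_sum fun i _ => ?_
  have h1 : (columnsort k).cumDegree (j + 1) x i ≤
      (columnsort k).numSupersteps i * (2 ^ (k - (j + 1)) * 5) := by
    rw [SortAlg.numSupersteps_eq_card]
    exact Finset.sum_le_card_nsmul _ _ _ fun t _ => columnsort_degree_le hk (j + 1) x t
  have h2 : ((columnsort k).cumDegree (j + 1) x i : ℝ) ≤
      (columnsort k).numSupersteps i * (2 ^ (k - (j + 1)) * 5) := by exact_mod_cast h1
  have h3 := mul_le_mul h2 (hg (Fin.zero_le i)) (hg0 i).le (by positivity)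
  have h4 := mul_le_mul_of_nonneg_left (hℓ i)
    (Nat.cast_nonneg (α := ℝ) ((columnsort k).numSupersteps i))
  linarith

theorem countP_labels_eq {k j : ℕ} (hj : j ≤ k) :
    ((columnsort k).labels.countP fun i => i < j) =
      (schedule k 0).countP fun op => k - j < op.logSize := by
  change ((schedule k 0).map fun op => k - op.logSize).countP _ = _
  rw [List.countP_map]
  refine List.countP_congr fun op hop => ?_
  have := logSize_le_of_mem_schedule k 0 op hop
  simp only [Function.comp_apply, decide_eq_true_eq]
  omega

/-- Only the term with label `0` is kept. Its cumulative degree is at least `M > 0`, which forces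
the existence of a 0-superstep and hence the summand `ℓ 0`. -/
theorem le_commTime {n k j : ℕ} {A : SortAlg n k} {c : ℕ} (hA : A.Legal c) (hs : A.Static)
    (hj : j + 1 ≤ k) (g ℓ : Fin (j + 1) → ℝ) (hg0 : ∀ i, 0 < g i) (hℓ0 : ∀ i, 0 ≤ ℓ i)
    {x : Input n} {M : ℝ} (hM0 : 0 < M) (hM : 2 ^ (j + 1) * M ≤ A.crossing x) :
    M * g 0 + ℓ 0 ≤ A.commTime (j + 1) g ℓ := by
  have h1 : (A.crossing x : ℝ) ≤ 2 ^ (j + 1) * A.cumDegree (j + 1) x 0 := by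
    exact_mod_cast SortAlg.crossing_le_cumDegree hA x (show 1 ≤ j + 1 by omega) hj
  have h2 : M ≤ A.cumDegree (j + 1) x 0 :=
    le_of_mul_le_mul_left (hM.trans h1) (by positivity)
  have h3 : 1 ≤ A.numSupersteps 0 := by
    by_contra hcon
    have h4 : A.numSupersteps 0 = 0 := by omega
    rw [SortAlg.numSupersteps_eq_card, Finset.card_eq_zero] at h4
    rw [SortAlg.cumDegree, h4, Finset.sum_empty] at h2
    norm_num at h2
    linarith
  have h3' : (1 : ℝ) ≤ A.numSupersteps 0 := by exact_mod_cast h3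
  rw [hs.commTime_eq _ _ _ x]
  refine le_trans ?_ (Finset.single_le_sum (f := fun i : Fin (j + 1) =>
    (A.cumDegree (j + 1) x i * g i + A.numSupersteps i * ℓ i)) (fun i _ => ?_)
    (Finset.mem_univ 0))
  · have h5 := mul_le_mul_of_nonneg_right h2 (hg0 0).le
    have h6 := mul_le_mul_of_nonneg_right h3' (hℓ0 0)
    simp only [Fin.val_zero]
    linarith
  · have := (hg0 i).le
    have := hℓ0 i
    positivity

/-- The segments on which supersteps with non-local communication act are large. -/
theorem exists_exponent {δ C : ℝ} (hδ0 : 0 < δ) (hC : 0 < C) :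
    ∃ e K : ℕ, ∀ k j : ℕ, K ≤ k → (2 : ℝ) ^ j ≤ C * ((2 : ℝ) ^ k) ^ (1 - δ) →
      j ≤ k ∧ 2 ≤ k - j ∧ (k - 2) * 2 ^ e ≤ (k - j - 2) * 3 ^ e := by
  obtain ⟨e, he⟩ := exists_pow_lt_of_lt_one (show (0 : ℝ) < δ / 2 by positivity)
    (show (2 / 3 : ℝ) < 1 by norm_num)
  -- This threshold gives `δ / 2 * k ≥ log C + 2`, so that half of `δ * k` absorbs the constants: `k
  -- - j ≥ δ / 2 * k + 2`.
  refine ⟨e, max 2 ⌈(Real.logb 2 C + 2) * 2 / δ⌉₊, fun k j hk h => ?_⟩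
  have hk2 : 2 ≤ k := (le_max_left _ _).trans hk
  have hkC : (Real.logb 2 C + 2) * 2 / δ ≤ k :=
    (Nat.le_ceil _).trans (by exact_mod_cast (le_max_right _ _).trans hk)
  rw [div_le_iff₀ hδ0] at hkC
  have hlog := Real.logb_le_logb_of_le (b := 2) (by norm_num) (by positivity) h
  rw [Real.logb_mul hC.ne' (by positivity), Real.logb_rpow_eq_mul_logb_of_pos (by positivity),
    Real.logb_pow, Real.logb_pow, Real.logb_self_eq_one (by norm_num)] at hlog
  have hl : δ / 2 * k + 2 ≤ (k : ℝ) - j := by linarith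
  have hk0 : (0 : ℝ) ≤ k := Nat.cast_nonneg k
  have hjk : j + 2 ≤ k := by
    have : (j : ℝ) + 2 ≤ k := by nlinarith
    exact_mod_cast this
  refine ⟨by omega, by omega, ?_⟩
  have key : ((k : ℝ) - 2) * 2 ^ e ≤ (k - j - 2) * 3 ^ e := by
    have h1 : ((2 : ℝ) / 3) ^ e * (k - 2) ≤ k - j - 2 := by
      have h2 : (2 : ℝ) ≤ k := by exact_mod_cast hk2
      calc ((2 : ℝ) / 3) ^ e * (k - 2) ≤ δ / 2 * (k - 2) := by
            apply mul_le_mul_of_nonneg_right he.le; linarith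
        _ ≤ k - j - 2 := by linarith
    rw [div_pow] at h1
    have h3 : (0 : ℝ) < 3 ^ e := by positivity
    have h4 := mul_le_mul_of_nonneg_right h1 h3.le
    have h5 : (2 : ℝ) ^ e / 3 ^ e * (k - 2) * 3 ^ e = (k - 2) * 2 ^ e := by field_simp
    linarith
  have e1 : ((k - 2 : ℕ) : ℝ) = k - 2 := by push_cast [hk2]; rfl
  have e2 : ((k - j - 2 : ℕ) : ℝ) = k - j - 2 := by
    rw [Nat.cast_sub (by omega), Nat.cast_sub (by omega)]; norm_num
  rw [← e1, ← e2] at key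
  exact_mod_cast key

theorem columnsort_optimal {ε : ℝ} (hε0 : 0 < ε) (hε1 : ε < 1) {c : ℕ} (hc : 1 ≤ c) {δ C : ℝ}
    (hδ0 : 0 < δ) (hC : 0 < C) :
    ∃ β : ℝ, 0 < β ∧ β ≤ 1 ∧ ∃ K : ℕ, ∀ k : ℕ, K ≤ k →
      ∀ j : ℕ, 1 ≤ j → (2 : ℝ) ^ j ≤ C * ((2 : ℝ) ^ k) ^ (1 - δ) →
      ∀ g ℓ : Fin j → ℝ, (∀ i, 0 < g i) → (∀ i, 0 ≤ ℓ i) →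
        Antitone g → Antitone (fun i => ℓ i / g i) →
      ∀ (k' : ℕ) (B : SortAlg (2 ^ k) k'), j ≤ k' → B.Legal c → B.Solves → B.Static →
        B.WorkLE ε 1 → (columnsort k).commTime j g ℓ ≤ 1 / β * B.commTime j g ℓ := by
  obtain ⟨K1, hK1⟩ := SortAlg.exists_le_crossing hε0 hε1 hc
  obtain ⟨e, K2, hK2⟩ := exists_exponent hδ0 hC
  have hc1 : (1 : ℝ) ≤ c := by exact_mod_cast hc
  have hα : 0 < (1 - ε) / (4 * c) := div_pos (by linarith) (by positivity)
  have hα1 : (1 - ε) / (4 * c) ≤ 1 := by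
    rw [div_le_one (by positivity)]
    linarith
  set α : ℝ := (1 - ε) / (4 * c)
  have hS : (1 : ℝ) ≤ 2 * 4 ^ e := by
    have : (1 : ℝ) ≤ 4 ^ e := one_le_pow₀ (by norm_num)
    linarith
  set S : ℝ := 2 * 4 ^ e with hSdef
  -- `S` bounds the number of non-local supersteps, `5` is the degree per virtual processor, and `α`
  -- is the crossing fraction.
  refine ⟨α / (5 * S), by positivity, ?_, max K1 (max K2 1), ?_⟩
  · rw [div_le_one (by positivity)]
    linarith
  intro k hk j hj1 hjC g ℓ hg0 hℓ0 hg hℓg k' B hjk' hL hSol hSt hW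
  obtain ⟨j, rfl⟩ : ∃ i, j = i + 1 := ⟨j - 1, by omega⟩
  obtain ⟨hjk, hl, he⟩ := hK2 k (j + 1) (by omega) hjC
  obtain ⟨x, hx⟩ := hK1 k k' (by omega) (by omega) B hL hSol hW
  have hup := columnsort_commTime_le (show 1 ≤ k by omega) g ℓ hg0 hg hℓg hℓ0
  have hlow := le_commTime hL hSt hjk' g ℓ hg0 hℓ0 (M := α * 2 ^ (k - (j + 1))) (x := x)
    (by positivity) (by
      refine le_trans (le_of_eq ?_) hx
      rw [mul_left_comm, ← pow_add]
      congr 2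
      omega)
  have hcount : (((columnsort k).labels.countP fun i => i < j + 1 : ℕ) : ℝ) ≤ S := by
    rw [countP_labels_eq hjk, hSdef]
    have := countP_schedule_le hl e k 0 he
    exact_mod_cast (show _ ≤ 2 * 4 ^ e by omega)
  have hgg := hg0 0
  have hll := hℓ0 0
  set l := k - (j + 1)
  calc (columnsort k).commTime (j + 1) g ℓ
      ≤ S * (5 * 2 ^ l * g 0 + ℓ 0) := hup.trans (by gcongr)
    _ ≤ 5 * S / α * (α * 2 ^ l * g 0 + ℓ 0) := by
        have h1 : 5 * S / α * (α * 2 ^ l * g 0) = S * (5 * 2 ^ l * g 0) := by field_simp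
        -- The latency term needs only `α ≤ 5`, which follows from `α ≤ 1`.
        have h2 : S * ℓ 0 ≤ 5 * S / α * ℓ 0 := by
          refine mul_le_mul_of_nonneg_right ?_ hll
          rw [le_div_iff₀ hα]
          have := mul_le_mul_of_nonneg_left hα1 (show 0 ≤ S by linarith)
          linarith
        rw [mul_add, mul_add, h1]
        linarith
    _ ≤ 5 * S / α * B.commTime (j + 1) g ℓ := by gcongr
    _ = 1 / (α / (5 * S)) * B.commTime (j + 1) g ℓ := by rw [one_div_div]

end NetObl

/-- Recursive Columnsort is a static `n`-sort algorithm on `n = 2 ^ k` virtual processors, and its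
communication time on D-BSP machines with `p = O(n ^ (1 - δ))` processors and non-increasing `g i`
and `ℓ i / g i` is within a constant factor of that of every algorithm of the class. -/
theorem mainTheorem8 (ε : ℝ) (hε0 : 0 < ε) (hε1 : ε < 1) (κ c : ℕ) (hκ : 1 ≤ κ) (hc : 1 ≤ c) :
    (∀ k : ℕ, 1 ≤ k →
      (NetObl.columnsort k).Legal c ∧ (NetObl.columnsort k).Solves ∧
        (NetObl.columnsort k).Static ∧ (NetObl.columnsort k).CopiesLE κ) ∧
    (∀ η : ℝ, 0 < η → ∃ N : ℕ, ∀ k : ℕ, N ≤ 2 ^ k → ∀ j : ℕ, j ≤ k →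
      ((2 : ℝ) ^ k) ^ η ≤ (2 : ℝ) ^ j → (NetObl.columnsort k).WorkLE ε j) ∧
    (∀ δ C : ℝ, 0 < δ → δ < 1 → 0 < C →
      ∃ β : ℝ, 0 < β ∧ β ≤ 1 ∧ ∃ N : ℕ, ∀ k : ℕ, N ≤ 2 ^ k →
        ∀ j : ℕ, 1 ≤ j → (2 : ℝ) ^ j ≤ C * ((2 : ℝ) ^ k) ^ (1 - δ) →
        ∀ g ℓ : Fin j → ℝ, (∀ i, 0 < g i) → (∀ i, 0 ≤ ℓ i) →
          Antitone g → Antitone (fun i => ℓ i / g i) →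
        ∀ (k' : ℕ) (B : NetObl.SortAlg (2 ^ k) k'), j ≤ k' → B.InClass ε κ c →
          (NetObl.columnsort k).commTime j g ℓ ≤ 1 / β * B.commTime j g ℓ) := by
  refine ⟨fun k hk => ⟨NetObl.columnsort_legal hk hc, NetObl.columnsort_solves hk,
    NetObl.columnsort_static, NetObl.columnsort_copiesLE hκ⟩, fun η hη => ?_,
    fun δ C hδ0 _ hC => ?_⟩
  · obtain ⟨K, hK⟩ := NetObl.columnsort_workLE hε0 hη
    exact ⟨2 ^ K, fun k hk => hK k ((Nat.pow_le_pow_iff_right (by norm_num)).1 hk)⟩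
  · obtain ⟨β, hβ0, hβ1, K, hK⟩ := NetObl.columnsort_optimal hε0 hε1 hc hδ0 hC
    refine ⟨β, hβ0, hβ1, 2 ^ K, fun k hk j hj hjC g ℓ hg0 hℓ0 hg hℓ k' B hk' hB => ?_⟩
    -- The lower bound needs the work bound only for the folding onto two processors.
    exact hK k ((Nat.pow_le_pow_iff_right (by norm_num)).1 hk) j hj hjC g ℓ hg0 hℓ0 hg hℓ k' B hk'
      hB.legal hB.solves hB.static (hB.work 1 le_rfl (hj.trans hk'))
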